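/- \textbf{Theorem (asymptotic power of the semi-supervised kernel test xssMMD with the linear kernel).} Let $\Phi$ be the distribution function of $N(0,1)$, $z_p=\Phi^{-1}(p)$, and let $\alpha\in(0,1)$. Consider a sequence of experiments along which the sample size $n\to\infty$ runs through even integers and the dimension $d=d_n$ satisfies $d/n\to\tau\in(0,\infty)$; all quantities below may depend on the experiment. The constants $c,C$ do not. \emph{Model.} Let $(X,V)\sim P_{XV}=N\big((\mu_X,\mu_V),\Sigma\big)$ and $(Y,W)\sim P_{YW}=N\big((\mu_Y,\mu_W),\Sigma\big)$, where $X,V,Y,W$ are $\mathbb R^d$-valued and $\Sigma=\begin{pmatrix}\Sigma_{11}&\Sigma_{12}\\ \Sigma_{21}&\Sigma_{22}\end{pmatrix}$ is a common (positive semidefinite) covariance matrix. There are constants $0<c\le C$ such that all eigenvalues of $\Sigma_{11}$ and $\Sigma_{22}$ lie in $[c,C]$, and $\|\mu_X\|^2=O(\sqrt d/n)$, $\|\mu_Y\|^2=O(\sqrt d/n)$. \emph{Data} (all independent). Labeled pairs $(X_i,V_i)_{i=1}^{n}$ i.i.d. from $P_{XV}$; unlabeled covariates $V_{n+1},\dots,V_{2n}$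 i.i.d. with the law of $V$; an additional sample $\widetilde X_1,\dots,\widetilde X_n$ i.i.d. with the law of $X$; and likewise $(Y_i,W_i)_{i=1}^n$, $W_{n+1},\dots,W_{2n}$, $\widetilde Y_1,\dots,\widetilde Y_n$ from $P_{YW}$ and its marginals (so $n_1=n_2=m_1=m_2=n$). \emph{Statistic.} With the linear kernel the witness function is $\widehat f(x)=\frac1n\sum_{i=1}^n\langle\widetilde X_i,x\rangle-\frac1n\sum_{i=1}^n\langle\widetilde Y_i,x\rangle$. A (measurable) regression procedure produces, from a function $f$ and a training sample of $n/2$ labeled pairs, an estimate $v\mapsto\widehat{\mathbb E}[f(X)\mid V=v]$; another one is used for $(Y,W)$. For $1\le i\le 2n$ let $\widehat e_i=\widehat{\mathbb E}[\widehat f(X_i)\mid V_i]$ be the estimate for $f=\widehat f$, evaluated at $V_i$ and trained on the labeled pairs with even index if $i$ is odd and on those with odd index if $i$ is even, and put $\widehat r_i=\widehat f(X_i)-\widehat e_i$ for $1\le i\le n$. Let $$\widehat\mu_X^\dagger=\frac1n\sum_{i=1}^n\widehat r_i+\frac1{2n}\sum_{i=1}^{2n}\widehat e_i,\qquad \widehat\sigma_X^{\dagger2}=\frac1n\Big\{\frac1n\sum_{i=1}^n\widehat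 r_i^2-\Big(\frac1n\sum_{i=1}^n\widehat r_i\Big)^2\Big\}+\frac1{2n}\Big\{\frac1{2n}\sum_{i=1}^{2n}\widehat e_i^2-\Big(\frac1{2n}\sum_{i=1}^{2n}\widehat e_i\Big)^2\Big\},$$ and define $\widehat\mu_Y^\dagger,\widehat\sigma_Y^{\dagger2}$ in the same way from $(Y,W)$. The xssMMD test rejects, $\Psi_{\mathrm{xss}}=1$, if $(\widehat\mu_X^\dagger-\widehat\mu_Y^\dagger)/\sqrt{\widehat\sigma_X^{\dagger2}+\widehat\sigma_Y^{\dagger2}}>z_{1-\alpha}$, and $\Psi_{\mathrm{xss}}=0$ otherwise. \emph{Consistency of the estimated conditional expectations.} With $(X,V)$ independent of $\widehat f$ and of the training sample, $$\frac{\mathbb E\big[\{\mathbb E[\widehat f(X)\mid V,\widehat f]-\widehat{\mathbb E}[\widehat f(X)\mid V]\}^2\,\big|\,\widehat f\,\big]}{\mathrm{Var}\{\widehat f(X)\mid\widehat f\}}=o_P(1),$$ where the expectation in the numerator is over the new pair $(X,V)$ and over a training sample of $n/2$ independent pairs from $P_{XV}$, and the analogous condition holds for $(Y,W)$. \emph{Conclusion.}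 As $n\to\infty$, $$\mathbb E[\Psi_{\mathrm{xss}}]=\Phi\left(z_\alpha+\frac{n\,\|\mu_X-\mu_Y\|^2}{\sqrt{4\,\mathrm{tr}(\Sigma_{11}^2)-2\,\mathrm{tr}(\Sigma_{12}\Sigma_{22}^{-1}\Sigma_{21}\Sigma_{11})}}\right)+o(1).$$ -/

import Mathlib

open MeasureTheory ProbabilityTheory Filter Topology
open scoped ENNReal RealInnerProductSpace

namespace XssMMD

noncomputable section

/-- The feature space `ℝ^d`. -/
abbrev Vec (d : ℕ) : Type := EuclideanSpace ℝ (Fin d)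

/-- The joint law `N((μ₁, μ₂), [[S₁₁, S₁₂], [S₂₁, S₂₂]])` of a pair of random vectors of `ℝ^d`. -/
def gaussianPair {d : ℕ} (μ₁ μ₂ : Vec d) (S₁₁ S₁₂ S₂₁ S₂₂ : Matrix (Fin d) (Fin d) ℝ) :
    Measure (Vec d × Vec d) :=
  (multivariateGaussian (WithLp.toLp 2 (Sum.elim (fun i => μ₁ i) (fun i => μ₂ i)))
      (Matrix.fromBlocks S₁₁ S₁₂ S₂₁ S₂₂)).map
    (fun z : EuclideanSpace ℝ (Fin d ⊕ Fin d) =>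
      ((WithLp.toLp 2 (fun i => z (Sum.inl i)) : Vec d),
        (WithLp.toLp 2 (fun i => z (Sum.inr i)) : Vec d)))

/-- The observations of one group: the independent copies `X̃₁, …, X̃ₙ` used for the witness
function, the labeled pairs `(X₁, V₁), …, (Xₙ, Vₙ)`, and the unlabeled covariates
`Vₙ₊₁, …, Vₙ₊ₘ`. Indices are `0`-based. -/
abbrev GroupData (d n m : ℕ) : Type :=
  (Fin n → Vec d) × (Fin n → Vec d × Vec d) × (Fin m → Vec d)

/-- The law of the observations of one group: everything is mutually independent, the pairs have
law `P`, the copies and the unlabeled covariates have its first and its second marginal. -/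
def groupLaw {d : ℕ} (P : Measure (Vec d × Vec d)) (n m : ℕ) : Measure (GroupData d n m) :=
  (Measure.pi fun _ : Fin n => P.fst).prod
    ((Measure.pi fun _ : Fin n => P).prod (Measure.pi fun _ : Fin m => P.snd))

/-- The law of all observations, the two groups being independent. -/
def dataLaw {d : ℕ} (P Q : Measure (Vec d × Vec d)) (n₁ n₂ m₁ m₂ : ℕ) :
    Measure (GroupData d n₁ m₁ × GroupData d n₂ m₂) :=
  (groupLaw P n₁ m₁).prod (groupLaw Q n₂ m₂)

/-- The linear kernel `k(x, y) = ⟨x, y⟩`. -/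
def linearKernel {d : ℕ} (x y : Vec d) : ℝ := ⟪x, y⟫

/-- The estimated witness function
`f̂ = n₁⁻¹ ∑ᵢ k(X̃ᵢ, ·) - n₂⁻¹ ∑ᵢ k(Ỹᵢ, ·)`. -/
def witness {d n₁ n₂ : ℕ} (k : Vec d → Vec d → ℝ) (X : Fin n₁ → Vec d) (Y : Fin n₂ → Vec d) :
    Vec d → ℝ :=
  fun x => (∑ i, k (X i) x) / n₁ - (∑ i, k (Y i) x) / n₂

/-- A regression procedure: from a function `f` and a training sample of `h` labeled pairs
`(Xᵢ, Vᵢ)`, it produces an estimate `v ↦ Ê[f(X) | V = v]`. -/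
abbrev Regression (d h : ℕ) : Type :=
  (Vec d → ℝ) → (Fin h → Vec d × Vec d) → Vec d → ℝ

/-- Applied to the witness function, the regression procedure is a measurable function of the
data and of the evaluation point. -/
def MeasurableRegression {d h : ℕ} (k : Vec d → Vec d → ℝ) (n₁ n₂ : ℕ) (est : Regression d h) :
    Prop :=
  Measurable fun p : ((Fin n₁ → Vec d) × (Fin n₂ → Vec d)) × (Fin h → Vec d × Vec d) × Vec d =>
    est (witness k p.1.1 p.1.2) p.2.1 p.2.2

/-- The half of a sample with odd `1`-based indices. -/
def foldA {α : Type} {n : ℕ} (L : Fin n → α) : Fin (n / 2) → α :=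
  fun j => L ⟨2 * j, by omega⟩

/-- The half of a sample with even `1`-based indices. -/
def foldB {α : Type} {n : ℕ} (L : Fin n → α) : Fin (n / 2) → α :=
  fun j => L ⟨2 * j + 1, by omega⟩

/-- All covariates of a group, labeled ones first. -/
def covariates {d n m : ℕ} (L : Fin n → Vec d × Vec d) (U : Fin m → Vec d) :
    Fin (n + m) → Vec d :=
  Fin.append (fun i => (L i).2) U

/-- The cross-fitted values `Ê[f(Xᵢ) | Vᵢ]`, `1 ≤ i ≤ n + m`: the estimator is trained on the
labeled pairs with even index if `i` is odd, and on those with odd index if `i` is even. -/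
def crossFit {d n m : ℕ} (est : Regression d (n / 2)) (f : Vec d → ℝ)
    (L : Fin n → Vec d × Vec d) (U : Fin m → Vec d) (i : Fin (n + m)) : ℝ :=
  if Odd ((i : ℕ) + 1) then est f (foldB L) (covariates L U i)
  else est f (foldA L) (covariates L U i)

/-- The residuals `f(Xᵢ) - Ê[f(Xᵢ) | Vᵢ]`, `1 ≤ i ≤ n`. -/
def residual {d n m : ℕ} (est : Regression d (n / 2)) (f : Vec d → ℝ)
    (L : Fin n → Vec d × Vec d) (U : Fin m → Vec d) (i : Fin n) : ℝ :=
  f (L i).1 - crossFit est f L U (Fin.castAdd m i)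

/-- Sample mean. -/
def empMean {n : ℕ} (a : Fin n → ℝ) : ℝ := (∑ i, a i) / n

/-- Sample variance `n⁻¹ ∑ aᵢ² - (n⁻¹ ∑ aᵢ)²`. -/
def empVar {n : ℕ} (a : Fin n → ℝ) : ℝ := empMean (fun i => a i ^ 2) - empMean a ^ 2

/-- The cross-fitted semi-supervised mean estimator of one group. -/
def crossMean {d n m : ℕ} (est : Regression d (n / 2)) (f : Vec d → ℝ)
    (L : Fin n → Vec d × Vec d) (U : Fin m → Vec d) : ℝ :=
  empMean (residual est f L U) + empMean (crossFit est f L U)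

/-- The cross-fitted estimator of the variance of the mean estimator of one group. -/
def crossVar {d n m : ℕ} (est : Regression d (n / 2)) (f : Vec d → ℝ)
    (L : Fin n → Vec d × Vec d) (U : Fin m → Vec d) : ℝ :=
  empVar (residual est f L U) / n + empVar (crossFit est f L U) / ((n + m : ℕ) : ℝ)

/-- The witness function of a data set. -/
def dataWitness {d n₁ n₂ m₁ m₂ : ℕ} (k : Vec d → Vec d → ℝ)
    (D : GroupData d n₁ m₁ × GroupData d n₂ m₂) : Vec d → ℝ :=
  witness k D.1.1 D.2.1

/-- The studentized cross-fitted statistic. -/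
def statistic {d n₁ n₂ m₁ m₂ : ℕ} (k : Vec d → Vec d → ℝ)
    (estX : Regression d (n₁ / 2)) (estY : Regression d (n₂ / 2))
    (D : GroupData d n₁ m₁ × GroupData d n₂ m₂) : ℝ :=
  (crossMean estX (dataWitness k D) D.1.2.1 D.1.2.2 -
      crossMean estY (dataWitness k D) D.2.2.1 D.2.2.2) /
    √(crossVar estX (dataWitness k D) D.1.2.1 D.1.2.2 +
      crossVar estY (dataWitness k D) D.2.2.1 D.2.2.2)

/-- The standard normal distribution function. -/
def Phi (x : ℝ) : ℝ := cdf (gaussianReal 0 1) x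

/-- The quantile of order `p ∈ (0, 1)` of the standard normal distribution. -/
def z (p : ℝ) : ℝ := sInf {x : ℝ | p ≤ Phi x}

/-- The power of the test of nominal level `α`, which rejects when the statistic exceeds
`z (1 - α)`: the probability of rejection. -/
def power {d : ℕ} (k : Vec d → Vec d → ℝ) (P Q : Measure (Vec d × Vec d)) (n₁ n₂ m₁ m₂ : ℕ)
    (estX : Regression d (n₁ / 2)) (estY : Regression d (n₂ / 2)) (α : ℝ) : ℝ :=
  (dataLaw P Q n₁ n₂ m₁ m₂).real {D | z (1 - α) < statistic k estX estY D}

/-- For a given function `f`, the ratio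
`E[(E[f(X) | V] - Ê[f(X) | V])²] / Var(f(X))`, where `(X, V) ∼ P` is independent of the training
sample of `h` independent pairs with law `P`, over which the expectation is taken as well.
As the witness function is independent of `(X, V)` and of the training sample, conditioning on it
amounts to taking it for `f`. -/
def relMSE {d h : ℕ} (P : Measure (Vec d × Vec d)) (est : Regression d h) (f : Vec d → ℝ) :
    ℝ≥0∞ :=
  (∫⁻ t, ∫⁻ p, ENNReal.ofReal
      (((P[fun q : Vec d × Vec d => f q.1 |
          MeasurableSpace.comap (Prod.snd : Vec d × Vec d → Vec d) inferInstance]) p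
        - est f t p.2) ^ 2) ∂P ∂(Measure.pi fun _ : Fin h => P)) /
    eVar[fun q : Vec d × Vec d => f q.1; P]

end

end XssMMD

namespace XssMMD

open scoped NNReal

/-! ### The standard normal distribution function -/

/-! With the linear kernel the witness function is `⟪a, ·⟫`, where `a` is the difference of the
means of the two additional samples. All other data are independent of `a`, so the power is the
average over `a` of a conditional power in which the witness function is a fixed linear functional.

Conditional power. For a Gaussian pair, `⟪a, X⟫ = e(V) + ε` with `e` affine and `ε` independent of
`V`; let `vr` and `ve` be the variances of `ε` and `e(V)`. With the true `e` in place of its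
estimate, the semi-supervised mean is exactly Gaussian with variance `(vr + ve / 2) / n`
(`GaussianRegression.map_oracleMean`). The estimation error changes this mean by `1 / (2n)` times
its sum over unlabeled covariates minus its sum over labeled ones. Given its training fold, each
estimate is evaluated at equally many fresh covariates of both kinds, so its bias cancels and only a
fluctuation remains (`lintegral_sq_sum_unlabeledValue_sub_labeledValue_le`). Consistency makes it
negligible against the standard deviation, and makes the variance estimate ratio consistent
(`GaussianRegression.lintegral_abs_crossVar_sub_le`). Both groups share the covariance and `a`,
hence also `vr` and `ve`, and the conditional power is close to `Phi (z α + ⟪δ, a⟫ / √(2 q / n))`,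
where `δ = μX - μY`, `q = vr + ve / 2 = aᵀ A a` and `A = S₁₁ - S₁₂ S₂₂⁻¹ S₂₁ / 2`
(`abs_conditional_power_sub_le`).

Averaging. The vector `a` has law `N(δ, (2 / n) S₁₁)` (`map_witnessVec`). As `‖δ‖ → 0`, `√n ⟪δ, a⟫`
is `√n ‖δ‖² + o(1)`, and `aᵀ A a` concentrates at `(2 / n) tr (A S₁₁)`, which stays away from zero
because `d / n → τ > 0` (`lintegral_quadratic_sub_trace_sq_le`, `le_trace_oracleCov_mul`).
Substituting these limits gives the stated drift, since `√n ‖δ‖²` is bounded. All steps are explicit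
inequalities, collected in `abs_power_sub_le`; the tuning parameters are chosen only at the end. -/

lemma gaussianPDFReal_le_one (x : ℝ) : gaussianPDFReal 0 1 x ≤ 1 := by
  rw [gaussianPDFReal]
  have h1 : (1 : ℝ) ≤ √(2 * Real.pi * ((1 : ℝ≥0) : ℝ)) := by
    rw [Real.one_le_sqrt]
    have := Real.pi_gt_three
    simp only [NNReal.coe_one]
    linarith
  have h2 : Real.exp (-(x - 0) ^ 2 / (2 * ((1 : ℝ≥0) : ℝ))) ≤ 1 := by
    rw [Real.exp_le_one_iff]
    have := sq_nonneg (x - 0)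
    simp only [NNReal.coe_one]
    linarith
  calc _ ≤ (1 : ℝ) * 1 := by
        gcongr
        exact inv_le_one_of_one_le₀ h1
    _ = 1 := one_mul _

lemma Phi_sub {x y : ℝ} (h : x ≤ y) : Phi y - Phi x = (gaussianReal 0 1).real (Set.Ioc x y) := by
  rw [Phi, Phi, cdf_eq_real, cdf_eq_real, ← Set.Iic_sdiff_Iic,
    measureReal_sdiff (Set.Iic_subset_Iic.2 h) measurableSet_Iic]

lemma Phi_mono : Monotone Phi := monotone_cdf _

lemma Phi_sub_le {x y : ℝ} (h : x ≤ y) : Phi y - Phi x ≤ y - x := by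
  rw [Phi_sub h, Measure.real, gaussianReal_apply _ one_ne_zero]
  refine ENNReal.toReal_le_of_le_ofReal (by linarith) ?_
  calc _ ≤ ∫⁻ _ in Set.Ioc x y, (1 : ℝ≥0∞) := by
        refine lintegral_mono fun t => ?_
        rw [gaussianPDF, ENNReal.ofReal_le_one]
        exact gaussianPDFReal_le_one t
    _ = _ := by simp

/-- The density is at most 1, so the constant is 1. This converts every error in the drift or in the
critical value into an error in the power. -/
lemma abs_Phi_sub_le (x y : ℝ) : |Phi x - Phi y| ≤ |x - y| := by
  rcases le_total x y with h | h
  · rw [abs_sub_comm, abs_sub_comm x, abs_of_nonneg (sub_nonneg.2 (Phi_mono h)),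
      abs_of_nonneg (sub_nonneg.2 h)]
    exact Phi_sub_le h
  · rw [abs_of_nonneg (sub_nonneg.2 (Phi_mono h)), abs_of_nonneg (sub_nonneg.2 h)]
    exact Phi_sub_le h

lemma continuous_Phi : Continuous Phi :=
  (LipschitzWith.of_dist_le' (K := 1) fun x y => by
    simpa [Real.dist_eq] using abs_Phi_sub_le x y).continuous

lemma Phi_strictMono : StrictMono Phi := by
  intro x y h
  rw [← sub_pos, Phi_sub h.le, measureReal_def, ENNReal.toReal_pos_iff]
  refine ⟨pos_iff_ne_zero.2 fun h0 => ?_, measure_lt_top _ _⟩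
  have := gaussianReal_absolutelyContinuous' 0 (v := 1) one_ne_zero h0
  simp only [Real.volume_Ioc, ENNReal.ofReal_eq_zero, sub_nonpos] at this
  exact absurd this (not_le.2 h)

lemma measureReal_gaussianReal_Ioi (x : ℝ) : (gaussianReal 0 1).real (Set.Ioi x) = Phi (-x) := by
  have h : (gaussianReal 0 1).map (fun y => -y) = gaussianReal 0 1 := by
    simpa using gaussianReal_map_neg (μ := 0) (v := 1)
  have := nullSingletonClass_gaussianReal (μ := 0) (v := 1) one_ne_zero
  rw [Phi, cdf_eq_real, measureReal_def, measureReal_def]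
  conv_rhs => rw [← h, Measure.map_apply measurable_neg measurableSet_Iic]
  congr 1
  rw [show (fun y : ℝ => -y) ⁻¹' Set.Iic (-x) = Set.Ici x by ext; simp]
  exact measure_congr Ioi_ae_eq_Ici

lemma Phi_neg (x : ℝ) : Phi (-x) = 1 - Phi x := by
  rw [← measureReal_gaussianReal_Ioi, ← Set.compl_Iic, measureReal_compl measurableSet_Iic, Phi,
    cdf_eq_real]
  simp

lemma Phi_z {p : ℝ} (hp : p ∈ Set.Ioo (0 : ℝ) 1) : Phi (z p) = p := by
  obtain ⟨x₀, hx₀⟩ := ((tendsto_cdf_atBot (gaussianReal 0 1)).eventually_lt_const hp.1).exists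
  obtain ⟨x₁, hx₁⟩ := ((tendsto_cdf_atTop (gaussianReal 0 1)).eventually_const_lt hp.2).exists
  obtain ⟨x, hx⟩ : p ∈ Set.range Phi :=
    mem_range_of_exists_le_of_exists_ge continuous_Phi ⟨x₀, hx₀.le⟩ ⟨x₁, hx₁.le⟩
  have : {y | p ≤ Phi y} = Set.Ici x := by
    ext y
    rw [← hx]
    exact Phi_strictMono.le_iff_le
  rw [z, this, csInf_Ici, hx]

lemma z_one_sub {p : ℝ} (hp : p ∈ Set.Ioo (0 : ℝ) 1) : z (1 - p) = -z p := by
  apply Phi_strictMono.injective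
  rw [Phi_neg, Phi_z hp, Phi_z ⟨by linarith [hp.2], by linarith [hp.1]⟩]

/-! ### Perturbation of a studentized Gaussian statistic -/

section Studentization

variable {Ω : Type*} {mΩ : MeasurableSpace Ω} {ν : Measure Ω}

lemma measureReal_lt_div_of_gaussian {O : Ω → ℝ} (hO : AEMeasurable O ν) {m σ : ℝ} (hσ : 0 < σ)
    (hlaw : ν.map O = gaussianReal m (Real.toNNReal (σ ^ 2))) (u : ℝ) :
    ν.real {ω | u < O ω / σ} = Phi (-u + m / σ) := by
  have h1 : ν.map (fun ω => O ω / σ - m / σ) = gaussianReal 0 1 := by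
    have h2 : (fun ω => O ω / σ - m / σ) = (fun x => x - m / σ) ∘ (fun x => x / σ) ∘ O := rfl
    rw [h2, ← AEMeasurable.map_map_of_aemeasurable (by fun_prop) (by fun_prop),
      ← AEMeasurable.map_map_of_aemeasurable (by fun_prop) hO, hlaw, gaussianReal_map_div_const,
      gaussianReal_map_sub_const, sub_self]
    congr 1
    ext
    simp only [NNReal.coe_div, Real.coe_toNNReal _ (sq_nonneg σ), NNReal.coe_one]
    rw [div_eq_one_iff_eq]
    · rfl
    · exact fun h => hσ.ne' (by simpa using h)
  rw [show -u + m / σ = -(u - m / σ) by ring, ← measureReal_gaussianReal_Ioi, ← h1,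
    measureReal_def, measureReal_def, Measure.map_apply_of_aemeasurable (by fun_prop)
      measurableSet_Ioi]
  congr 2
  ext ω
  simp

/-- Here `N` is the numerator, `S` the variance estimate and `O` the Gaussian oracle. Outside two
bad events, `N / σ` is within `κ` of `O / σ` and `√S / σ` is within `κ` of 1, so rejection is
sandwiched between the events that `O / σ` exceeds `t ± κ (|t| + 1)`. No independence between `N`,
`S` and `O` is involved. -/
lemma abs_measureReal_studentized_sub_le [IsProbabilityMeasure ν] {N S O : Ω → ℝ}
    (hO : AEMeasurable O ν) {m σ : ℝ} (hσ : 0 < σ)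
    (hlaw : ν.map O = gaussianReal m (Real.toNNReal (σ ^ 2))) (t : ℝ) {κ : ℝ} (hκ0 : 0 < κ)
    (hκ : κ ≤ 1) :
    |ν.real {ω | t < N ω / √(S ω)} - Phi (-t + m / σ)| ≤
      κ * (|t| + 1) + ν.real {ω | κ * σ ≤ |N ω - O ω|} + ν.real {ω | κ ≤ |S ω / σ ^ 2 - 1|} := by
  set B₁ := {ω | κ * σ ≤ |N ω - O ω|}
  set B₂ := {ω | κ ≤ |S ω / σ ^ 2 - 1|}
  set E := {ω | t < N ω / √(S ω)}
  have key : ∀ ω, ω ∉ B₁ → ω ∉ B₂ → ∃ s : ℝ, |s - 1| ≤ κ ∧ |N ω / σ - O ω / σ| ≤ κ ∧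
      (ω ∈ E ↔ t * s < N ω / σ) := by
    intro ω h₁ h₂
    simp only [B₁, B₂, Set.mem_ofPred_eq, not_le] at h₁ h₂
    have hS : 0 < S ω / σ ^ 2 := by linarith [(abs_lt.1 h₂).1]
    have hS' : 0 < S ω := by
      have := mul_pos hS (pow_pos hσ 2)
      rwa [div_mul_cancel₀ _ (pow_pos hσ 2).ne'] at this
    have hs := Real.sqrt_pos.2 hS'
    refine ⟨√(S ω) / σ, ?_, ?_, ?_⟩
    · refine le_trans ?_ h₂.le
      -- With `x = √S / σ`, `|x - 1| ≤ |x² - 1|` because `x + 1 ≥ 1`.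
      rw [show S ω / σ ^ 2 - 1 = (√(S ω) / σ - 1) * (√(S ω) / σ + 1) by
        ring_nf; rw [Real.sq_sqrt hS'.le]; ring, abs_mul]
      refine le_mul_of_one_le_right (abs_nonneg _) ?_
      rw [abs_of_nonneg (by positivity)]
      have : 0 < √(S ω) / σ := by positivity
      linarith
    · rw [← sub_div, abs_div, abs_of_pos hσ, div_le_iff₀ hσ]
      exact h₁.le
    · simp only [E, Set.mem_ofPred_eq]
      rw [lt_div_iff₀ hs, lt_div_iff₀ hσ, mul_assoc, div_mul_cancel₀ _ hσ.ne']
  have hts : ∀ s : ℝ, |s - 1| ≤ κ → |t * s - t| ≤ κ * |t| := by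
    intro s hs
    rw [show t * s - t = (s - 1) * t by ring, abs_mul]
    gcongr
  have hsub₁ : E ⊆ {ω | t - κ * (|t| + 1) < O ω / σ} ∪ B₁ ∪ B₂ := by
    intro ω hω
    by_contra hcon
    simp only [Set.mem_union, not_or] at hcon
    obtain ⟨s, h1, h2, h3⟩ := key ω hcon.1.2 hcon.2
    have h4 := h3.1 hω
    have h5 := hcon.1.1
    simp only [Set.mem_ofPred_eq, not_lt] at h5
    have h6 := abs_le.1 (hts s h1)
    have h7 := abs_le.1 h2
    linarith [h6.1, h7.2]
  have hsub₂ : {ω | t + κ * (|t| + 1) < O ω / σ} ⊆ E ∪ B₁ ∪ B₂ := by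
    intro ω hω
    by_contra hcon
    simp only [Set.mem_union, not_or] at hcon
    obtain ⟨s, h1, h2, h3⟩ := key ω hcon.1.2 hcon.2
    have h5 := hcon.1.1
    rw [h3, not_lt] at h5
    simp only [Set.mem_ofPred_eq] at hω
    have h6 := abs_le.1 (hts s h1)
    have h7 := abs_le.1 h2
    linarith [h6.2, h7.1]
  have hU : ∀ A : Set Ω, ν.real (A ∪ B₁ ∪ B₂) ≤ ν.real A + ν.real B₁ + ν.real B₂ := fun A =>
    (measureReal_union_le _ _).trans (by gcongr; exact measureReal_union_le _ _)
  have h₁ := (measureReal_mono hsub₁ (μ := ν)).trans (hU _)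
  have h₂ := (measureReal_mono hsub₂ (μ := ν)).trans (hU _)
  rw [measureReal_lt_div_of_gaussian hO hσ hlaw] at h₁ h₂
  have hl₁ := abs_Phi_sub_le (-(t - κ * (|t| + 1)) + m / σ) (-t + m / σ)
  have hl₂ := abs_Phi_sub_le (-(t + κ * (|t| + 1)) + m / σ) (-t + m / σ)
  rw [show -(t - κ * (|t| + 1)) + m / σ - (-t + m / σ) = κ * (|t| + 1) by ring] at hl₁
  rw [show -(t + κ * (|t| + 1)) + m / σ - (-t + m / σ) = -(κ * (|t| + 1)) by ring, abs_neg] at hl₂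
  rw [abs_of_nonneg (by positivity : 0 ≤ κ * (|t| + 1))] at hl₁ hl₂
  rw [abs_le]
  constructor
  · linarith [(abs_le.1 hl₂).1]
  · linarith [(abs_le.1 hl₁).2]

end Studentization

/-! ### Sums of independent variables under a product measure -/

section Pi

variable {ι : Type*} [Fintype ι] {α : Type*} {mα : MeasurableSpace α} {μ : Measure α}
  [IsProbabilityMeasure μ]

lemma lintegral_pi_eval (i : ι) {G : α → ℝ≥0∞} (hG : Measurable G) :
    ∫⁻ t, G (t i) ∂(Measure.pi fun _ : ι => μ) = ∫⁻ x, G x ∂μ :=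
  (measurePreserving_eval (fun _ : ι => μ) i).lintegral_comp hG

omit [IsProbabilityMeasure μ] in
lemma memLp_two_of_lintegral_ne_top {g : α → ℝ} (hg : Measurable g)
    (h : ∫⁻ x, ENNReal.ofReal (g x ^ 2) ∂μ ≠ ∞) : MemLp g 2 μ := by
  rw [memLp_two_iff_integrable_sq hg.aestronglyMeasurable]
  refine ⟨(hg.pow_const 2).aestronglyMeasurable, ?_⟩
  rw [hasFiniteIntegral_iff_ofReal (ae_of_all _ fun x => sq_nonneg _)]
  exact lt_top_iff_ne_top.2 h

/-- Variances of independent terms add, and a variance is at most the second moment. No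
integrability is assumed: if a second moment is infinite, so is the right-hand side. -/
lemma lintegral_sq_sum_sub_integral_le {g : ι → α → ℝ} (hg : ∀ i, Measurable (g i)) :
    ∫⁻ t, ENNReal.ofReal ((∑ i, (g i (t i) - ∫ x, g i x ∂μ)) ^ 2) ∂(Measure.pi fun _ : ι => μ) ≤
      ∑ i, ∫⁻ x, ENNReal.ofReal (g i x ^ 2) ∂μ := by
  by_cases h : ∀ i, ∫⁻ x, ENNReal.ofReal (g i x ^ 2) ∂μ ≠ ∞
  · have hL : ∀ i, MemLp (g i) 2 μ := fun i => memLp_two_of_lintegral_ne_top (hg i) (h i)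
    have hLp : ∀ i, MemLp (fun t : ι → α => g i (t i)) 2 (Measure.pi fun _ : ι => μ) := fun i =>
      (hL i).comp_measurePreserving (measurePreserving_eval (fun _ : ι => μ) i)
    have hvar := variance_sum_pi (μ := fun _ : ι => μ) (X := g) hL
    have hmean : ∫ t, (∑ i, fun ω : ι → α => g i (ω i)) t ∂(Measure.pi fun _ : ι => μ) =
        ∑ i, ∫ x, g i x ∂μ := by
      simp only [Finset.sum_apply]
      rw [integral_finsetSum _ fun i _ => (hLp i).integrable (by norm_num)]
      refine Finset.sum_congr rfl fun i _ => ?_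
      exact integral_comp_eval (μ := fun _ : ι => μ) (hg i).aestronglyMeasurable
    have hS : MemLp (∑ i, fun ω : ι → α => g i (ω i)) 2 (Measure.pi fun _ : ι => μ) :=
      memLp_finsetSum' _ fun i _ => hLp i
    have h1 := evariance_eq_lintegral_ofReal (∑ i, fun ω : ι → α => g i (ω i))
      (Measure.pi fun _ : ι => μ)
    rw [hmean] at h1
    simp only [Finset.sum_apply, ← Finset.sum_sub_distrib] at h1
    rw [← h1, ← hS.ofReal_variance_eq, hvar,
      ENNReal.ofReal_sum_of_nonneg fun i _ => variance_nonneg _ _]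
    refine Finset.sum_le_sum fun i _ => ?_
    have h2 : MemLp (g i) 2 μ := hL i
    rw [← ofReal_integral_eq_lintegral_ofReal h2.integrable_sq (ae_of_all _ fun _ => sq_nonneg _)]
    refine ENNReal.ofReal_le_ofReal ?_
    exact variance_le_expectation_sq (hg i).aestronglyMeasurable
  · push Not at h
    obtain ⟨i, hi⟩ := h
    have : ∑ i, ∫⁻ x, ENNReal.ofReal (g i x ^ 2) ∂μ = ∞ :=
      ENNReal.sum_eq_top.2 ⟨i, Finset.mem_univ _, hi⟩
    rw [this]
    exact le_top

end Pi

/-! ### Sums of independent Gaussian variables -/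

section GaussianSums

variable {Ω : Type*} {mΩ : MeasurableSpace Ω} {ν : Measure Ω}

lemma map_comp_of_measurePreserving {α β γ : Type*} {mα : MeasurableSpace α}
    {mβ : MeasurableSpace β} {mγ : MeasurableSpace γ} {μ : Measure α} {η : Measure β} {F : α → β}
    (hF : MeasurePreserving F μ η) {g : β → γ} (hg : Measurable g) :
    μ.map (fun x => g (F x)) = η.map g := by
  rw [← hF.map_eq, Measure.map_map hg hF.measurable]
  rfl

lemma hasGaussianLaw_of_map_eq {X : Ω → ℝ} {m : ℝ} {v : ℝ≥0}
    (h : ν.map X = gaussianReal m v) : HasGaussianLaw X ν :=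
  ⟨by rw [h]; infer_instance⟩

lemma integral_of_map_eq_gaussianReal {X : Ω → ℝ} {m : ℝ} {v : ℝ≥0} (hX : Measurable X)
    (h : ν.map X = gaussianReal m v) : ∫ ω, X ω ∂ν = m := by
  have := integral_map (μ := ν) (f := fun x : ℝ => x) hX.aemeasurable
    (by fun_prop)
  rw [← this, h]
  exact integral_id_gaussianReal

lemma variance_of_map_eq_gaussianReal {X : Ω → ℝ} {m : ℝ} {v : ℝ≥0} (hX : Measurable X)
    (h : ν.map X = gaussianReal m v) : Var[X; ν] = v := by
  have := variance_map (μ := ν) (X := id) (Y := X) (by fun_prop) hX.aemeasurable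
  rw [Function.id_comp] at this
  rw [← this, h]
  exact variance_id_gaussianReal

lemma map_eq_gaussianReal_of_hasGaussianLaw {X : Ω → ℝ} {m v : ℝ} (hX : HasGaussianLaw X ν)
    (hm : ∫ ω, X ω ∂ν = m) (hv : Var[X; ν] = v) : ν.map X = gaussianReal m v.toNNReal := by
  rw [hX.map_eq_gaussianReal, hm, hv]

lemma map_const_mul_of_map_eq_gaussianReal {X : Ω → ℝ} {m v : ℝ} (hX : Measurable X)
    (h : ν.map X = gaussianReal m v.toNNReal) (c : ℝ) :
    ν.map (fun ω => c * X ω) = gaussianReal (c * m) (c ^ 2 * v).toNNReal := by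
  rw [show (fun ω => c * X ω) = (fun x => c * x) ∘ X from rfl,
    ← Measure.map_map (by fun_prop) hX, h, gaussianReal_map_const_mul]
  congr 1
  rw [Real.toNNReal_mul (sq_nonneg c)]
  congr 1
  ext
  simp [sq_nonneg]

lemma map_sum_pi_of_map_eq_gaussianReal {ι : Type*} [Fintype ι] {α : Type*}
    {mα : MeasurableSpace α} {μ : Measure α} [IsProbabilityMeasure μ] {g : α → ℝ}
    (hg : Measurable g) {m v : ℝ} (hv : 0 ≤ v) (h : μ.map g = gaussianReal m v.toNNReal) :
    (Measure.pi fun _ : ι => μ).map (fun t => ∑ i, g (t i)) =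
      gaussianReal (Fintype.card ι * m) (Fintype.card ι * v).toNNReal := by
  have hG : ∀ i : ι, (Measure.pi fun _ : ι => μ).map (fun t => g (t i)) =
      gaussianReal m v.toNNReal := fun i => by
    rw [← h]
    exact map_comp_of_measurePreserving (measurePreserving_eval (fun _ : ι => μ) i) hg
  have hgi : ∀ i : ι, Measurable (fun t : ι → α => g (t i)) := fun i =>
    hg.comp (measurable_pi_apply i)
  have hL := fun i : ι => hasGaussianLaw_of_map_eq (hG i)
  refine map_eq_gaussianReal_of_hasGaussianLaw
    (iIndepFun.hasGaussianLaw_fun_sum hL (iIndepFun_pi fun _ => hg.aemeasurable)) ?_ ?_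
  · rw [integral_finsetSum _ fun i _ => (hL i).integrable]
    simp [integral_of_map_eq_gaussianReal (hgi _) (hG _)]
  · have h1 := variance_sum_pi (μ := fun _ : ι => μ) (X := fun _ => g)
      fun _ => (hasGaussianLaw_of_map_eq h).memLp_two
    rw [show (fun t : ι → α => ∑ i, g (t i)) = ∑ i, fun t : ι → α => g (t i) by
      ext; simp, h1]
    simp [variance_of_map_eq_gaussianReal hg h, hv]

lemma map_prod_add_of_map_eq_gaussianReal {α β : Type*} {mα : MeasurableSpace α}
    {mβ : MeasurableSpace β} {μ : Measure α} {η : Measure β} [IsProbabilityMeasure μ]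
    [IsProbabilityMeasure η] {g : α → ℝ} {k : β → ℝ} (hg : Measurable g) (hk : Measurable k)
    {m m' v v' : ℝ} (hv : 0 ≤ v) (hv' : 0 ≤ v') (h : μ.map g = gaussianReal m v.toNNReal)
    (h' : η.map k = gaussianReal m' v'.toNNReal) :
    (μ.prod η).map (fun p => g p.1 + k p.2) = gaussianReal (m + m') (v + v').toNNReal := by
  have hi : IndepFun (fun p : α × β => g p.1) (fun p => k p.2) (μ.prod η) :=
    indepFun_prod hg hk
  rw [Real.toNNReal_add hv hv']
  refine gaussianReal_add_gaussianReal_of_indepFun hi ?_ ?_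
  · rw [← h]
    exact map_comp_of_measurePreserving measurePreserving_fst hg
  · rw [← h']
    exact map_comp_of_measurePreserving measurePreserving_snd hk

lemma map_add_of_indepFun_gaussianReal {X Y : Ω → ℝ} {m m' v v' : ℝ} (hi : IndepFun X Y ν)
    (hv : 0 ≤ v) (hv' : 0 ≤ v') (h : ν.map X = gaussianReal m v.toNNReal)
    (h' : ν.map Y = gaussianReal m' v'.toNNReal) :
    ν.map (fun ω => X ω + Y ω) = gaussianReal (m + m') (v + v').toNNReal := by
  rw [Real.toNNReal_add hv hv']
  exact gaussianReal_add_gaussianReal_of_indepFun hi h h'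

end GaussianSums

/-! ### The empirical variance -/

lemma empVar_sub_const {n : ℕ} (hn : 0 < n) (a : Fin n → ℝ) (c : ℝ) :
    empVar (fun i => a i - c) = empVar a := by
  have hn' : (n : ℝ) ≠ 0 := by positivity
  simp only [empVar, empMean, sub_sq, Finset.sum_add_distrib, Finset.sum_sub_distrib,
    ← Finset.sum_mul, ← Finset.mul_sum, Finset.sum_const, Finset.card_univ, Fintype.card_fin,
    nsmul_eq_mul]
  field_simp
  ring

lemma empVar_eq {n : ℕ} (hn : 0 < n) (a : Fin n → ℝ) :
    empVar a = empMean fun i => (a i - empMean a) ^ 2 := by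
  rw [← empVar_sub_const hn a (empMean a)]
  have hn' : (n : ℝ) ≠ 0 := by positivity
  have : empMean (fun i => a i - empMean a) = 0 := by
    simp only [empMean, Finset.sum_sub_distrib, Finset.sum_const, Finset.card_univ,
      Fintype.card_fin, nsmul_eq_mul]
    field_simp
    ring
  rw [empVar, this]
  ring

lemma empVar_le {n : ℕ} (a : Fin n → ℝ) : empVar a ≤ empMean fun i => a i ^ 2 := by
  rw [empVar]
  linarith [sq_nonneg (empMean a)]

/-- Young's inequality `2 |x y| ≤ θ x² + θ⁻¹ y²`, applied to the centered samples. -/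
lemma abs_empVar_add_sub_le {n : ℕ} (hn : 0 < n) (a b : Fin n → ℝ) {θ : ℝ} (hθ : 0 < θ) :
    |empVar (fun i => a i + b i) - empVar a| ≤ θ * empVar a + (1 + θ⁻¹) * empVar b := by
  have hab : empMean (fun i => a i + b i) = empMean a + empMean b := by
    simp only [empMean, Finset.sum_add_distrib, add_div]
  rw [empVar_eq hn, empVar_eq hn a, empVar_eq hn b, hab]
  set x : Fin n → ℝ := fun i => a i - empMean a
  set y : Fin n → ℝ := fun i => b i - empMean b
  have hx : ∀ i, (a i + b i - (empMean a + empMean b)) ^ 2 = (x i + y i) ^ 2 := fun i => by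
    simp only [x, y]; ring
  simp only [hx]
  change |empMean (fun i => (x i + y i) ^ 2) - empMean (fun i => x i ^ 2)| ≤
    θ * empMean (fun i => x i ^ 2) + (1 + θ⁻¹) * empMean (fun i => y i ^ 2)
  clear_value x y
  simp only [empMean, ← sub_div, ← Finset.sum_sub_distrib]
  rw [abs_div, Nat.abs_cast, ← mul_div_assoc, ← mul_div_assoc, ← add_div, Finset.mul_sum,
    Finset.mul_sum, ← Finset.sum_add_distrib]
  gcongr
  refine (Finset.abs_sum_le_sum_abs _ _).trans (Finset.sum_le_sum fun i _ => ?_)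
  have h1 : 0 ≤ θ⁻¹ * (θ * x i - y i) ^ 2 := by positivity
  have h2 : 0 ≤ θ⁻¹ * (θ * x i + y i) ^ 2 := by positivity
  have e1 : θ⁻¹ * (θ * x i - y i) ^ 2 = θ * x i ^ 2 - 2 * x i * y i + θ⁻¹ * y i ^ 2 := by
    field_simp
    ring
  have e2 : θ⁻¹ * (θ * x i + y i) ^ 2 = θ * x i ^ 2 + 2 * x i * y i + θ⁻¹ * y i ^ 2 := by
    field_simp
    ring
  rw [abs_le]
  constructor <;> nlinarith [sq_nonneg (y i)]

/-! ### Moments of the empirical variance of a Gaussian sample -/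

/-- The fourth moment of the standard normal distribution. -/
noncomputable def fourthMoment : ℝ := ∫ x, x ^ 4 ∂(gaussianReal 0 1)

lemma fourthMoment_nonneg : 0 ≤ fourthMoment := integral_nonneg fun x => by positivity

section GaussianMoments

variable {Ω : Type*} {mΩ : MeasurableSpace Ω} {μ : Measure Ω}

lemma lintegral_sub_sq_of_map_eq_gaussianReal [IsProbabilityMeasure μ] {g : Ω → ℝ}
    (hg : Measurable g) {m v : ℝ} (hv : 0 ≤ v) (h : μ.map g = gaussianReal m v.toNNReal) :
    ∫⁻ x, ENNReal.ofReal ((g x - m) ^ 2) ∂μ = ENNReal.ofReal v := by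
  have h1 := evariance_eq_lintegral_ofReal g μ
  rw [integral_of_map_eq_gaussianReal hg h] at h1
  rw [← h1, ← ((hasGaussianLaw_of_map_eq h).memLp_two).ofReal_variance_eq,
    variance_of_map_eq_gaussianReal hg h, Real.coe_toNNReal _ hv]

lemma integrable_pow_four_gaussianReal : Integrable (fun x : ℝ => x ^ 4) (gaussianReal 0 1) := by
  have := (memLp_id_gaussianReal (μ := 0) (v := 1) 4).integrable_norm_pow (p := 4) (by norm_num)
  refine this.congr (ae_of_all _ fun x => ?_)
  simp only [id, Real.norm_eq_abs]
  exact Even.pow_abs (by decide) x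

lemma lintegral_sub_pow_four_of_map_eq_gaussianReal {g : Ω → ℝ}
    (hg : Measurable g) {m v : ℝ} (hv : 0 ≤ v) (h : μ.map g = gaussianReal m v.toNNReal) :
    ∫⁻ x, ENNReal.ofReal (((g x - m) ^ 2) ^ 2) ∂μ = ENNReal.ofReal (fourthMoment * v ^ 2) := by
  have h1 : gaussianReal m v.toNNReal = (gaussianReal 0 1).map (fun x => √v * x + m) := by
    rw [show (fun x => √v * x + m) = (fun x => x + m) ∘ (fun x => √v * x) from rfl,
      ← Measure.map_map (by fun_prop) (by fun_prop), gaussianReal_map_const_mul,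
      gaussianReal_map_add_const]
    congr 1
    · ring
    · ext
      simp [Real.sq_sqrt hv, hv]
  have h2 : ∫⁻ x, ENNReal.ofReal (((g x - m) ^ 2) ^ 2) ∂μ =
      ∫⁻ y, ENNReal.ofReal (((y - m) ^ 2) ^ 2) ∂(μ.map g) := by
    rw [lintegral_map (by fun_prop) hg]
  rw [h2, h, h1, lintegral_map (by fun_prop) (by fun_prop), fourthMoment,
    mul_comm, ENNReal.ofReal_mul (sq_nonneg v),
    ofReal_integral_eq_lintegral_ofReal integrable_pow_four_gaussianReal
      (ae_of_all _ fun x => by positivity), ← lintegral_const_mul _ (by fun_prop)]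
  refine lintegral_congr fun x => ?_
  rw [← ENNReal.ofReal_mul (sq_nonneg v)]
  congr 1
  rw [show ((√v * x + m - m) ^ 2) ^ 2 = ((√v) ^ 2) ^ 2 * x ^ 4 by ring, Real.sq_sqrt hv]

lemma lintegral_sq_sum_sub_of_map_eq_gaussianReal [IsProbabilityMeasure μ] {ι : Type*} [Fintype ι]
    {g : Ω → ℝ} (hg : Measurable g) {m v : ℝ} (hv : 0 ≤ v)
    (h : μ.map g = gaussianReal m v.toNNReal) :
    ∫⁻ t, ENNReal.ofReal ((∑ i, (g (t i) - m)) ^ 2) ∂(Measure.pi fun _ : ι => μ) ≤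
      ENNReal.ofReal (Fintype.card ι * v) := by
  have hgi := fun i : ι => integral_of_map_eq_gaussianReal hg h
  have h1 := lintegral_sq_sum_sub_integral_le (ι := ι) (μ := μ) (g := fun _ x => g x - m)
    (fun _ => by fun_prop)
  have h2 : ∫ x, (g x - m) ∂μ = 0 := by
    rw [integral_sub (hasGaussianLaw_of_map_eq h).integrable (integrable_const _),
      integral_of_map_eq_gaussianReal hg h]
    simp
  simp only [h2, sub_zero, lintegral_sub_sq_of_map_eq_gaussianReal hg hv h, Finset.sum_const,
    nsmul_eq_mul, Finset.card_univ] at h1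
  refine h1.trans (le_of_eq ?_)
  rw [ENNReal.ofReal_mul (by positivity), ENNReal.ofReal_natCast]

lemma lintegral_sq_sum_sq_sub_of_map_eq_gaussianReal [IsProbabilityMeasure μ] {ι : Type*}
    [Fintype ι] {g : Ω → ℝ} (hg : Measurable g) {m v : ℝ} (hv : 0 ≤ v)
    (h : μ.map g = gaussianReal m v.toNNReal) :
    ∫⁻ t, ENNReal.ofReal ((∑ i, ((g (t i) - m) ^ 2 - v)) ^ 2) ∂(Measure.pi fun _ : ι => μ) ≤
      ENNReal.ofReal (Fintype.card ι * (fourthMoment * v ^ 2)) := by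
  have h1 := lintegral_sq_sum_sub_integral_le (ι := ι) (μ := μ) (g := fun _ x => (g x - m) ^ 2)
    (fun _ => by fun_prop)
  have h2 : ∫ x, (g x - m) ^ 2 ∂μ = v := by
    rw [integral_eq_lintegral_of_nonneg_ae (ae_of_all _ fun _ => sq_nonneg _)
      (by fun_prop), lintegral_sub_sq_of_map_eq_gaussianReal hg hv h, ENNReal.toReal_ofReal hv]
  simp only [h2, lintegral_sub_pow_four_of_map_eq_gaussianReal hg hv h, Finset.sum_const,
    nsmul_eq_mul, Finset.card_univ] at h1
  refine h1.trans (le_of_eq ?_)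
  rw [ENNReal.ofReal_mul (Nat.cast_nonneg _), ENNReal.ofReal_natCast]

/-- About the true mean, `empVar - v` is the average of `(g - m)² - v` minus the square of the
average of `g - m`, and both have explicit second moments. The error is measured against a positive
bound `V` rather than `v`, since the noise or the fit may be degenerate. -/
lemma lintegral_abs_empVar_sub_le [IsProbabilityMeasure μ] {N : ℕ} (hN : 0 < N)
    {g : Ω → ℝ} (hg : Measurable g) {m v V : ℝ} (hv : 0 ≤ v) (hvV : v ≤ V) (hV : 0 < V)
    (h : μ.map g = gaussianReal m v.toNNReal) :
    ∫⁻ t, ENNReal.ofReal |empVar (fun i => g (t i)) - v| ∂(Measure.pi fun _ : Fin N => μ) ≤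
      ENNReal.ofReal (V * (fourthMoment + 2) / √N) := by
  have hN' : (0 : ℝ) < N := by positivity
  have hsN : 0 < √(N : ℝ) := Real.sqrt_pos.2 hN'
  -- In `|y| ≤ s + s⁻¹ y²` this `s` balances both terms, as the second moment of `y` is of order `V²
  -- / N`.
  set s : ℝ := V / √N with hs
  have hs0 : 0 < s := by positivity
  have hK := fourthMoment_nonneg
  have key : ∀ t : Fin N → Ω, |empVar (fun i => g (t i)) - v| ≤
      s + (s⁻¹ * ((N : ℝ)⁻¹) ^ 2) * (∑ i, ((g (t i) - m) ^ 2 - v)) ^ 2 +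
        ((N : ℝ)⁻¹) ^ 2 * (∑ i, (g (t i) - m)) ^ 2 := by
    intro t
    rw [← empVar_sub_const hN _ m, empVar]
    simp only [empMean, Finset.sum_sub_distrib (f := fun i => (g (t i) - m) ^ 2), Finset.sum_const,
      Finset.card_univ, Fintype.card_fin, nsmul_eq_mul]
    set A := ∑ i, (g (t i) - m) ^ 2
    set B := ∑ i, (g (t i) - m)
    have e1 : A / N - (B / N) ^ 2 - v = (N : ℝ)⁻¹ * (A - N * v) - ((N : ℝ)⁻¹) ^ 2 * B ^ 2 := by
      field_simp
      ring
    rw [e1]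
    set y := (N : ℝ)⁻¹ * (A - N * v)
    have e2 : s⁻¹ * (N : ℝ)⁻¹ ^ 2 * (A - N * v) ^ 2 = s⁻¹ * y ^ 2 := by simp only [y]; ring
    rw [e2]
    have h3 : |y| ≤ s + s⁻¹ * y ^ 2 := by
      have e3 : 0 ≤ s⁻¹ * (|y| - s) ^ 2 := by positivity
      have e4 : s⁻¹ * (|y| - s) ^ 2 = s⁻¹ * y ^ 2 - 2 * |y| + s := by
        rw [sub_sq, sq_abs]
        field_simp
      linarith [abs_nonneg y]
    have h4 : 0 ≤ ((N : ℝ)⁻¹) ^ 2 * B ^ 2 := by positivity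
    refine (abs_sub _ _).trans ?_
    rw [abs_of_nonneg h4]
    linarith
  calc _ ≤ ∫⁻ t, (ENNReal.ofReal s + ENNReal.ofReal (s⁻¹ * ((N : ℝ)⁻¹) ^ 2) *
          ENNReal.ofReal ((∑ i, ((g (t i) - m) ^ 2 - v)) ^ 2) + ENNReal.ofReal (((N : ℝ)⁻¹) ^ 2) *
          ENNReal.ofReal ((∑ i, (g (t i) - m)) ^ 2)) ∂(Measure.pi fun _ : Fin N => μ) := by
        refine lintegral_mono fun t => (ENNReal.ofReal_le_ofReal (key t)).trans (le_of_eq ?_)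
        rw [ENNReal.ofReal_add (by positivity) (by positivity),
          ENNReal.ofReal_add (by positivity) (by positivity),
          ENNReal.ofReal_mul (p := s⁻¹ * (N : ℝ)⁻¹ ^ 2) (by positivity),
          ENNReal.ofReal_mul (p := (N : ℝ)⁻¹ ^ 2) (by positivity)]
    _ ≤ ENNReal.ofReal s + ENNReal.ofReal (s⁻¹ * ((N : ℝ)⁻¹) ^ 2) *
          ENNReal.ofReal (N * (fourthMoment * v ^ 2)) +
          ENNReal.ofReal (((N : ℝ)⁻¹) ^ 2) * ENNReal.ofReal (N * v) := by
        rw [lintegral_add_left (by fun_prop), lintegral_add_left (by fun_prop),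
          lintegral_const_mul _ (by fun_prop), lintegral_const_mul _ (by fun_prop), lintegral_const,
          measure_univ, mul_one]
        have h5 := lintegral_sq_sum_sq_sub_of_map_eq_gaussianReal (ι := Fin N) hg hv h
        have h6 := lintegral_sq_sum_sub_of_map_eq_gaussianReal (ι := Fin N) hg hv h
        rw [Fintype.card_fin] at h5 h6
        gcongr
    _ ≤ _ := by
        rw [← ENNReal.ofReal_mul (by positivity), ← ENNReal.ofReal_mul (by positivity),
          ← ENNReal.ofReal_add (by positivity) (by positivity),
          ← ENNReal.ofReal_add (by positivity) (by positivity)]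
        refine ENNReal.ofReal_le_ofReal ?_
        have h7 : s⁻¹ * (N : ℝ)⁻¹ ^ 2 * (N * (fourthMoment * v ^ 2)) ≤ V * fourthMoment / √N := by
          calc _ ≤ s⁻¹ * (N : ℝ)⁻¹ ^ 2 * (N * (fourthMoment * V ^ 2)) := by gcongr
            _ = V * fourthMoment / √N := by
              rw [hs]
              have := Real.sq_sqrt hN'.le
              field_simp
              rw [this]
        have h8 : (N : ℝ)⁻¹ ^ 2 * (N * v) ≤ V / √N := by
          have h9 : √(N : ℝ) ≤ N := by
            rw [Real.sqrt_le_left hN'.le]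
            have : (1 : ℝ) ≤ N := by exact_mod_cast hN
            nlinarith
          calc (N : ℝ)⁻¹ ^ 2 * (N * v) ≤ (N : ℝ)⁻¹ ^ 2 * (N * V) := by gcongr
            _ = V / N := by field_simp
            _ ≤ V / √N := by gcongr
        calc _ ≤ V / √N + V * fourthMoment / √N + V / √N := by linarith
          _ = _ := by ring

end GaussianMoments

/-! ### Splitting a sample into its two folds -/

/-- The indices of the two folds, as an enumeration of all indices. -/
def foldEquiv {n : ℕ} (hn : Even n) : Fin (n / 2) ⊕ Fin (n / 2) ≃ Fin n where
  toFun := Sum.elim (fun k => ⟨2 * k, by omega⟩) (fun k => ⟨2 * k + 1, by omega⟩)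
  invFun i := if (i : ℕ) % 2 = 0 then Sum.inl ⟨i / 2, by obtain ⟨m, rfl⟩ := hn; omega⟩
    else Sum.inr ⟨i / 2, by obtain ⟨m, rfl⟩ := hn; omega⟩
  left_inv x := by
    rcases x with k | k
    · simp
    · have : (2 * (k : ℕ) + 1) / 2 = k := by omega
      simp [this, Nat.add_mod]
  right_inv i := by
    by_cases h : (i : ℕ) % 2 = 0
    · simp only [h, if_true, Sum.elim_inl]
      ext
      simp only
      omega
    · simp only [h, if_false, Sum.elim_inr]
      ext
      simp only
      omega

lemma sum_eq_sum_folds {M : Type*} [AddCommMonoid M] {n : ℕ} (hn : Even n) (F : Fin n → M) :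
    ∑ i, F i = ∑ k : Fin (n / 2), F ⟨2 * k, by omega⟩ +
      ∑ k : Fin (n / 2), F ⟨2 * k + 1, by omega⟩ := by
  rw [← (foldEquiv hn).sum_comp, Fintype.sum_sum_type]
  rfl

section Folds

variable {α : Type} {mα : MeasurableSpace α}

@[fun_prop]
lemma measurable_foldA {n : ℕ} : Measurable (foldA : (Fin n → α) → Fin (n / 2) → α) :=
  measurable_pi_lambda _ fun _ => measurable_pi_apply _

@[fun_prop]
lemma measurable_foldB {n : ℕ} : Measurable (foldB : (Fin n → α) → Fin (n / 2) → α) :=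
  measurable_pi_lambda _ fun _ => measurable_pi_apply _

/-- The two folds are independent samples; this is what makes cross-fitting work, since an estimate
is always evaluated on the fold it was not trained on. -/
lemma measurePreserving_folds {n : ℕ} (hn : Even n) (μ : Measure α) [IsProbabilityMeasure μ] :
    MeasurePreserving (fun L : Fin n → α => (foldA L, foldB L)) (Measure.pi fun _ => μ)
      ((Measure.pi fun _ => μ).prod (Measure.pi fun _ => μ)) := by
  have h1 := (measurePreserving_piCongrLeft (fun _ : Fin n => μ) (foldEquiv hn)).symm
  have h2 := measurePreserving_sumPiEquivProdPi (fun _ : Fin (n / 2) ⊕ Fin (n / 2) => μ)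
  exact h2.comp h1

lemma lintegral_foldB_foldA {n : ℕ} (hn : Even n) (μ : Measure α) [IsProbabilityMeasure μ]
    {H : (Fin (n / 2) → α) → (Fin (n / 2) → α) → ℝ≥0∞} (hH : Measurable (Function.uncurry H)) :
    ∫⁻ L, H (foldB L) (foldA L) ∂(Measure.pi fun _ : Fin n => μ) =
      ∫⁻ t, ∫⁻ u, H t u ∂(Measure.pi fun _ => μ) ∂(Measure.pi fun _ => μ) := by
  have h1 := (measurePreserving_folds hn μ).lintegral_comp (f := fun p => H p.2 p.1)
    (hH.comp measurable_swap)
  rw [h1]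
  exact lintegral_prod_symm _ (hH.comp measurable_swap).aemeasurable

lemma lintegral_foldA_foldB {n : ℕ} (hn : Even n) (μ : Measure α) [IsProbabilityMeasure μ]
    {H : (Fin (n / 2) → α) → (Fin (n / 2) → α) → ℝ≥0∞} (hH : Measurable (Function.uncurry H)) :
    ∫⁻ L, H (foldA L) (foldB L) ∂(Measure.pi fun _ : Fin n => μ) =
      ∫⁻ t, ∫⁻ u, H t u ∂(Measure.pi fun _ => μ) ∂(Measure.pi fun _ => μ) := by
  have h1 := (measurePreserving_folds hn μ).lintegral_comp (f := fun p => H p.1 p.2) hH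
  rw [h1]
  exact lintegral_prod _ hH.aemeasurable

end Folds

/-! ### Cross-fitting errors -/

section CrossFit

variable {d n m : ℕ}

/-- The value at the `i`-th labeled covariate of a trained function, the function being trained on
the fold which does not contain `i`. -/
def labeledValue (D : (Fin (n / 2) → Vec d × Vec d) → Vec d → ℝ) (L : Fin n → Vec d × Vec d)
    (i : Fin n) : ℝ :=
  if Even (i : ℕ) then D (foldB L) (L i).2 else D (foldA L) (L i).2

/-- The value at the `i`-th unlabeled covariate of a trained function. -/
def unlabeledValue (D : (Fin (n / 2) → Vec d × Vec d) → Vec d → ℝ) (L : Fin n → Vec d × Vec d)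
    (U : Fin m → Vec d) (i : Fin m) : ℝ :=
  if Even (i : ℕ) then D (foldB L) (U i) else D (foldA L) (U i)

/-- The mean square of a trained function, over the training sample and a new covariate. -/
noncomputable def trainedSq {h : ℕ} (P : Measure (Vec d × Vec d))
    (D : (Fin h → Vec d × Vec d) → Vec d → ℝ) :
    ℝ≥0∞ :=
  ∫⁻ t, ∫⁻ p, ENNReal.ofReal (D t p.2 ^ 2) ∂P ∂(Measure.pi fun _ : Fin h => P)

lemma crossFit_castAdd (est : Regression d (n / 2)) (f : Vec d → ℝ) (L : Fin n → Vec d × Vec d)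
    (U : Fin m → Vec d) (i : Fin n) :
    crossFit est f L U (Fin.castAdd m i) = labeledValue (est f) L i := by
  simp [crossFit, labeledValue, covariates, Nat.odd_add_one]

/-- As `n` is even, position `n + i` has the parity of `i`. Labeled and unlabeled covariates are
therefore shared between the two estimates in the same way, which the cancellation of biases needs.
-/
lemma crossFit_natAdd (hn : Even n) (est : Regression d (n / 2)) (f : Vec d → ℝ)
    (L : Fin n → Vec d × Vec d) (U : Fin m → Vec d) (i : Fin m) :
    crossFit est f L U (Fin.natAdd n i) = unlabeledValue (est f) L U i := by
  simp [crossFit, unlabeledValue, covariates, Nat.odd_add_one, Nat.even_add, hn]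

lemma labeledValue_sub (D : (Fin (n / 2) → Vec d × Vec d) → Vec d → ℝ) (e : Vec d → ℝ)
    (L : Fin n → Vec d × Vec d) (i : Fin n) :
    labeledValue (fun t v => D t v - e v) L i = labeledValue D L i - e (L i).2 := by
  unfold labeledValue
  split_ifs <;> rfl

lemma unlabeledValue_sub (D : (Fin (n / 2) → Vec d × Vec d) → Vec d → ℝ) (e : Vec d → ℝ)
    (L : Fin n → Vec d × Vec d) (U : Fin m → Vec d) (i : Fin m) :
    unlabeledValue (fun t v => D t v - e v) L U i = unlabeledValue D L U i - e (U i) := by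
  unfold unlabeledValue
  split_ifs <;> rfl

variable {P : Measure (Vec d × Vec d)} [IsProbabilityMeasure P]
  {D : (Fin (n / 2) → Vec d × Vec d) → Vec d → ℝ}

lemma labeledValue_even (L : Fin n → Vec d × Vec d) (k : Fin (n / 2)) :
    labeledValue D L ⟨2 * k, by omega⟩ = D (foldB L) (foldA L k).2 := by
  simp [labeledValue, foldA]

lemma labeledValue_odd (L : Fin n → Vec d × Vec d) (k : Fin (n / 2)) :
    labeledValue D L ⟨2 * k + 1, by omega⟩ = D (foldA L) (foldB L k).2 := by
  simp [labeledValue, foldB]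

@[fun_prop]
lemma measurable_labeledValue (hD : Measurable (Function.uncurry D)) (i : Fin n) :
    Measurable fun L => labeledValue D L i := by
  unfold labeledValue
  split_ifs
  · exact hD.comp (g := Function.uncurry D)
      (f := fun L : Fin n → Vec d × Vec d => (foldB L, (L i).2)) (by fun_prop)
  · exact hD.comp (g := Function.uncurry D)
      (f := fun L : Fin n → Vec d × Vec d => (foldA L, (L i).2)) (by fun_prop)

lemma measurable_unlabeledValue (hD : Measurable (Function.uncurry D)) (i : Fin m) :
    Measurable fun p : (Fin n → Vec d × Vec d) × (Fin m → Vec d) =>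
      unlabeledValue D p.1 p.2 i := by
  unfold unlabeledValue
  split_ifs
  · exact hD.comp (g := Function.uncurry D)
      (f := fun p : (Fin n → Vec d × Vec d) × (Fin m → Vec d) => (foldB p.1, p.2 i)) (by fun_prop)
  · exact hD.comp (g := Function.uncurry D)
      (f := fun p : (Fin n → Vec d × Vec d) × (Fin m → Vec d) => (foldA p.1, p.2 i)) (by fun_prop)

/-- The covariate with index `i` lies outside the training fold, so it acts as a fresh one. -/
lemma lintegral_labeledValue_sq (hn : Even n) (hD : Measurable (Function.uncurry D)) (i : Fin n) :
    ∫⁻ L, ENNReal.ofReal (labeledValue D L i ^ 2) ∂(Measure.pi fun _ : Fin n => P) =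
      trainedSq P D := by
  obtain ⟨k, rfl⟩ := (foldEquiv hn).surjective i
  have hG : ∀ k : Fin (n / 2), Measurable (Function.uncurry fun
      (t u : Fin (n / 2) → Vec d × Vec d) => ENNReal.ofReal (D t (u k).2 ^ 2)) := fun k =>
    ((hD.comp (f := fun p : (Fin (n / 2) → Vec d × Vec d) × (Fin (n / 2) → Vec d × Vec d) =>
      (p.1, (p.2 k).2)) (by fun_prop)).pow_const 2).ennreal_ofReal
  have hp : ∀ t, Measurable fun p : Vec d × Vec d => ENNReal.ofReal (D t p.2 ^ 2) := fun t =>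
    ((hD.comp (f := fun p : Vec d × Vec d => (t, p.2)) (by fun_prop)).pow_const 2).ennreal_ofReal
  rcases k with k | k
  · simp only [foldEquiv, Equiv.coe_fn_mk, Sum.elim_inl, labeledValue_even]
    rw [lintegral_foldB_foldA hn P (hG k), trainedSq]
    exact lintegral_congr fun t => lintegral_pi_eval k (hp t)
  · simp only [foldEquiv, Equiv.coe_fn_mk, Sum.elim_inr, labeledValue_odd]
    rw [lintegral_foldA_foldB hn P (hG k), trainedSq]
    exact lintegral_congr fun t => lintegral_pi_eval k (hp t)

lemma lintegral_folds (hn : Even n) {H : (Fin (n / 2) → Vec d × Vec d) → ℝ≥0∞}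
    (hH : Measurable H) (i : ℕ) :
    ∫⁻ L, (if Even i then H (foldB L) else H (foldA L)) ∂(Measure.pi fun _ : Fin n => P) =
      ∫⁻ t, H t ∂(Measure.pi fun _ => P) := by
  split_ifs
  · exact (measurePreserving_snd.comp (measurePreserving_folds hn P)).lintegral_comp hH
  · exact (measurePreserving_fst.comp (measurePreserving_folds hn P)).lintegral_comp hH

lemma lintegral_unlabeledValue_sq (hn : Even n) (hD : Measurable (Function.uncurry D))
    (i : Fin m) :
    ∫⁻ L, ∫⁻ v, ENNReal.ofReal
        ((if Even (i : ℕ) then D (foldB L) v else D (foldA L) v) ^ 2) ∂P.snd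
        ∂(Measure.pi fun _ : Fin n => P) = trainedSq P D := by
  have hp : Measurable fun p : (Fin (n / 2) → Vec d × Vec d) × Vec d =>
      ENNReal.ofReal (D p.1 p.2 ^ 2) := (hD.pow_const 2).ennreal_ofReal
  have := lintegral_folds (P := P) hn
    (H := fun t => ∫⁻ v, ENNReal.ofReal (D t v ^ 2) ∂P.snd) hp.lintegral_prod_right' i
  rw [trainedSq]
  have h2 : ∀ t, ∫⁻ v, ENNReal.ofReal (D t v ^ 2) ∂P.snd =
      ∫⁻ p, ENNReal.ofReal (D t p.2 ^ 2) ∂P := fun t => by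
    exact lintegral_map (hp.comp (measurable_prodMk_left (x := t))) measurable_snd
  simp only [h2] at this
  rw [← this]
  refine lintegral_congr fun L => ?_
  split_ifs
  · exact h2 _
  · exact h2 _

/-- The mean of a trained function at a new covariate. -/
noncomputable def trainedMean {h : ℕ} (P : Measure (Vec d × Vec d))
    (D : (Fin h → Vec d × Vec d) → Vec d → ℝ)
    (t : Fin h → Vec d × Vec d) : ℝ :=
  ∫ p, D t p.2 ∂P

lemma measurable_trainedMean (hD : Measurable (Function.uncurry D)) :
    Measurable (trainedMean P D) := by
  have : StronglyMeasurable fun p : (Fin (n / 2) → Vec d × Vec d) × (Vec d × Vec d) =>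
      D p.1 p.2.2 :=
    (hD.comp (f := fun p : (Fin (n / 2) → Vec d × Vec d) × (Vec d × Vec d) => (p.1, p.2.2))
      (by fun_prop)).stronglyMeasurable
  exact this.integral_prod_right'.measurable

/-- For a fixed training fold `t` the summands are independent and centered, so their second moments
add; then `t` is averaged. -/
lemma lintegral_sum_trained_le (hD : Measurable (Function.uncurry D)) :
    ∫⁻ t, ∫⁻ u : Fin (n / 2) → Vec d × Vec d,
        ENNReal.ofReal ((∑ k, (D t (u k).2 - trainedMean P D t)) ^ 2)
        ∂(Measure.pi fun _ => P) ∂(Measure.pi fun _ => P) ≤ (n / 2 : ℕ) * trainedSq P D := by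
  rw [trainedSq, ← lintegral_const_mul']
  · refine lintegral_mono fun t => ?_
    refine (lintegral_sq_sum_sub_integral_le (μ := P) (g := fun _ p => D t p.2) fun _ =>
      (hD.comp (f := fun p : Vec d × Vec d => (t, p.2)) (by fun_prop))).trans ?_
    simp
  · simp

lemma measurable_sum_trained (hD : Measurable (Function.uncurry D)) :
    Measurable (Function.uncurry fun (t u : Fin (n / 2) → Vec d × Vec d) =>
      ENNReal.ofReal ((∑ k, (D t (u k).2 - trainedMean P D t)) ^ 2)) := by
  refine ((Finset.measurable_sum _ fun k _ => ?_).pow_const 2).ennreal_ofReal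
  refine Measurable.sub (hD.comp (f := fun p : (Fin (n / 2) → Vec d × Vec d) ×
    (Fin (n / 2) → Vec d × Vec d) => (p.1, (p.2 k).2)) (by fun_prop)) ?_
  exact (measurable_trainedMean hD).comp measurable_fst

lemma lintegral_sq_sum_unlabeledValue_le (hn : Even n) (hD : Measurable (Function.uncurry D)) :
    ∫⁻ q, ENNReal.ofReal ((∑ i, (unlabeledValue D q.1 q.2 i -
        if Even (i : ℕ) then trainedMean P D (foldB q.1) else trainedMean P D (foldA q.1))) ^ 2)
        ∂((Measure.pi fun _ : Fin n => P).prod (Measure.pi fun _ : Fin n => P.snd)) ≤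
      n * trainedSq P D := by
  have hDt : ∀ t, Measurable (D t) := fun t => hD.comp measurable_prodMk_left
  have hm := measurable_trainedMean (P := P) hD
  rw [lintegral_prod]
  · calc _ ≤ ∫⁻ L, ∑ i : Fin n, ∫⁻ v, ENNReal.ofReal
            ((if Even (i : ℕ) then D (foldB L) v else D (foldA L) v) ^ 2) ∂P.snd
            ∂(Measure.pi fun _ : Fin n => P) := by
          refine lintegral_mono fun L => ?_
          refine le_trans (le_of_eq ?_) (lintegral_sq_sum_sub_integral_le (μ := P.snd)
            (g := fun (i : Fin n) v => if Even (i : ℕ) then D (foldB L) v else D (foldA L) v)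
            fun i => ?_)
          · refine lintegral_congr fun U => ?_
            congr 3
            ext i
            simp only [unlabeledValue]
            congr 1
            split_ifs
            · rw [Measure.snd, integral_map (by fun_prop) (hDt _).aestronglyMeasurable]
              rfl
            · rw [Measure.snd, integral_map (by fun_prop) (hDt _).aestronglyMeasurable]
              rfl
          · split_ifs
            · exact hDt _
            · exact hDt _
      _ = _ := by
          rw [lintegral_finsetSum]
          · simp only [lintegral_unlabeledValue_sq hn hD]
            simp
          · intro i _
            refine Measurable.lintegral_prod_right' (f := fun p : (Fin n → Vec d × Vec d) × Vec d =>
              ENNReal.ofReal ((if Even (i : ℕ) then D (foldB p.1) p.2 else D (foldA p.1) p.2) ^ 2))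
              (Measurable.ennreal_ofReal (Measurable.pow_const ?_ 2))
            split_ifs
            · exact hD.comp (f := fun p : (Fin n → Vec d × Vec d) × Vec d => (foldB p.1, p.2))
                (by fun_prop)
            · exact hD.comp (f := fun p : (Fin n → Vec d × Vec d) × Vec d => (foldA p.1, p.2))
                (by fun_prop)
  · refine (Measurable.ennreal_ofReal (Measurable.pow_const
      (Finset.measurable_sum _ fun i _ => ?_) 2)).aemeasurable
    refine (measurable_unlabeledValue hD i).sub ?_
    split_ifs
    · exact hm.comp (by fun_prop)
    · exact hm.comp (by fun_prop)

/-- The heart of the argument. Each of the two conditional means given the training fold occurs `n /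
2` times among the unlabeled and `n / 2` times among the labeled covariates, so the sums may be
centered for free. What remains is one unlabeled fluctuation `A` and one labeled fluctuation per
fold, `B` and `B'`. These last two are mutually dependent, hence the crude bound by three squares,
which gives `3 (n + n / 2 + n / 2) = 6 n`. Without the cancellation the second moment would be of
order `n²`. -/
lemma lintegral_sq_sum_unlabeledValue_sub_labeledValue_le (hn : Even n)
    (hD : Measurable (Function.uncurry D)) :
    ∫⁻ q, ENNReal.ofReal ((∑ i, unlabeledValue D q.1 q.2 i - ∑ i, labeledValue D q.1 i) ^ 2)
        ∂((Measure.pi fun _ : Fin n => P).prod (Measure.pi fun _ : Fin n => P.snd)) ≤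
      6 * n * trainedSq P D := by
  set A : (Fin n → Vec d × Vec d) × (Fin n → Vec d) → ℝ := fun q =>
    ∑ i, (unlabeledValue D q.1 q.2 i -
        if Even (i : ℕ) then trainedMean P D (foldB q.1) else trainedMean P D (foldA q.1)) with hA
  set B : (Fin n → Vec d × Vec d) → ℝ := fun L =>
    ∑ k, (D (foldB L) (foldA L k).2 - trainedMean P D (foldB L)) with hB
  set B' : (Fin n → Vec d × Vec d) → ℝ := fun L =>
    ∑ k, (D (foldA L) (foldB L k).2 - trainedMean P D (foldA L)) with hB'
  have key : ∀ q : (Fin n → Vec d × Vec d) × (Fin n → Vec d),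
      ∑ i, unlabeledValue D q.1 q.2 i - ∑ i, labeledValue D q.1 i = A q - B q.1 - B' q.1 := by
    intro q
    have hodd : ∀ k : Fin (n / 2), ¬ Even (2 * (k : ℕ) + 1) := fun k =>
      Nat.not_even_iff_odd.2 ⟨k, rfl⟩
    have hev : ∀ k : Fin (n / 2), Even (2 * (k : ℕ)) := fun k => even_two_mul _
    simp only [hA, hB, hB', Finset.sum_sub_distrib]
    rw [sum_eq_sum_folds hn (fun i => labeledValue D q.1 i), sum_eq_sum_folds hn (fun i : Fin n =>
      if Even (i : ℕ) then trainedMean P D (foldB q.1) else trainedMean P D (foldA q.1))]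
    simp only [labeledValue_even, labeledValue_odd, hev, hodd, if_true, if_false]
    ring
  have hle : ∀ q : (Fin n → Vec d × Vec d) × (Fin n → Vec d),
      ENNReal.ofReal ((∑ i, unlabeledValue D q.1 q.2 i - ∑ i, labeledValue D q.1 i) ^ 2) ≤
        3 * (ENNReal.ofReal (A q ^ 2) + ENNReal.ofReal (B q.1 ^ 2) +
          ENNReal.ofReal (B' q.1 ^ 2)) := by
    intro q
    rw [key, ← ENNReal.ofReal_add (sq_nonneg _) (sq_nonneg _),
      ← ENNReal.ofReal_add (by positivity) (sq_nonneg _),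
      show (3 : ℝ≥0∞) = ENNReal.ofReal 3 by simp,
      ← ENNReal.ofReal_mul (by norm_num)]
    refine ENNReal.ofReal_le_ofReal ?_
    nlinarith [sq_nonneg (A q + B q.1), sq_nonneg (A q + B' q.1), sq_nonneg (B q.1 - B' q.1)]
  have hmB : Measurable fun L => ENNReal.ofReal (B L ^ 2) :=
    (measurable_sum_trained (P := P) hD).comp
      (f := fun L : Fin n → Vec d × Vec d => (foldB L, foldA L)) (by fun_prop)
  have hmB' : Measurable fun L => ENNReal.ofReal (B' L ^ 2) :=
    (measurable_sum_trained (P := P) hD).comp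
      (f := fun L : Fin n → Vec d × Vec d => (foldA L, foldB L)) (by fun_prop)
  have iB : ∫⁻ q, ENNReal.ofReal (B q.1 ^ 2)
      ∂((Measure.pi fun _ : Fin n => P).prod (Measure.pi fun _ : Fin n => P.snd)) ≤
        (n / 2 : ℕ) * trainedSq P D := by
    rw [measurePreserving_fst.lintegral_comp hmB,
      lintegral_foldB_foldA hn P (measurable_sum_trained (P := P) hD)]
    exact lintegral_sum_trained_le hD
  have iB' : ∫⁻ q, ENNReal.ofReal (B' q.1 ^ 2)
      ∂((Measure.pi fun _ : Fin n => P).prod (Measure.pi fun _ : Fin n => P.snd)) ≤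
        (n / 2 : ℕ) * trainedSq P D := by
    rw [measurePreserving_fst.lintegral_comp hmB',
      lintegral_foldA_foldB hn P (measurable_sum_trained (P := P) hD)]
    exact lintegral_sum_trained_le hD
  calc _ ≤ 3 * (n * trainedSq P D + (n / 2 : ℕ) * trainedSq P D +
        (n / 2 : ℕ) * trainedSq P D) := by
        refine (lintegral_mono hle).trans ?_
        have m1 : Measurable fun q : (Fin n → Vec d × Vec d) × (Fin n → Vec d) =>
            ENNReal.ofReal (B q.1 ^ 2) := hmB.comp measurable_fst
        have m2 : Measurable fun q : (Fin n → Vec d × Vec d) × (Fin n → Vec d) =>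
            ENNReal.ofReal (B' q.1 ^ 2) := hmB'.comp measurable_fst
        rw [lintegral_const_mul' _ _ (by simp), lintegral_add_right _ m2, lintegral_add_right _ m1]
        gcongr
        exact lintegral_sq_sum_unlabeledValue_le hn hD
    _ = _ := by
        have : (n : ℝ≥0∞) = (n / 2 : ℕ) + (n / 2 : ℕ) := by
          obtain ⟨k, rfl⟩ := hn
          norm_cast
          omega
        rw [this]
        ring

end CrossFit

/-! ### The estimators of one group when the regression is Gaussian -/

/-- Under `P`, the pair `(X, V)` satisfies `f(X) = e(V) + ε`, where `e(V)` and the noise `ε` are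
independent and Gaussian. -/
structure GaussianRegression {d : ℕ} (P : Measure (Vec d × Vec d)) (f e : Vec d → ℝ)
    (m vr ve : ℝ) : Prop where
  measurable_f : Measurable f
  measurable_e : Measurable e
  vr_nonneg : 0 ≤ vr
  ve_nonneg : 0 ≤ ve
  noise_law : P.map (fun p => f p.1 - e p.2) = gaussianReal 0 vr.toNNReal
  fit_law : P.map (fun p => e p.2) = gaussianReal m ve.toNNReal
  indep : IndepFun (fun p => f p.1 - e p.2) (fun p => e p.2) P

/-- The cross-fitted mean estimator when the conditional expectation `e` is known. -/
noncomputable def oracleMean {d n m : ℕ} (f e : Vec d → ℝ) (L : Fin n → Vec d × Vec d)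
    (U : Fin m → Vec d) : ℝ :=
  empMean (fun i => f (L i).1 - e (L i).2) + empMean (fun i => e (covariates L U i))

/-- The law of the labeled pairs and of the unlabeled covariates. -/
noncomputable def sampleLaw {d : ℕ} (P : Measure (Vec d × Vec d)) (n m : ℕ) :
    Measure ((Fin n → Vec d × Vec d) × (Fin m → Vec d)) :=
  (Measure.pi fun _ : Fin n => P).prod (Measure.pi fun _ : Fin m => P.snd)

instance {d : ℕ} (P : Measure (Vec d × Vec d)) [IsProbabilityMeasure P] (n m : ℕ) :
    IsProbabilityMeasure (sampleLaw P n m) := by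
  unfold sampleLaw
  infer_instance

section Group

variable {d n m : ℕ} {P : Measure (Vec d × Vec d)} [IsProbabilityMeasure P]
  {f e : Vec d → ℝ} {mean vr ve : ℝ}

lemma measurePreserving_covariates :
    MeasurePreserving (fun q : (Fin n → Vec d × Vec d) × (Fin m → Vec d) => covariates q.1 q.2)
      (sampleLaw P n m) (Measure.pi fun _ : Fin (n + m) => P.snd) := by
  have h0 : MeasurePreserving (fun (L : Fin n → Vec d × Vec d) i => (L i).2)
      (Measure.pi fun _ : Fin n => P) (Measure.pi fun _ : Fin n => P.snd) :=
    measurePreserving_pi _ _ fun _ => measurable_snd.measurePreserving P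
  have h1 := h0.prod (MeasurePreserving.id (Measure.pi fun _ : Fin m => P.snd))
  have h2 := (measurePreserving_sumPiEquivProdPi (fun _ : Fin n ⊕ Fin m => P.snd)).symm
  have h3 := measurePreserving_piCongrLeft (fun _ : Fin (n + m) => P.snd) finSumFinEquiv
  have h4 := (h3.comp h2).comp h1
  convert! h4 using 1
  ext q : 1
  refine (MeasurableEquiv.symm_apply_eq
    (MeasurableEquiv.piCongrLeft (fun _ : Fin (n + m) => Vec d) finSumFinEquiv)).1 ?_
  ext x : 1
  rcases x with i | i
  · change covariates q.1 q.2 (Fin.castAdd m i) = _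
    simp only [covariates, Fin.append_left]
    rfl
  · change covariates q.1 q.2 (Fin.natAdd n i) = _
    simp only [covariates, Fin.append_right]
    rfl

/-- Regrouped by observation: a labeled covariate enters both averages, which leaves half of its
fitted value next to the noise. -/
lemma oracleMean_eq (hn : 0 < n) (L : Fin n → Vec d × Vec d) (U : Fin n → Vec d) :
    oracleMean f e L U =
      (n : ℝ)⁻¹ * ∑ i, ((f (L i).1 - e (L i).2) + 2⁻¹ * e (L i).2) +
        (2 * n : ℝ)⁻¹ * ∑ i, e (U i) := by
  have hn' : (n : ℝ) ≠ 0 := by positivity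
  simp only [oracleMean, empMean, covariates, Fin.sum_univ_add, Fin.append_left, Fin.append_right,
    Finset.sum_add_distrib, ← Finset.mul_sum]
  push_cast
  field_simp
  ring

/-- The labeled part has variance `(vr + ve / 4) / n` and the unlabeled part `ve / (4 n)`; their sum
is `(vr + ve / 2) / n`. -/
lemma GaussianRegression.map_oracleMean (h : GaussianRegression P f e mean vr ve) (hn : 0 < n) :
    (sampleLaw P n n).map (fun q => oracleMean f e q.1 q.2) =
      gaussianReal mean ((vr + ve / 2) / n).toNNReal := by
  have hf := h.measurable_f
  have he := h.measurable_e
  have hr0 := h.vr_nonneg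
  have he0 := h.ve_nonneg
  have hn' : (n : ℝ) ≠ 0 := by positivity
  have h1 : P.map (fun p => (f p.1 - e p.2) + 2⁻¹ * e p.2) =
      gaussianReal (0 + 2⁻¹ * mean) (vr + 2⁻¹ ^ 2 * ve).toNNReal := by
    refine map_add_of_indepFun_gaussianReal (h.indep.comp measurable_id (measurable_const_mul 2⁻¹))
      hr0 (by positivity) h.noise_law ?_
    exact map_const_mul_of_map_eq_gaussianReal (by fun_prop) h.fit_law _
  have h2 := map_const_mul_of_map_eq_gaussianReal (by fun_prop)
    (map_sum_pi_of_map_eq_gaussianReal (ι := Fin n) (by fun_prop) (by positivity) h1) (n : ℝ)⁻¹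
  have h3 : P.snd.map e = gaussianReal mean ve.toNNReal := by
    rw [← h.fit_law, Measure.snd, Measure.map_map he measurable_snd]
    rfl
  have h4 := map_const_mul_of_map_eq_gaussianReal (by fun_prop)
    (map_sum_pi_of_map_eq_gaussianReal (ι := Fin n) he he0 h3) (2 * n : ℝ)⁻¹
  have h5 := map_prod_add_of_map_eq_gaussianReal (by fun_prop) (by fun_prop) (by positivity)
    (by positivity) h2 h4
  simp only [oracleMean_eq hn, sampleLaw]
  rw [h5]
  congr 1
  · simp only [Fintype.card_fin]
    field_simp
    ring
  · congr 1
    simp only [Fintype.card_fin]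
    field_simp
    ring

/-- At a labeled covariate the error enters the residual average with weight `-1 / n` and the fitted
average with weight `1 / (2 n)`, hence `-1 / (2 n)` in all, opposite to its weight at an unlabeled
covariate. -/
lemma crossMean_sub_oracleMean (hn : Even n) (hn0 : 0 < n) (est : Regression d (n / 2))
    (L : Fin n → Vec d × Vec d) (U : Fin n → Vec d) :
    crossMean est f L U - oracleMean f e L U =
      (2 * n : ℝ)⁻¹ * (∑ i, unlabeledValue (fun t v => est f t v - e v) L U i -
        ∑ i, labeledValue (fun t v => est f t v - e v) L i) := by
  have hn' : (n : ℝ) ≠ 0 := by positivity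
  simp only [crossMean, oracleMean, residual, empMean, Fin.sum_univ_add, crossFit_castAdd,
    crossFit_natAdd hn, covariates, Fin.append_left, Fin.append_right, labeledValue_sub,
    unlabeledValue_sub, Finset.sum_sub_distrib]
  push_cast
  field_simp
  ring

lemma lintegral_sq_crossMean_sub_oracleMean_le (hn : Even n) (hn0 : 0 < n)
    {est : Regression d (n / 2)} (he : Measurable e)
    (hest : Measurable (Function.uncurry (est f))) :
    ∫⁻ q, ENNReal.ofReal ((crossMean est f q.1 q.2 - oracleMean f e q.1 q.2) ^ 2)
        ∂(sampleLaw P n n) ≤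
      ENNReal.ofReal (3 / (2 * n)) * trainedSq P (fun t v => est f t v - e v) := by
  have hD : Measurable (Function.uncurry fun (t : Fin (n / 2) → Vec d × Vec d) v =>
      est f t v - e v) := hest.sub (he.comp measurable_snd)
  have hn' : (0 : ℝ) < n := by positivity
  simp only [crossMean_sub_oracleMean hn hn0, mul_pow]
  simp only [ENNReal.ofReal_mul (sq_nonneg (2 * n : ℝ)⁻¹)]
  rw [lintegral_const_mul' _ _ ENNReal.ofReal_ne_top]
  refine (mul_le_mul_right (lintegral_sq_sum_unlabeledValue_sub_labeledValue_le hn hD) _).trans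
    (le_of_eq ?_)
  rw [← mul_assoc]
  congr 1
  rw [show (6 : ℝ≥0∞) * n = ENNReal.ofReal (6 * n) by
    rw [ENNReal.ofReal_mul (by norm_num), ENNReal.ofReal_natCast]; norm_num,
    ← ENNReal.ofReal_mul (by positivity)]
  congr 1
  field_simp
  norm_num

/-- The perturbations `g i` may depend on each other and on the `x i`: only their second moments are
used. This allows the cross-fitting errors, which share training data. -/
lemma lintegral_abs_empVar_add_sub_le {Ω : Type*} {mΩ : MeasurableSpace Ω} {ν : Measure Ω}
    [IsProbabilityMeasure ν] {N : ℕ} (hN : 0 < N) {x g : Fin N → Ω → ℝ}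
    (hg : ∀ i, Measurable (g i)) {v b θ : ℝ} {M : ℝ≥0∞} (hv : 0 ≤ v) (hb : 0 ≤ b) (hθ : 0 < θ)
    (hθ1 : θ ≤ 1)
    (hxv : ∫⁻ ω, ENNReal.ofReal |empVar (fun i => x i ω) - v| ∂ν ≤ ENNReal.ofReal b)
    (hgM : ∀ i, ∫⁻ ω, ENNReal.ofReal (g i ω ^ 2) ∂ν ≤ M) :
    ∫⁻ ω, ENNReal.ofReal |empVar (fun i => x i ω + g i ω) - v| ∂ν ≤
      ENNReal.ofReal (θ * v + 2 * b) + ENNReal.ofReal (2 * θ⁻¹) * M := by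
  have hN' : (0 : ℝ) < N := by positivity
  have h1θ : 1 ≤ θ⁻¹ := (one_le_inv₀ hθ).2 hθ1
  have key : ∀ ω, |empVar (fun i => x i ω + g i ω) - v| ≤
      θ * v + 2 * |empVar (fun i => x i ω) - v| +
        (2 * θ⁻¹) * ((N : ℝ)⁻¹ * ∑ i, g i ω ^ 2) := by
    intro ω
    have h1 := abs_empVar_add_sub_le hN (fun i => x i ω) (fun i => g i ω) hθ
    have h2 := empVar_le (fun i => g i ω)
    have h3 : empMean (fun i => g i ω ^ 2) = (N : ℝ)⁻¹ * ∑ i, g i ω ^ 2 := by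
      rw [empMean, div_eq_inv_mul]
    rw [h3] at h2
    have h4 : 0 ≤ (N : ℝ)⁻¹ * ∑ i, g i ω ^ 2 := by positivity
    set a := empVar (fun i => x i ω)
    have h5 : |empVar (fun i => x i ω + g i ω) - v| ≤
        |empVar (fun i => x i ω + g i ω) - a| + |a - v| := abs_sub_le _ _ _
    have h6 : θ * a ≤ θ * v + |a - v| := by
      have : θ * (a - v) ≤ 1 * |a - v| :=
        (mul_le_mul_of_nonneg_left (le_abs_self _) hθ.le).trans
          (mul_le_mul_of_nonneg_right hθ1 (abs_nonneg _))
      linarith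
    have h7 : (1 + θ⁻¹) * empVar (fun i => g i ω) ≤ (2 * θ⁻¹) * ((N : ℝ)⁻¹ * ∑ i, g i ω ^ 2) :=
      (mul_le_mul_of_nonneg_left h2 (by positivity)).trans
        (mul_le_mul_of_nonneg_right (by linarith) h4)
    linarith
  calc _ ≤ ∫⁻ ω, (ENNReal.ofReal (θ * v) + 2 * ENNReal.ofReal |empVar (fun i => x i ω) - v| +
        ENNReal.ofReal (2 * θ⁻¹) * (ENNReal.ofReal (N : ℝ)⁻¹ * ∑ i, ENNReal.ofReal (g i ω ^ 2)))
          ∂ν := by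
        refine lintegral_mono fun ω => (ENNReal.ofReal_le_ofReal (key ω)).trans (le_of_eq ?_)
        have h4 : 0 ≤ (N : ℝ)⁻¹ * ∑ i, g i ω ^ 2 := by positivity
        rw [ENNReal.ofReal_add (by positivity) (by positivity),
          ENNReal.ofReal_add (by positivity) (by positivity),
          ENNReal.ofReal_mul (p := 2) (by norm_num), ENNReal.ofReal_mul (p := 2 * θ⁻¹)
            (by positivity), ENNReal.ofReal_mul (p := (N : ℝ)⁻¹) (by positivity),
          ENNReal.ofReal_sum_of_nonneg fun i _ => sq_nonneg _]
        norm_num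
    _ ≤ ENNReal.ofReal (θ * v) + 2 * ENNReal.ofReal b + ENNReal.ofReal (2 * θ⁻¹) *
          (ENNReal.ofReal (N : ℝ)⁻¹ * ∑ _i : Fin N, M) := by
        have hms : Measurable fun ω => ∑ i, ENNReal.ofReal (g i ω ^ 2) :=
          Finset.measurable_sum _ fun i _ => ((hg i).pow_const 2).ennreal_ofReal
        rw [lintegral_add_right _ (by fun_prop), lintegral_add_left (by fun_prop),
          lintegral_const_mul' _ _ ENNReal.ofReal_ne_top,
          lintegral_const_mul' _ _ ENNReal.ofReal_ne_top,
          lintegral_const_mul' _ _ (by norm_num), lintegral_const, measure_univ, mul_one,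
          lintegral_finsetSum _ fun i _ => ((hg i).pow_const 2).ennreal_ofReal]
        gcongr
        exact hgM _
    _ = _ := by
        rw [Finset.sum_const, Finset.card_univ, Fintype.card_fin, nsmul_eq_mul, ← mul_assoc
          (ENNReal.ofReal (N : ℝ)⁻¹), ← ENNReal.ofReal_natCast N,
          ← ENNReal.ofReal_mul (by positivity), inv_mul_cancel₀ hN'.ne', ENNReal.ofReal_one,
          one_mul, ENNReal.ofReal_add (by positivity) (by positivity),
          ENNReal.ofReal_mul (p := 2) (by norm_num)]
        norm_num

lemma lintegral_sq_unlabeledValue (hn : Even n)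
    {D : (Fin (n / 2) → Vec d × Vec d) → Vec d → ℝ} (hD : Measurable (Function.uncurry D))
    (i : Fin m) :
    ∫⁻ q, ENNReal.ofReal (unlabeledValue D q.1 q.2 i ^ 2) ∂(sampleLaw P n m) =
      trainedSq P D := by
  rw [sampleLaw, lintegral_prod _
    ((measurable_unlabeledValue hD i).pow_const 2).ennreal_ofReal.aemeasurable,
    ← lintegral_unlabeledValue_sq (m := m) hn hD i]
  refine lintegral_congr fun L => ?_
  refine lintegral_pi_eval (μ := P.snd) i
    (G := fun v => ENNReal.ofReal ((if Even (i : ℕ) then D (foldB L) v else D (foldA L) v) ^ 2)) ?_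
  have hDt : ∀ t, Measurable (D t) := fun t => hD.comp measurable_prodMk_left
  split_ifs
  · exact ((hDt _).pow_const 2).ennreal_ofReal
  · exact ((hDt _).pow_const 2).ennreal_ofReal

lemma lintegral_sq_labeledValue (hn : Even n)
    {D : (Fin (n / 2) → Vec d × Vec d) → Vec d → ℝ} (hD : Measurable (Function.uncurry D))
    (i : Fin n) :
    ∫⁻ q, ENNReal.ofReal (labeledValue D q.1 i ^ 2) ∂(sampleLaw P n m) = trainedSq P D := by
  rw [← lintegral_labeledValue_sq hn hD i, sampleLaw]
  exact measurePreserving_fst.lintegral_comp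
    ((measurable_labeledValue hD i).pow_const 2).ennreal_ofReal

/-- The residuals are the true noise minus the estimation error, and the fitted values are the true
fit plus that error. Each empirical variance is thus a perturbation of that of an i.i.d. Gaussian
sample, of size `n` and `2 n`. -/
lemma GaussianRegression.lintegral_abs_crossVar_sub_le (h : GaussianRegression P f e mean vr ve)
    (hn : Even n) (hn0 : 0 < n) {est : Regression d (n / 2)}
    (hest : Measurable (Function.uncurry (est f))) {θ : ℝ} (hθ : 0 < θ) (hθ1 : θ ≤ 1)
    (hV : 0 < vr + ve) :
    ∫⁻ q, ENNReal.ofReal |n * crossVar est f q.1 q.2 - (vr + ve / 2)| ∂(sampleLaw P n n) ≤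
      2 * (ENNReal.ofReal ((vr + ve) * (θ + 2 * (fourthMoment + 2) / √n)) +
        ENNReal.ofReal (2 * θ⁻¹) * trainedSq P (fun t v => est f t v - e v)) := by
  have hf := h.measurable_f
  have he := h.measurable_e
  have hr0 := h.vr_nonneg
  have he0 := h.ve_nonneg
  have hK := fourthMoment_nonneg
  have hn' : (0 : ℝ) < n := by positivity
  have hsn : 0 < √(n : ℝ) := Real.sqrt_pos.2 hn'
  set D : (Fin (n / 2) → Vec d × Vec d) → Vec d → ℝ := fun t v => est f t v - e v with hDdef
  have hD : Measurable (Function.uncurry D) := hest.sub (he.comp measurable_snd)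
  set b := (vr + ve) * (fourthMoment + 2) / √n with hb
  have hb0 : 0 ≤ b := by positivity
  have hres : ∫⁻ q, ENNReal.ofReal |empVar (residual est f q.1 q.2) - vr| ∂(sampleLaw P n n) ≤
      ENNReal.ofReal (θ * vr + 2 * b) + ENNReal.ofReal (2 * θ⁻¹) * trainedSq P D := by
    have h1 := lintegral_abs_empVar_add_sub_le (ν := sampleLaw P n n) hn0
      (x := fun i q => f (q.1 i).1 - e (q.1 i).2) (g := fun i q => -labeledValue D q.1 i)
      (fun i => ((measurable_labeledValue hD i).comp measurable_fst).neg) hr0 hb0 hθ hθ1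
      (M := trainedSq P D) ?_ ?_
    · refine le_trans (le_of_eq (lintegral_congr fun q => ?_)) h1
      have : residual est f q.1 q.2 =
          fun i => f (q.1 i).1 - e (q.1 i).2 + -labeledValue D q.1 i := by
        ext i
        rw [residual, crossFit_castAdd, hDdef, labeledValue_sub]
        ring
      rw [this]
    · rw [sampleLaw]
      have h2 := lintegral_abs_empVar_sub_le (μ := P) hn0 (g := fun p => f p.1 - e p.2)
        (by fun_prop) hr0 (le_add_of_nonneg_right he0) hV h.noise_law
      refine le_trans (le_of_eq ?_) h2
      refine measurePreserving_fst.lintegral_comp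
        (f := fun t : Fin n → Vec d × Vec d =>
          ENNReal.ofReal |empVar (fun i => f (t i).1 - e (t i).2) - vr|) ?_
      unfold empVar empMean
      fun_prop
    · intro i
      simp only [neg_sq]
      exact (lintegral_sq_labeledValue hn hD i).le
  have hfit : ∫⁻ q, ENNReal.ofReal |empVar (crossFit est f q.1 q.2) - ve| ∂(sampleLaw P n n) ≤
      ENNReal.ofReal (θ * ve + 2 * b) + ENNReal.ofReal (2 * θ⁻¹) * trainedSq P D := by
    have hgap : ∀ i, (∀ q : (Fin n → Vec d × Vec d) × (Fin n → Vec d),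
        crossFit est f q.1 q.2 (Fin.castAdd n i) - e (covariates q.1 q.2 (Fin.castAdd n i)) =
          labeledValue D q.1 i) ∧ (∀ q : (Fin n → Vec d × Vec d) × (Fin n → Vec d),
        crossFit est f q.1 q.2 (Fin.natAdd n i) - e (covariates q.1 q.2 (Fin.natAdd n i)) =
          unlabeledValue D q.1 q.2 i) := by
      intro i
      constructor <;> intro q
      · rw [crossFit_castAdd, hDdef, labeledValue_sub, covariates, Fin.append_left]
      · rw [crossFit_natAdd hn, hDdef, unlabeledValue_sub, covariates, Fin.append_right]
    have h1 := lintegral_abs_empVar_add_sub_le (ν := sampleLaw P n n) (N := n + n) (by omega)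
      (x := fun i q => e (covariates q.1 q.2 i))
      (g := fun i q => crossFit est f q.1 q.2 i - e (covariates q.1 q.2 i))
      (fun i => ?_) he0 hb0 hθ hθ1
      (M := trainedSq P D) ?_ ?_
    · simpa only [add_sub_cancel] using h1
    · refine Fin.addCases (fun i => ?_) (fun i => ?_) i
      · simp only [(hgap i).1]
        exact (measurable_labeledValue hD i).comp measurable_fst
      · simp only [(hgap i).2]
        exact measurable_unlabeledValue hD i
    · have h3 : P.snd.map e = gaussianReal mean ve.toNNReal := by
        rw [← h.fit_law, Measure.snd, Measure.map_map he measurable_snd]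
        rfl
      have h2 := lintegral_abs_empVar_sub_le (μ := P.snd) (N := n + n) (by omega) he he0
        (le_add_of_nonneg_left hr0) hV h3
      refine le_trans (le_of_eq ?_) (h2.trans (ENNReal.ofReal_le_ofReal ?_))
      · refine measurePreserving_covariates.lintegral_comp
          (f := fun t : Fin (n + n) → Vec d => ENNReal.ofReal |empVar (fun i => e (t i)) - ve|) ?_
        unfold empVar empMean
        fun_prop
      · rw [hb]
        gcongr
        linarith
    · intro i
      refine Fin.addCases (fun i => ?_) (fun i => ?_) i
      · simp only [(hgap i).1]
        exact (lintegral_sq_labeledValue hn hD i).le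
      · simp only [(hgap i).2]
        exact (lintegral_sq_unlabeledValue hn hD i).le
  have hpt : ∀ q : (Fin n → Vec d × Vec d) × (Fin n → Vec d),
      ENNReal.ofReal |n * crossVar est f q.1 q.2 - (vr + ve / 2)| ≤
        ENNReal.ofReal |empVar (residual est f q.1 q.2) - vr| +
          ENNReal.ofReal |empVar (crossFit est f q.1 q.2) - ve| := by
    intro q
    rw [← ENNReal.ofReal_add (abs_nonneg _) (abs_nonneg _)]
    refine ENNReal.ofReal_le_ofReal ?_
    -- The weight `1 / (2 n)` of the second variance turns into the factor `1 / 2`.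
    have e1 : n * crossVar est f q.1 q.2 - (vr + ve / 2) =
        (empVar (residual est f q.1 q.2) - vr) +
          2⁻¹ * (empVar (crossFit est f q.1 q.2) - ve) := by
      rw [crossVar]
      push_cast
      field_simp
      ring
    rw [e1]
    refine (abs_add_le _ _).trans (add_le_add le_rfl ?_)
    rw [abs_mul, abs_of_pos (by norm_num : (0 : ℝ) < 2⁻¹)]
    linarith [abs_nonneg (empVar (crossFit est f q.1 q.2) - ve)]
  have hmono : ∀ w, w ≤ vr + ve → ENNReal.ofReal (θ * w + 2 * b) ≤
      ENNReal.ofReal ((vr + ve) * (θ + 2 * (fourthMoment + 2) / √n)) := by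
    intro w hw
    refine ENNReal.ofReal_le_ofReal ?_
    have : θ * w ≤ θ * (vr + ve) := by gcongr
    calc θ * w + 2 * b ≤ θ * (vr + ve) + 2 * b := by gcongr
      _ = _ := by rw [hb]; ring
  have hmeas : Measurable fun q : (Fin n → Vec d × Vec d) × (Fin n → Vec d) =>
      ENNReal.ofReal |empVar (residual est f q.1 q.2) - vr| := by
    have : ∀ i, Measurable fun q : (Fin n → Vec d × Vec d) × (Fin n → Vec d) =>
        residual est f q.1 q.2 i := by
      intro i
      simp only [residual, crossFit_castAdd]
      refine Measurable.sub (by fun_prop) ?_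
      exact (measurable_labeledValue (D := est f) hest i).comp measurable_fst
    unfold empVar empMean
    fun_prop
  refine (lintegral_mono hpt).trans ?_
  rw [lintegral_add_left hmeas, two_mul]
  exact add_le_add (hres.trans (add_le_add (hmono vr (by linarith)) le_rfl))
    (hfit.trans (add_le_add (hmono ve (by linarith)) le_rfl))

end Group

/-! ### The conditional power given the witness function -/

lemma measureReal_ge_le_of_lintegral_le {Ω : Type*} {mΩ : MeasurableSpace Ω} {ν : Measure Ω}
    {X : Ω → ℝ} (hX : Measurable X) {b c : ℝ} (hb : 0 ≤ b) (hc : 0 < c)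
    (h : ∫⁻ ω, ENNReal.ofReal (X ω) ∂ν ≤ ENNReal.ofReal b) :
    ν.real {ω | c ≤ X ω} ≤ b / c := by
  have h1 := mul_meas_ge_le_lintegral (μ := ν) hX.ennreal_ofReal (ENNReal.ofReal c)
  have h2 : {ω | ENNReal.ofReal c ≤ ENNReal.ofReal (X ω)} = {ω | c ≤ X ω} := by
    ext ω
    simp only [Set.mem_ofPred_eq]
    constructor
    · intro h3
      by_contra h4
      rw [not_le] at h4
      exact absurd h3 (not_le.2 ((ENNReal.ofReal_lt_ofReal_iff hc).2 h4))
    · exact fun h3 => ENNReal.ofReal_le_ofReal h3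
  rw [h2] at h1
  rw [measureReal_def]
  refine ENNReal.toReal_le_of_le_ofReal (by positivity) ?_
  rw [ENNReal.ofReal_div_of_pos hc, ENNReal.le_div_iff_mul_le (by simp [hc]) (by simp), mul_comm]
  exact h1.trans h

section Measurability

variable {d n m : ℕ} {est : Regression d (n / 2)} {f e : Vec d → ℝ}

@[fun_prop]
lemma measurable_covariates (i : Fin (n + m)) :
    Measurable fun q : (Fin n → Vec d × Vec d) × (Fin m → Vec d) => covariates q.1 q.2 i := by
  refine Fin.addCases (fun i => ?_) (fun i => ?_) i
  · simp only [covariates, Fin.append_left]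
    fun_prop
  · simp only [covariates, Fin.append_right]
    fun_prop

lemma measurable_crossFit (hest : Measurable (Function.uncurry (est f))) (i : Fin (n + m)) :
    Measurable fun q : (Fin n → Vec d × Vec d) × (Fin m → Vec d) => crossFit est f q.1 q.2 i := by
  unfold crossFit
  split_ifs
  · exact hest.comp (f := fun q : (Fin n → Vec d × Vec d) × (Fin m → Vec d) =>
      (foldB q.1, covariates q.1 q.2 i)) (by fun_prop)
  · exact hest.comp (f := fun q : (Fin n → Vec d × Vec d) × (Fin m → Vec d) =>
      (foldA q.1, covariates q.1 q.2 i)) (by fun_prop)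

lemma measurable_crossMean (hf : Measurable f) (hest : Measurable (Function.uncurry (est f))) :
    Measurable fun q : (Fin n → Vec d × Vec d) × (Fin m → Vec d) => crossMean est f q.1 q.2 := by
  have h1 := fun i => measurable_crossFit (m := m) hest i
  unfold crossMean residual empMean
  fun_prop

lemma measurable_crossVar (hf : Measurable f) (hest : Measurable (Function.uncurry (est f))) :
    Measurable fun q : (Fin n → Vec d × Vec d) × (Fin m → Vec d) => crossVar est f q.1 q.2 := by
  have h1 := fun i => measurable_crossFit (m := m) hest i
  unfold crossVar residual empVar empMean
  fun_prop

lemma measurable_oracleMean (hf : Measurable f) (he : Measurable e) :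
    Measurable fun q : (Fin n → Vec d × Vec d) × (Fin m → Vec d) => oracleMean f e q.1 q.2 := by
  unfold oracleMean empMean
  fun_prop

end Measurability

section TwoSample

variable {Ω₁ Ω₂ : Type*} {mΩ₁ : MeasurableSpace Ω₁} {mΩ₂ : MeasurableSpace Ω₂}
  {μ₁ : Measure Ω₁} {μ₂ : Measure Ω₂} [IsProbabilityMeasure μ₁] [IsProbabilityMeasure μ₂]

lemma lintegral_prod_add_le {A : Ω₁ → ℝ} {B : Ω₂ → ℝ} (hA : Measurable A) (hB : Measurable B)
    (hA0 : ∀ x, 0 ≤ A x) (hB0 : ∀ x, 0 ≤ B x) {b : ℝ} (hb : 0 ≤ b)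
    (iA : ∫⁻ x, ENNReal.ofReal (A x) ∂μ₁ ≤ ENNReal.ofReal b)
    (iB : ∫⁻ x, ENNReal.ofReal (B x) ∂μ₂ ≤ ENNReal.ofReal b) :
    ∫⁻ ω, ENNReal.ofReal (A ω.1 + B ω.2) ∂(μ₁.prod μ₂) ≤ ENNReal.ofReal (2 * b) := by
  simp only [ENNReal.ofReal_add (hA0 _) (hB0 _)]
  rw [lintegral_add_left (by fun_prop), two_mul,
    ENNReal.ofReal_add hb hb]
  refine add_le_add (le_trans (le_of_eq ?_) iA) (le_trans (le_of_eq ?_) iB)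
  · exact measurePreserving_fst.lintegral_comp hA.ennreal_ofReal
  · exact measurePreserving_snd.lintegral_comp hB.ennreal_ofReal

/-- Both bad events of `abs_measureReal_studentized_sub_le` are bounded by Markov's inequality. The
groups have the same oracle variance `q / n`, so `σ² = 2 q / n`. -/
lemma abs_two_sample_power_sub_le {C₁ O₁ S₁ : Ω₁ → ℝ} {C₂ O₂ S₂ : Ω₂ → ℝ}
    (hC₁ : Measurable C₁) (hO₁ : Measurable O₁) (hS₁ : Measurable S₁)
    (hC₂ : Measurable C₂) (hO₂ : Measurable O₂) (hS₂ : Measurable S₂)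
    {m₁ m₂ q n b₁ b₂ κ : ℝ} (hq : 0 < q) (hn : 0 < n) (hb₁ : 0 ≤ b₁) (hb₂ : 0 ≤ b₂)
    (hκ : 0 < κ) (hκ1 : κ ≤ 1)
    (law₁ : μ₁.map O₁ = gaussianReal m₁ (q / n).toNNReal)
    (law₂ : μ₂.map O₂ = gaussianReal m₂ (q / n).toNNReal)
    (hCO₁ : ∫⁻ x, ENNReal.ofReal ((C₁ x - O₁ x) ^ 2) ∂μ₁ ≤ ENNReal.ofReal b₁)
    (hCO₂ : ∫⁻ x, ENNReal.ofReal ((C₂ x - O₂ x) ^ 2) ∂μ₂ ≤ ENNReal.ofReal b₁)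
    (hSq₁ : ∫⁻ x, ENNReal.ofReal |n * S₁ x - q| ∂μ₁ ≤ ENNReal.ofReal b₂)
    (hSq₂ : ∫⁻ x, ENNReal.ofReal |n * S₂ x - q| ∂μ₂ ≤ ENNReal.ofReal b₂) (t : ℝ) :
    |(μ₁.prod μ₂).real {ω | t < (C₁ ω.1 - C₂ ω.2) / √(S₁ ω.1 + S₂ ω.2)} -
      Phi (-t + (m₁ - m₂) / √(2 * q / n))| ≤
      κ * (|t| + 1) + 2 * b₁ / (κ ^ 2 * (q / n)) + b₂ / (κ * q) := by
  set ν := μ₁.prod μ₂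
  set σ := √(2 * q / n) with hσ
  have hσ0 : 0 < σ := Real.sqrt_pos.2 (by positivity)
  have hσ2 : σ ^ 2 = 2 * q / n := Real.sq_sqrt (by positivity)
  have hlaw : ν.map (fun ω => O₁ ω.1 - O₂ ω.2) = gaussianReal (m₁ - m₂) (σ ^ 2).toNNReal := by
    have h2 := map_const_mul_of_map_eq_gaussianReal hO₂ law₂ (-1)
    have h3 := map_prod_add_of_map_eq_gaussianReal hO₁ (by fun_prop) (by positivity)
      (by positivity) law₁ h2
    simp only [neg_one_mul, ← sub_eq_add_neg] at h3
    rw [h3, hσ2]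
    congr 2
    ring
  have main := abs_measureReal_studentized_sub_le (ν := ν)
    (N := fun ω => C₁ ω.1 - C₂ ω.2) (S := fun ω => S₁ ω.1 + S₂ ω.2)
    (O := fun ω => O₁ ω.1 - O₂ ω.2) (by fun_prop) hσ0 hlaw t hκ hκ1
  refine main.trans (add_le_add (add_le_add le_rfl ?_) ?_)
  -- The level `κ² σ² / 2` comes from `(x - y)² ≤ 2 x² + 2 y²`.
  · have hsub : {ω : Ω₁ × Ω₂ | κ * σ ≤ |C₁ ω.1 - C₂ ω.2 - (O₁ ω.1 - O₂ ω.2)|} ⊆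
        {ω | κ ^ 2 * σ ^ 2 / 2 ≤ (C₁ ω.1 - O₁ ω.1) ^ 2 + (C₂ ω.2 - O₂ ω.2) ^ 2} := by
      intro ω hω
      simp only [Set.mem_ofPred_eq] at hω ⊢
      have h1 := pow_le_pow_left₀ (by positivity) hω 2
      rw [sq_abs, mul_pow] at h1
      nlinarith [sq_nonneg (C₁ ω.1 - O₁ ω.1 + (C₂ ω.2 - O₂ ω.2))]
    refine (measureReal_mono hsub).trans ?_
    refine (measureReal_ge_le_of_lintegral_le (by fun_prop) (by positivity) (by positivity)
      (lintegral_prod_add_le (A := fun x => (C₁ x - O₁ x) ^ 2) (B := fun x => (C₂ x - O₂ x) ^ 2)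
        (by fun_prop) (by fun_prop) (fun _ => sq_nonneg _) (fun _ => sq_nonneg _) hb₁ hCO₁
        hCO₂)).trans (le_of_eq ?_)
    rw [hσ2]
    congr 1
    ring
  · have hsub : {ω : Ω₁ × Ω₂ | κ ≤ |(S₁ ω.1 + S₂ ω.2) / σ ^ 2 - 1|} ⊆
        {ω | κ * (2 * q) ≤ |n * S₁ ω.1 - q| + |n * S₂ ω.2 - q|} := by
      intro ω hω
      simp only [Set.mem_ofPred_eq] at hω ⊢
      have e1 : (S₁ ω.1 + S₂ ω.2) / σ ^ 2 - 1 =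
          (n * S₁ ω.1 - q + (n * S₂ ω.2 - q)) / (2 * q) := by
        rw [hσ2]
        field_simp
        ring
      rw [e1, abs_div, abs_of_pos (by positivity : 0 < 2 * q), le_div_iff₀ (by positivity)] at hω
      exact hω.trans (abs_add_le _ _)
    refine (measureReal_mono hsub).trans ?_
    refine (measureReal_ge_le_of_lintegral_le (by fun_prop) (by positivity) (by positivity)
      (lintegral_prod_add_le (A := fun x => |n * S₁ x - q|) (B := fun x => |n * S₂ x - q|)
        (by fun_prop) (by fun_prop) (fun _ => abs_nonneg _) (fun _ => abs_nonneg _) hb₂ hSq₁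
        hSq₂)).trans (le_of_eq ?_)
    field_simp

end TwoSample

section ConditionalPower

variable {d n : ℕ} {P Q : Measure (Vec d × Vec d)} [IsProbabilityMeasure P]
  [IsProbabilityMeasure Q] {f eX eY : Vec d → ℝ} {mX mY vr ve : ℝ}

/-- The choice `θ = √ρ` balances `θ` against `2 ρ / θ` and gives `3 √ρ`. -/
lemma GaussianRegression.lintegral_abs_crossVar_sub_le_of_trainedSq_le
    (h : GaussianRegression P f eX mX vr ve) (hn : Even n) (hn0 : 0 < n)
    {est : Regression d (n / 2)} (hest : Measurable (Function.uncurry (est f)))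
    (hV : 0 < vr + ve) {ρ : ℝ} (hρ : 0 < ρ) (hρ1 : ρ ≤ 1)
    (hm : trainedSq P (fun t v => est f t v - eX v) ≤ ENNReal.ofReal (ρ * (vr + ve))) :
    ∫⁻ q, ENNReal.ofReal |n * crossVar est f q.1 q.2 - (vr + ve / 2)| ∂(sampleLaw P n n) ≤
      ENNReal.ofReal (2 * ((vr + ve) * (3 * √ρ + 2 * (fourthMoment + 2) / √n))) := by
  have hK := fourthMoment_nonneg
  have hsρ : 0 < √ρ := Real.sqrt_pos.2 hρ
  have hsρ1 : √ρ ≤ 1 := Real.sqrt_le_one.2 hρ1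
  refine (h.lintegral_abs_crossVar_sub_le hn hn0 hest hsρ hsρ1 hV).trans ?_
  calc _ ≤ 2 * (ENNReal.ofReal ((vr + ve) * (√ρ + 2 * (fourthMoment + 2) / √n)) +
      ENNReal.ofReal (2 * (√ρ)⁻¹) * ENNReal.ofReal (ρ * (vr + ve))) := by gcongr
    _ = _ := by
      rw [← ENNReal.ofReal_mul (by positivity), ← ENNReal.ofReal_add (by positivity)
        (by positivity), show (2 : ℝ≥0∞) = ENNReal.ofReal 2 by simp,
        ← ENNReal.ofReal_mul (by norm_num)]
      congr 2
      have := Real.mul_self_sqrt hρ.le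
      have e2 : 2 * (√ρ)⁻¹ * (ρ * (vr + ve)) = 2 * √ρ * (vr + ve) := by
        field_simp
        linear_combination (-1) * this
      rw [e2]
      ring

lemma abs_conditional_power_sub_le (hX : GaussianRegression P f eX mX vr ve)
    (hY : GaussianRegression Q f eY mY vr ve) (hn : Even n) (hn0 : 0 < n)
    {estX estY : Regression d (n / 2)} (hestX : Measurable (Function.uncurry (estX f)))
    (hestY : Measurable (Function.uncurry (estY f))) (hV : 0 < vr + ve) {ρ κ : ℝ} (hρ : 0 < ρ)
    (hρ1 : ρ ≤ 1) (hκ : 0 < κ) (hκ1 : κ ≤ 1)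
    (hmX : trainedSq P (fun t v => estX f t v - eX v) ≤ ENNReal.ofReal (ρ * (vr + ve)))
    (hmY : trainedSq Q (fun t v => estY f t v - eY v) ≤ ENNReal.ofReal (ρ * (vr + ve))) (t : ℝ) :
    |((sampleLaw P n n).prod (sampleLaw Q n n)).real
        {ω | t < (crossMean estX f ω.1.1 ω.1.2 - crossMean estY f ω.2.1 ω.2.2) /
          √(crossVar estX f ω.1.1 ω.1.2 + crossVar estY f ω.2.1 ω.2.2)} -
      Phi (-t + (mX - mY) / √(2 * (vr + ve / 2) / n))| ≤
      κ * (|t| + 1) + 6 * ρ / κ ^ 2 + 4 * (3 * √ρ + 2 * (fourthMoment + 2) / √n) / κ := by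
  have hf := hX.measurable_f
  have hr0 := hX.vr_nonneg
  have he0 := hX.ve_nonneg
  have hK := fourthMoment_nonneg
  have hn' : (0 : ℝ) < n := by positivity
  have hsn : 0 < √(n : ℝ) := Real.sqrt_pos.2 hn'
  -- The consistency error is relative to `vr + ve`, the oracle variance involves `vr + ve / 2`.
  -- They are comparable, so the scale cancels from the final bound.
  have hq : (vr + ve) / 2 ≤ vr + ve / 2 := by linarith
  have hq0 : 0 < vr + ve / 2 := by linarith
  have e1 : ∀ {M : ℝ≥0∞}, M ≤ ENNReal.ofReal (ρ * (vr + ve)) →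
      ENNReal.ofReal (3 / (2 * n)) * M ≤ ENNReal.ofReal (3 / (2 * n) * (ρ * (vr + ve))) := by
    intro M hM
    rw [ENNReal.ofReal_mul (by positivity)]
    gcongr
  have main := abs_two_sample_power_sub_le (measurable_crossMean (m := n) hf hestX)
    (measurable_oracleMean hf hX.measurable_e) (measurable_crossVar hf hestX)
    (measurable_crossMean (m := n) hf hestY) (measurable_oracleMean hf hY.measurable_e)
    (measurable_crossVar hf hestY) hq0 hn' (by positivity) (by positivity) hκ hκ1
    (hX.map_oracleMean hn0) (hY.map_oracleMean hn0)
    ((lintegral_sq_crossMean_sub_oracleMean_le hn hn0 hX.measurable_e hestX (P := P)).trans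
      (e1 hmX))
    ((lintegral_sq_crossMean_sub_oracleMean_le hn hn0 hY.measurable_e hestY (P := Q)).trans
      (e1 hmY))
    (hX.lintegral_abs_crossVar_sub_le_of_trainedSq_le hn hn0 hestX hV hρ hρ1 hmX)
    (hY.lintegral_abs_crossVar_sub_le_of_trainedSq_le hn hn0 hestY hV hρ hρ1 hmY) t
  refine main.trans (add_le_add (add_le_add le_rfl ?_) ?_)
  · calc _ ≤ 2 * (3 / (2 * n) * (ρ * (vr + ve))) / (κ ^ 2 * ((vr + ve) / 2 / n)) := by gcongr
      _ = _ := by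
        field_simp
        ring
  · calc _ ≤ 2 * ((vr + ve) * (3 * √ρ + 2 * (fourthMoment + 2) / √n)) /
          (κ * ((vr + ve) / 2)) := by gcongr
      _ = _ := by
        field_simp
        ring

end ConditionalPower

open scoped Matrix

/-! ### Gaussian pairs -/

section GaussianPair

variable {d : ℕ} {μ₁ μ₂ : Vec d} {S₁₁ S₁₂ S₂₁ S₂₂ : Matrix (Fin d) (Fin d) ℝ}

/-- The two halves of a vector, as a continuous linear map. -/
noncomputable def splitCLM (d : ℕ) : EuclideanSpace ℝ (Fin d ⊕ Fin d) →L[ℝ] Vec d × Vec d :=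
  LinearMap.toContinuousLinearMap
    { toFun := fun z => ((WithLp.toLp 2 (fun i => z (Sum.inl i)) : Vec d),
        (WithLp.toLp 2 (fun i => z (Sum.inr i)) : Vec d))
      map_add' := fun _ _ => rfl
      map_smul' := fun _ _ => rfl }

lemma gaussianPair_eq_map_splitCLM : gaussianPair μ₁ μ₂ S₁₁ S₁₂ S₂₁ S₂₂ =
    (multivariateGaussian (WithLp.toLp 2 (Sum.elim (fun i => μ₁ i) (fun i => μ₂ i)))
      (Matrix.fromBlocks S₁₁ S₁₂ S₂₁ S₂₂)).map (splitCLM d) := rfl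

instance isGaussian_gaussianPair : IsGaussian (gaussianPair μ₁ μ₂ S₁₁ S₁₂ S₂₁ S₂₂) := by
  rw [gaussianPair_eq_map_splitCLM]
  infer_instance

lemma inner_splitCLM (a b : Vec d) (z : EuclideanSpace ℝ (Fin d ⊕ Fin d)) :
    ⟪a, (splitCLM d z).1⟫ + ⟪b, (splitCLM d z).2⟫ =
      ⟪(WithLp.toLp 2 (Sum.elim (fun i => a i) (fun i => b i)) :
        EuclideanSpace ℝ (Fin d ⊕ Fin d)), z⟫ := by
  simp only [PiLp.inner_apply, Fintype.sum_sum_type, Sum.elim_inl, Sum.elim_inr]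
  rfl

lemma integral_inner_gaussianPair (a b : Vec d) :
    ∫ p, (⟪a, p.1⟫ + ⟪b, p.2⟫) ∂(gaussianPair μ₁ μ₂ S₁₁ S₁₂ S₂₁ S₂₂) = ⟪a, μ₁⟫ + ⟪b, μ₂⟫ := by
  rw [gaussianPair_eq_map_splitCLM, integral_map (by fun_prop) (by fun_prop)]
  simp only [inner_splitCLM]
  have := ((innerSL ℝ) (WithLp.toLp 2 (Sum.elim (fun i => a i) (fun i => b i)) :
        EuclideanSpace ℝ (Fin d ⊕ Fin d))).integral_comp_comm (φ := fun x => x)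
        (IsGaussian.integrable_fun_id (μ := multivariateGaussian
          (WithLp.toLp 2 (Sum.elim (fun i => μ₁ i) (fun i => μ₂ i)))
          (Matrix.fromBlocks S₁₁ S₁₂ S₂₁ S₂₂)))
  simp only [innerSL_apply_apply] at this
  rw [this, integral_id_multivariateGaussian, ← inner_splitCLM]
  rfl

lemma covariance_inner_gaussianPair (hS : (Matrix.fromBlocks S₁₁ S₁₂ S₂₁ S₂₂).PosSemidef)
    (a b a' b' : Vec d) :
    cov[fun p => ⟪a, p.1⟫ + ⟪b, p.2⟫, fun p => ⟪a', p.1⟫ + ⟪b', p.2⟫;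
        gaussianPair μ₁ μ₂ S₁₁ S₁₂ S₂₁ S₂₂] =
      a.ofLp ⬝ᵥ (S₁₁ *ᵥ a'.ofLp + S₁₂ *ᵥ b'.ofLp) +
        b.ofLp ⬝ᵥ (S₂₁ *ᵥ a'.ofLp + S₂₂ *ᵥ b'.ofLp) := by
  rw [gaussianPair_eq_map_splitCLM, covariance_map (by fun_prop) (by fun_prop) (by fun_prop)]
  simp only [Function.comp_def, inner_splitCLM]
  rw [← covarianceBilin_apply_eq_cov IsGaussian.memLp_two_id,
    covarianceBilin_multivariateGaussian hS]
  simp only [Matrix.fromBlocks_mulVec]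
  exact sumElim_dotProduct_sumElim _ _ _ _

lemma hasGaussianLaw_inner_gaussianPair (a b : Vec d) :
    HasGaussianLaw (fun p : Vec d × Vec d => ⟪a, p.1⟫ + ⟪b, p.2⟫)
      (gaussianPair μ₁ μ₂ S₁₁ S₁₂ S₂₁ S₂₂) :=
  IsGaussian.hasGaussianLaw_id.map_fun
    ((innerSL ℝ a).comp (ContinuousLinearMap.fst ℝ (Vec d) (Vec d)) +
      (innerSL ℝ b).comp (ContinuousLinearMap.snd ℝ (Vec d) (Vec d)))

lemma map_inner_gaussianPair (hS : (Matrix.fromBlocks S₁₁ S₁₂ S₂₁ S₂₂).PosSemidef)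
    (a b : Vec d) :
    (gaussianPair μ₁ μ₂ S₁₁ S₁₂ S₂₁ S₂₂).map (fun p => ⟪a, p.1⟫ + ⟪b, p.2⟫) =
      gaussianReal (⟪a, μ₁⟫ + ⟪b, μ₂⟫) (a.ofLp ⬝ᵥ (S₁₁ *ᵥ a.ofLp + S₁₂ *ᵥ b.ofLp) +
        b.ofLp ⬝ᵥ (S₂₁ *ᵥ a.ofLp + S₂₂ *ᵥ b.ofLp)).toNNReal := by
  refine map_eq_gaussianReal_of_hasGaussianLaw (hasGaussianLaw_inner_gaussianPair a b)
    (integral_inner_gaussianPair a b) ?_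
  rw [← covariance_inner_gaussianPair (μ₁ := μ₁) (μ₂ := μ₂) hS, covariance_self (by fun_prop)]

/-- The slope of the regression of `⟨a, X⟩` on `V`. -/
noncomputable def regressionSlope (S₂₁ S₂₂ : Matrix (Fin d) (Fin d) ℝ) (a : Vec d) : Vec d :=
  WithLp.toLp 2 (S₂₂⁻¹ *ᵥ (S₂₁ *ᵥ a.ofLp))

/-- The conditional expectation of `⟨a, X⟩` given `V = v`. -/
noncomputable def regressionFun (μ₁ μ₂ : Vec d) (S₂₁ S₂₂ : Matrix (Fin d) (Fin d) ℝ) (a v : Vec d) :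
    ℝ :=
  ⟪regressionSlope S₂₁ S₂₂ a, v⟫ + (⟪a, μ₁⟫ - ⟪regressionSlope S₂₁ S₂₂ a, μ₂⟫)

/-- The variance of `E[⟨a, X⟩ | V]`. -/
noncomputable def fitVar (S₁₂ S₂₁ S₂₂ : Matrix (Fin d) (Fin d) ℝ) (a : Vec d) : ℝ :=
  a.ofLp ⬝ᵥ ((S₁₂ * S₂₂⁻¹ * S₂₁) *ᵥ a.ofLp)

/-- The variance of `⟨a, X⟩ - E[⟨a, X⟩ | V]`. -/
noncomputable def noiseVar (S₁₁ S₁₂ S₂₁ S₂₂ : Matrix (Fin d) (Fin d) ℝ) (a : Vec d) : ℝ :=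
  a.ofLp ⬝ᵥ (S₁₁ *ᵥ a.ofLp) - fitVar S₁₂ S₂₁ S₂₂ a

lemma blocks_transpose (hS : (Matrix.fromBlocks S₁₁ S₁₂ S₂₁ S₂₂).PosSemidef) :
    S₁₁ᵀ = S₁₁ ∧ S₁₂ᵀ = S₂₁ ∧ S₂₁ᵀ = S₁₂ ∧ S₂₂ᵀ = S₂₂ := by
  have h := hS.isHermitian
  rw [Matrix.IsHermitian, Matrix.fromBlocks_conjTranspose, Matrix.fromBlocks_inj] at h
  simp only [Matrix.conjTranspose_eq_transpose_of_trivial] at h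
  exact ⟨h.1, h.2.2.1, h.2.1, h.2.2.2⟩

/-- The normal equations; they make the noise uncorrelated with `V`. -/
lemma mulVec_regressionSlope (h₂₂ : IsUnit S₂₂) (a : Vec d) :
    S₂₂ *ᵥ (regressionSlope S₂₁ S₂₂ a).ofLp = S₂₁ *ᵥ a.ofLp := by
  rw [regressionSlope, Matrix.mulVec_mulVec, Matrix.mul_nonsing_inv _
    ((Matrix.isUnit_iff_isUnit_det _).1 h₂₂), Matrix.one_mulVec]

lemma dotProduct_mulVec_regressionSlope (a : Vec d) :
    a.ofLp ⬝ᵥ (S₁₂ *ᵥ (regressionSlope S₂₁ S₂₂ a).ofLp) = fitVar S₁₂ S₂₁ S₂₂ a := by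
  rw [fitVar, regressionSlope, Matrix.mulVec_mulVec, Matrix.mulVec_mulVec]

lemma regressionSlope_dotProduct (hS : (Matrix.fromBlocks S₁₁ S₁₂ S₂₁ S₂₂).PosSemidef)
    (a : Vec d) :
    (regressionSlope S₂₁ S₂₂ a).ofLp ⬝ᵥ (S₂₁ *ᵥ a.ofLp) = fitVar S₁₂ S₂₁ S₂₂ a := by
  rw [← dotProduct_mulVec_regressionSlope, Matrix.dotProduct_mulVec, dotProduct_comm,
    ← Matrix.mulVec_transpose, (blocks_transpose hS).2.2.1, dotProduct_comm, dotProduct_comm]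

lemma measurable_regressionFun (a : Vec d) : Measurable (regressionFun μ₁ μ₂ S₂₁ S₂₂ a) := by
  unfold regressionFun
  fun_prop

lemma inner_sub_regressionFun (a : Vec d) (p : Vec d × Vec d) :
    ⟪a, p.1⟫ - regressionFun μ₁ μ₂ S₂₁ S₂₂ a p.2 =
      ⟪a, p.1⟫ + ⟪-regressionSlope S₂₁ S₂₂ a, p.2⟫ -
        (⟪a, μ₁⟫ + ⟪-regressionSlope S₂₁ S₂₂ a, μ₂⟫) := by
  rw [regressionFun, inner_neg_left, inner_neg_left]
  ring

/-- Noise and `V` are jointly Gaussian, so vanishing covariances suffice. Independence of the whole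
of `V`, not only of the fitted value, is what identifies the conditional expectation. -/
lemma indepFun_noise_gaussianPair (hS : (Matrix.fromBlocks S₁₁ S₁₂ S₂₁ S₂₂).PosSemidef)
    (h₂₂ : IsUnit S₂₂) (a : Vec d) :
    IndepFun (fun p : Vec d × Vec d => ⟪a, p.1⟫ - regressionFun μ₁ μ₂ S₂₁ S₂₂ a p.2)
      (fun p => p.2) (gaussianPair μ₁ μ₂ S₁₁ S₁₂ S₂₁ S₂₂) := by
  set w := regressionSlope S₂₁ S₂₂ a with hw
  have h1 : HasGaussianLaw (fun p : Vec d × Vec d => (⟪a, p.1⟫ + ⟪-w, p.2⟫, p.2))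
      (gaussianPair μ₁ μ₂ S₁₁ S₁₂ S₂₁ S₂₂) :=
    IsGaussian.hasGaussianLaw_id.map_fun
      (((innerSL ℝ a).comp (ContinuousLinearMap.fst ℝ (Vec d) (Vec d)) +
        (innerSL ℝ (-w)).comp (ContinuousLinearMap.snd ℝ (Vec d) (Vec d))).prod
          (ContinuousLinearMap.snd ℝ (Vec d) (Vec d)))
  have h2 := h1.indepFun_of_covariance_inner fun x y => ?_
  · have h3 := h2.comp (φ := fun r => r - (⟪a, μ₁⟫ + ⟪-w, μ₂⟫)) (ψ := id) (by fun_prop)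
      measurable_id
    convert! h3 using 1
    ext p
    exact inner_sub_regressionFun a p
  · have h4 := covariance_inner_gaussianPair (μ₁ := μ₁) (μ₂ := μ₂) hS (x • a) (x • -w) 0 y
    simp only [inner_smul_left, ← mul_add, inner_zero_left, zero_add] at h4
    simp only [conj_trivial] at h4
    simp only [RCLike.inner_apply (𝕜 := ℝ), conj_trivial]
    have h5 : a.ofLp ⬝ᵥ (S₁₂ *ᵥ y.ofLp) = w.ofLp ⬝ᵥ (S₂₂ *ᵥ y.ofLp) := by
      rw [Matrix.dotProduct_mulVec, Matrix.dotProduct_mulVec, ← Matrix.mulVec_transpose,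
        ← Matrix.mulVec_transpose, (blocks_transpose hS).2.1, (blocks_transpose hS).2.2.2, hw,
        mulVec_regressionSlope h₂₂]
    simp only [mul_comm _ x]
    rw [h4]
    simp [h5]

lemma gaussianRegression_gaussianPair (hS : (Matrix.fromBlocks S₁₁ S₁₂ S₂₁ S₂₂).PosSemidef)
    (h₂₂ : IsUnit S₂₂) (a : Vec d) :
    GaussianRegression (gaussianPair μ₁ μ₂ S₁₁ S₁₂ S₂₁ S₂₂) (fun x => ⟪a, x⟫)
      (regressionFun μ₁ μ₂ S₂₁ S₂₂ a) ⟪a, μ₁⟫ (noiseVar S₁₁ S₁₂ S₂₁ S₂₂ a)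
      (fitVar S₁₂ S₂₁ S₂₂ a) := by
  set w := regressionSlope S₂₁ S₂₂ a with hw
  have hve : (0 : Vec d).ofLp ⬝ᵥ (S₁₁ *ᵥ (0 : Vec d).ofLp + S₁₂ *ᵥ w.ofLp) +
        w.ofLp ⬝ᵥ (S₂₁ *ᵥ (0 : Vec d).ofLp + S₂₂ *ᵥ w.ofLp) = fitVar S₁₂ S₂₁ S₂₂ a := by
    rw [hw, mulVec_regressionSlope h₂₂]
    simp [regressionSlope_dotProduct hS]
  have hvr : a.ofLp ⬝ᵥ (S₁₁ *ᵥ a.ofLp + S₁₂ *ᵥ (-w).ofLp) +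
        (-w).ofLp ⬝ᵥ (S₂₁ *ᵥ a.ofLp + S₂₂ *ᵥ (-w).ofLp) = noiseVar S₁₁ S₁₂ S₂₁ S₂₂ a := by
    have e1 : (-w).ofLp = -w.ofLp := rfl
    rw [e1, Matrix.mulVec_neg, Matrix.mulVec_neg, hw, mulVec_regressionSlope h₂₂, noiseVar,
      add_neg_cancel, dotProduct_zero, add_zero, dotProduct_add, dotProduct_neg,
      dotProduct_mulVec_regressionSlope]
    ring
  refine ⟨by fun_prop, measurable_regressionFun a, ?_, ?_, ?_, ?_, ?_⟩
  -- Nonnegativity is read off from a variance, which avoids Schur complements; the covariance does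
  -- not involve the means, so zero means serve.
  · rw [← hvr, ← covariance_inner_gaussianPair (μ₁ := 0) (μ₂ := 0) hS,
      covariance_self (by fun_prop)]
    exact variance_nonneg _ _
  · rw [← hve, ← covariance_inner_gaussianPair (μ₁ := 0) (μ₂ := 0) hS,
      covariance_self (by fun_prop)]
    exact variance_nonneg _ _
  · have h1 := map_inner_gaussianPair (μ₁ := μ₁) (μ₂ := μ₂) hS a (-w)
    rw [hvr] at h1
    simp only [inner_sub_regressionFun]
    rw [show (fun p : Vec d × Vec d => ⟪a, p.1⟫ + ⟪-w, p.2⟫ - (⟪a, μ₁⟫ + ⟪-w, μ₂⟫)) =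
      (fun r => r - (⟪a, μ₁⟫ + ⟪-w, μ₂⟫)) ∘ (fun p => ⟪a, p.1⟫ + ⟪-w, p.2⟫) from rfl,
      ← Measure.map_map (by fun_prop) (by fun_prop), h1, gaussianReal_map_sub_const, sub_self]
  · have h1 := map_inner_gaussianPair (μ₁ := μ₁) (μ₂ := μ₂) hS 0 w
    rw [hve] at h1
    simp only [inner_zero_left, zero_add] at h1
    simp only [regressionFun]
    rw [show (fun p : Vec d × Vec d => ⟪w, p.2⟫ + (⟪a, μ₁⟫ - ⟪w, μ₂⟫)) =
      (fun r => r + (⟪a, μ₁⟫ - ⟪w, μ₂⟫)) ∘ (fun p => ⟪w, p.2⟫) from rfl,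
      ← Measure.map_map (by fun_prop) (by fun_prop), h1, gaussianReal_map_add_const]
    congr 1
    ring
  · exact (indepFun_noise_gaussianPair hS h₂₂ a).comp measurable_id (measurable_regressionFun a)

/-- The centered noise is independent of `V` and has conditional expectation zero; the fitted value
is a function of `V`. -/
lemma condExp_inner_gaussianPair (hS : (Matrix.fromBlocks S₁₁ S₁₂ S₂₁ S₂₂).PosSemidef)
    (h₂₂ : IsUnit S₂₂) (a : Vec d) :
    (gaussianPair μ₁ μ₂ S₁₁ S₁₂ S₂₁ S₂₂)[fun q : Vec d × Vec d => ⟪a, q.1⟫ |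
        MeasurableSpace.comap (Prod.snd : Vec d × Vec d → Vec d) inferInstance]
      =ᵐ[gaussianPair μ₁ μ₂ S₁₁ S₁₂ S₂₁ S₂₂]
      fun p => regressionFun μ₁ μ₂ S₂₁ S₂₂ a p.2 := by
  set P := gaussianPair μ₁ μ₂ S₁₁ S₁₂ S₂₁ S₂₂
  set r : Vec d × Vec d → ℝ := fun p => ⟪a, p.1⟫ - regressionFun μ₁ μ₂ S₂₁ S₂₂ a p.2
  have hreg := gaussianRegression_gaussianPair (μ₁ := μ₁) (μ₂ := μ₂) hS h₂₂ a
  have hr : Measurable r := by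
    have := measurable_regressionFun (μ₁ := μ₁) (μ₂ := μ₂) (S₂₁ := S₂₁) (S₂₂ := S₂₂) a
    fun_prop
  have hle : MeasurableSpace.comap (Prod.snd : Vec d × Vec d → Vec d) inferInstance ≤
      (inferInstance : MeasurableSpace (Vec d × Vec d)) := measurable_snd.comap_le
  have hsplit : (fun q : Vec d × Vec d => ⟪a, q.1⟫) =
      r + fun p => regressionFun μ₁ μ₂ S₂₁ S₂₂ a p.2 := by
    ext p
    simp [r]
  have hrI : Integrable r P := (hasGaussianLaw_of_map_eq hreg.noise_law).integrable
  have heI : Integrable (fun p : Vec d × Vec d => regressionFun μ₁ μ₂ S₂₁ S₂₂ a p.2) P :=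
    (hasGaussianLaw_of_map_eq hreg.fit_law).integrable
  rw [hsplit]
  refine (condExp_add hrI heI _).trans ?_
  have h1 : P[r | MeasurableSpace.comap (Prod.snd : Vec d × Vec d → Vec d) inferInstance]
      =ᵐ[P] fun _ => 0 := by
    have h2 := condExp_indep_eq (μ := P) (f := r) hr.comap_le hle
      (comap_measurable r).stronglyMeasurable (indepFun_noise_gaussianPair hS h₂₂ a)
    rwa [integral_of_map_eq_gaussianReal hr hreg.noise_law] at h2
  have h3 : P[fun p => regressionFun μ₁ μ₂ S₂₁ S₂₂ a p.2 |
      MeasurableSpace.comap (Prod.snd : Vec d × Vec d → Vec d) inferInstance] =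
      fun p => regressionFun μ₁ μ₂ S₂₁ S₂₂ a p.2 := by
    refine condExp_of_stronglyMeasurable hle ?_ heI
    exact ((measurable_regressionFun a).comp (comap_measurable Prod.snd)).stronglyMeasurable
  filter_upwards [h1] with p hp
  simp [hp, h3]

/-- Turns the consistency hypothesis into a bound on `trainedSq`: the variance in the denominator
splits into noise and fit. -/
lemma relMSE_gaussianPair (hS : (Matrix.fromBlocks S₁₁ S₁₂ S₂₁ S₂₂).PosSemidef)
    (h₂₂ : IsUnit S₂₂) {h : ℕ} (est : Regression d h) (a : Vec d) :
    relMSE (gaussianPair μ₁ μ₂ S₁₁ S₁₂ S₂₁ S₂₂) est (fun x => ⟪a, x⟫) =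
      trainedSq (gaussianPair μ₁ μ₂ S₁₁ S₁₂ S₂₁ S₂₂)
          (fun t v => est (fun x => ⟪a, x⟫) t v - regressionFun μ₁ μ₂ S₂₁ S₂₂ a v) /
        ENNReal.ofReal (noiseVar S₁₁ S₁₂ S₂₁ S₂₂ a + fitVar S₁₂ S₂₁ S₂₂ a) := by
  rw [relMSE, trainedSq]
  congr 1
  · refine lintegral_congr fun t => lintegral_congr_ae ?_
    filter_upwards [condExp_inner_gaussianPair (μ₁ := μ₁) (μ₂ := μ₂) hS h₂₂ a] with p hp
    rw [hp]
    congr 1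
    ring
  · have h1 := covariance_inner_gaussianPair (μ₁ := μ₁) (μ₂ := μ₂) hS a 0 a 0
    rw [covariance_self (by fun_prop)] at h1
    simp only [inner_zero_left, add_zero] at h1
    have h2 := hasGaussianLaw_inner_gaussianPair (μ₁ := μ₁) (μ₂ := μ₂) (S₁₁ := S₁₁) (S₁₂ := S₁₂)
      (S₂₁ := S₂₁) (S₂₂ := S₂₂) a 0
    simp only [inner_zero_left, add_zero] at h2
    rw [← h2.memLp_two.ofReal_variance_eq, h1, noiseVar]
    simp

end GaussianPair

/-! ### Concentration of Gaussian quadratic forms -/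

section QuadraticForm

variable {d : ℕ}

lemma dotProduct_mulVec_symm {A : Matrix (Fin d) (Fin d) ℝ} (hA : Aᵀ = A) (x y : Fin d → ℝ) :
    x ⬝ᵥ (A *ᵥ y) = y ⬝ᵥ (A *ᵥ x) := by
  rw [Matrix.dotProduct_mulVec, ← Matrix.mulVec_transpose, hA, dotProduct_comm]

lemma inner_eq_dotProduct (x y : Vec d) : ⟪x, y⟫ = x.ofLp ⬝ᵥ y.ofLp := by
  rw [EuclideanSpace.inner_eq_star_dotProduct, star_trivial, dotProduct_comm]

lemma norm_sq_eq_dotProduct (x : Vec d) : ‖x‖ ^ 2 = x.ofLp ⬝ᵥ x.ofLp := by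
  rw [← inner_eq_dotProduct, real_inner_self_eq_norm_sq]

open scoped MatrixOrder Matrix.Norms.L2Operator in
lemma exists_sqrt_multivariateGaussian (δ : Vec d) {T : Matrix (Fin d) (Fin d) ℝ}
    (hT : T.PosSemidef) : ∃ R : Matrix (Fin d) (Fin d) ℝ, Rᵀ = R ∧ R * R = T ∧
      multivariateGaussian δ T = (stdGaussian (Vec d)).map
        (fun x => δ + WithLp.toLp 2 (R *ᵥ x.ofLp)) := by
  refine ⟨CFC.sqrt T, ?_, CFC.sqrt_mul_sqrt_self _ hT.nonneg, rfl⟩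
  have h : (CFC.sqrt T).IsHermitian := (CFC.sqrt_nonneg T).isSelfAdjoint
  rwa [Matrix.IsHermitian, Matrix.conjTranspose_eq_transpose_of_trivial] at h

lemma dotProduct_eigenvectorBasis {B : Matrix (Fin d) (Fin d) ℝ} (hB : B.IsHermitian)
    (x : Fin d → ℝ) :
    (∑ i, x i • hB.eigenvectorBasis i : Vec d).ofLp ⬝ᵥ
      (B *ᵥ (∑ i, x i • hB.eigenvectorBasis i : Vec d).ofLp) =
      ∑ i, hB.eigenvalues i * x i ^ 2 := by
  set u := hB.eigenvectorBasis
  have h1 : B *ᵥ (∑ i, x i • u i : Vec d).ofLp =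
      (∑ i, (hB.eigenvalues i * x i) • u i : Vec d).ofLp := by
    simp only [WithLp.ofLp_sum, WithLp.ofLp_smul, Matrix.mulVec_sum, Matrix.mulVec_smul]
    refine Finset.sum_congr rfl fun i _ => ?_
    rw [hB.mulVec_eigenvectorBasis, smul_smul, mul_comm]
  rw [h1, ← inner_eq_dotProduct, u.orthonormal.inner_sum]
  refine Finset.sum_congr rfl fun i _ => ?_
  simp only [conj_trivial]
  ring

lemma eigenvalues_eq_dotProduct {B : Matrix (Fin d) (Fin d) ℝ} (hB : B.IsHermitian) (i : Fin d) :
    hB.eigenvalues i =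
      (hB.eigenvectorBasis i).ofLp ⬝ᵥ (B *ᵥ (hB.eigenvectorBasis i).ofLp) := by
  rw [hB.mulVec_eigenvectorBasis, dotProduct_smul, ← norm_sq_eq_dotProduct]
  simp

variable {A T R : Matrix (Fin d) (Fin d) ℝ}

lemma isHermitian_conj (hA : Aᵀ = A) (hR : Rᵀ = R) : (R * A * R).IsHermitian := by
  rw [Matrix.IsHermitian, Matrix.conjTranspose_eq_transpose_of_trivial, Matrix.transpose_mul,
    Matrix.transpose_mul, hA, hR, Matrix.mul_assoc]

lemma dotProduct_conj_mulVec (hR : Rᵀ = R) (x y : Fin d → ℝ) :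
    x ⬝ᵥ ((R * A * R) *ᵥ y) = (R *ᵥ x) ⬝ᵥ (A *ᵥ (R *ᵥ y)) := by
  rw [← Matrix.mulVec_mulVec, ← Matrix.mulVec_mulVec, Matrix.dotProduct_mulVec x R,
    ← Matrix.mulVec_transpose, hR]

lemma dotProduct_mulVec_self_eq (hR : Rᵀ = R) (hRT : R * R = T) (x : Fin d → ℝ) :
    (R *ᵥ x) ⬝ᵥ (R *ᵥ x) = x ⬝ᵥ (T *ᵥ x) := by
  rw [← hRT, ← Matrix.mulVec_mulVec, Matrix.dotProduct_mulVec x R, ← Matrix.mulVec_transpose, hR]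

/-- Evaluated at a unit eigenvector `x`, the form is at most `CA ‖R x‖² = CA xᵀ T x ≤ CA CT`. -/
lemma eigenvalues_conj_le (hA : Aᵀ = A) (hR : Rᵀ = R) (hRT : R * R = T) {CA CT : ℝ}
    (hCA : 0 ≤ CA) (hAub : ∀ x, x ⬝ᵥ (A *ᵥ x) ≤ CA * (x ⬝ᵥ x))
    (hTub : ∀ x, x ⬝ᵥ (T *ᵥ x) ≤ CT * (x ⬝ᵥ x)) (i : Fin d) :
    (isHermitian_conj hA hR).eigenvalues i ≤ CA * CT := by
  rw [eigenvalues_eq_dotProduct, dotProduct_conj_mulVec hR]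
  refine (hAub _).trans ?_
  rw [dotProduct_mulVec_self_eq hR hRT]
  gcongr
  refine (hTub _).trans ?_
  rw [← norm_sq_eq_dotProduct]
  simp

lemma le_eigenvalues_conj (hA : Aᵀ = A) (hR : Rᵀ = R) (hRT : R * R = T) {cA cT : ℝ}
    (hcA : 0 ≤ cA) (hAlb : ∀ x, cA * (x ⬝ᵥ x) ≤ x ⬝ᵥ (A *ᵥ x))
    (hTlb : ∀ x, cT * (x ⬝ᵥ x) ≤ x ⬝ᵥ (T *ᵥ x)) (i : Fin d) :
    cA * cT ≤ (isHermitian_conj hA hR).eigenvalues i := by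
  rw [eigenvalues_eq_dotProduct, dotProduct_conj_mulVec hR]
  refine le_trans ?_ (hAlb _)
  rw [dotProduct_mulVec_self_eq hR hRT]
  gcongr
  refine le_trans ?_ (hTlb _)
  rw [← norm_sq_eq_dotProduct]
  simp

lemma sum_eigenvalues_conj (hA : Aᵀ = A) (hR : Rᵀ = R) (hRT : R * R = T) :
    ∑ i, (isHermitian_conj hA hR).eigenvalues i = (A * T).trace := by
  have h := (isHermitian_conj hA hR).trace_eq_sum_eigenvalues
  simp only [RCLike.ofReal_real_eq_id, id] at h
  rw [← h, Matrix.mul_assoc, Matrix.trace_mul_comm, Matrix.mul_assoc, hRT]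

lemma le_trace_mul (hT : T.PosSemidef) (hA : Aᵀ = A) {cA cT : ℝ} (hcA : 0 ≤ cA)
    (hAlb : ∀ x, cA * (x ⬝ᵥ x) ≤ x ⬝ᵥ (A *ᵥ x)) (hTlb : ∀ x, cT * (x ⬝ᵥ x) ≤ x ⬝ᵥ (T *ᵥ x)) :
    d * (cA * cT) ≤ (A * T).trace := by
  obtain ⟨R, hR, hRT, -⟩ := exists_sqrt_multivariateGaussian 0 hT
  rw [← sum_eigenvalues_conj hA hR hRT]
  have := Finset.card_nsmul_le_sum Finset.univ (isHermitian_conj hA hR).eigenvalues (cA * cT)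
    fun i _ => le_eigenvalues_conj hA hR hRT hcA hAlb hTlb i
  simpa using this

/-- Follows from the nonnegativity of the form of `A` at `A x - CA x`, without diagonalizing. -/
lemma mulVec_dotProduct_mulVec_le (hA : Aᵀ = A) {CA : ℝ} (hCA : 0 < CA)
    (hApos : ∀ x, 0 ≤ x ⬝ᵥ (A *ᵥ x)) (hAub : ∀ x, x ⬝ᵥ (A *ᵥ x) ≤ CA * (x ⬝ᵥ x))
    (x : Fin d → ℝ) : (A *ᵥ x) ⬝ᵥ (A *ᵥ x) ≤ CA ^ 2 * (x ⬝ᵥ x) := by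
  set w := A *ᵥ x with hw
  have h1 := hApos (w - CA • x)
  have h2 := hAub w
  have h3 := hAub x
  have h4 : (w - CA • x) ⬝ᵥ (A *ᵥ (w - CA • x)) =
      w ⬝ᵥ (A *ᵥ w) - 2 * CA * (w ⬝ᵥ w) + CA ^ 2 * (x ⬝ᵥ (A *ᵥ x)) := by
    rw [Matrix.mulVec_sub, Matrix.mulVec_smul, sub_dotProduct, dotProduct_sub, dotProduct_sub,
      smul_dotProduct, smul_dotProduct, dotProduct_smul, dotProduct_smul,
      dotProduct_mulVec_symm hA x w, ← hw]
    simp only [smul_eq_mul]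
    ring
  rw [h4] at h1
  have h5 : CA ^ 2 * (x ⬝ᵥ (A *ᵥ x)) ≤ CA ^ 2 * (CA * (x ⬝ᵥ x)) := by gcongr
  have h6 : CA * (w ⬝ᵥ w) ≤ CA * (CA ^ 2 * (x ⬝ᵥ x)) := by linarith
  exact le_of_mul_le_mul_left h6 hCA

lemma map_inner_multivariateGaussian {ι : Type*} [Fintype ι] [DecidableEq ι]
    (δ : EuclideanSpace ℝ ι) {S : Matrix ι ι ℝ} (hS : S.PosSemidef) (x : EuclideanSpace ℝ ι) :
    (multivariateGaussian δ S).map (fun a => ⟪x, a⟫) =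
      gaussianReal ⟪x, δ⟫ (x.ofLp ⬝ᵥ (S *ᵥ x.ofLp)).toNNReal := by
  refine map_eq_gaussianReal_of_hasGaussianLaw
    (IsGaussian.hasGaussianLaw_id.map_fun (innerSL ℝ x)) ?_ ?_
  · have := ((innerSL ℝ) x).integral_comp_comm (φ := fun x => x)
        (IsGaussian.integrable_fun_id (μ := multivariateGaussian δ S))
    simp only [innerSL_apply_apply] at this
    rw [this, integral_id_multivariateGaussian]
  · rw [← covarianceBilin_self IsGaussian.memLp_two_id, covarianceBilin_multivariateGaussian hS]

lemma lintegral_inner_sub_sq_multivariateGaussian (δ : Vec d) (hT : T.PosSemidef) (x : Vec d) :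
    ∫⁻ a, ENNReal.ofReal ((⟪x, a⟫ - ⟪x, δ⟫) ^ 2) ∂(multivariateGaussian δ T) =
      ENNReal.ofReal (x.ofLp ⬝ᵥ (T *ᵥ x.ofLp)) := by
  refine lintegral_sub_sq_of_map_eq_gaussianReal (by fun_prop) ?_
    (map_inner_multivariateGaussian δ hT x)
  simpa using hT.dotProduct_mulVec_nonneg x.ofLp

/-- Write `a - δ = R g` with `R` the square root of `T` and `g` standard Gaussian. In an eigenbasis
of `R A R` the quantity becomes `∑ λᵢ (xᵢ² - 1)`, a sum of independent centered terms with `0 ≤ λᵢ ≤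
CA CT` and `∑ λᵢ = tr (A T)`. -/
lemma lintegral_centered_quadratic_sub_trace_sq_le (δ : Vec d) (hT : T.PosSemidef) (hA : Aᵀ = A)
    {CA CT : ℝ} (hCA : 0 ≤ CA) (hApos : ∀ x, 0 ≤ x ⬝ᵥ (A *ᵥ x))
    (hAub : ∀ x, x ⬝ᵥ (A *ᵥ x) ≤ CA * (x ⬝ᵥ x)) (hTub : ∀ x, x ⬝ᵥ (T *ᵥ x) ≤ CT * (x ⬝ᵥ x)) :
    ∫⁻ a, ENNReal.ofReal (((a - δ).ofLp ⬝ᵥ (A *ᵥ (a - δ).ofLp) - (A * T).trace) ^ 2)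
        ∂(multivariateGaussian δ T) ≤
      ENNReal.ofReal (d * (fourthMoment * (CA * CT) ^ 2)) := by
  obtain ⟨R, hR, hRT, hmap⟩ := exists_sqrt_multivariateGaussian δ hT
  have hK := fourthMoment_nonneg
  set hB := isHermitian_conj hA hR
  have hlam0 : ∀ i, 0 ≤ hB.eigenvalues i := fun i => by
    simpa using le_eigenvalues_conj (cA := 0) (cT := 0) hA hR hRT le_rfl (by simpa using hApos)
      (fun x => by simpa using hT.dotProduct_mulVec_nonneg x) i
  have hlam1 : ∀ i, hB.eigenvalues i ≤ CA * CT := eigenvalues_conj_le hA hR hRT hCA hAub hTub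
  have hmeasA : Measurable fun a : Vec d =>
      ENNReal.ofReal (((a - δ).ofLp ⬝ᵥ (A *ᵥ (a - δ).ofLp) - (A * T).trace) ^ 2) := by
    unfold dotProduct Matrix.mulVec dotProduct
    fun_prop
  have hmeasR : Measurable fun x : Vec d => δ + WithLp.toLp 2 (R *ᵥ x.ofLp) := by
    unfold Matrix.mulVec dotProduct
    fun_prop
  have hmeasB : Measurable fun x : Fin d → ℝ => ∑ i, x i • hB.eigenvectorBasis i := by fun_prop
  have hmeasAR : Measurable fun x : Vec d => ENNReal.ofReal
      (((δ + WithLp.toLp 2 (R *ᵥ x.ofLp) - δ).ofLp ⬝ᵥ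
        (A *ᵥ (δ + WithLp.toLp 2 (R *ᵥ x.ofLp) - δ).ofLp) - (A * T).trace) ^ 2) :=
    hmeasA.comp hmeasR
  rw [hmap, lintegral_map hmeasA hmeasR,
    stdGaussian_eq_map_pi_orthonormalBasis hB.eigenvectorBasis, lintegral_map hmeasAR hmeasB]
  have hpt : ∀ x : Fin d → ℝ, ((δ + WithLp.toLp 2 (R *ᵥ (∑ i, x i • hB.eigenvectorBasis i :
      Vec d).ofLp) - δ).ofLp ⬝ᵥ (A *ᵥ (δ + WithLp.toLp 2 (R *ᵥ (∑ i, x i • hB.eigenvectorBasis i :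
      Vec d).ofLp) - δ).ofLp) - (A * T).trace) =
      ∑ i, (hB.eigenvalues i * x i ^ 2 - hB.eigenvalues i) := by
    intro x
    rw [add_sub_cancel_left, ← dotProduct_conj_mulVec hR, dotProduct_eigenvectorBasis hB,
      Finset.sum_sub_distrib, sum_eigenvalues_conj hA hR hRT]
  simp only [hpt]
  have hid : (gaussianReal 0 1).map (fun x : ℝ => x) = gaussianReal 0 (1 : ℝ).toNNReal := by
    rw [Measure.map_id', Real.toNNReal_one]
  have h2 : ∀ c : ℝ, ∫ x, c * x ^ 2 ∂(gaussianReal 0 1) = c := by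
    intro c
    rw [integral_const_mul]
    have h3 := lintegral_sub_sq_of_map_eq_gaussianReal (μ := gaussianReal 0 1) (g := fun x => x)
      (by fun_prop) zero_le_one hid
    simp only [sub_zero] at h3
    rw [integral_eq_lintegral_of_nonneg_ae (ae_of_all _ fun _ => sq_nonneg _) (by fun_prop), h3]
    simp
  have h4 : ∀ c : ℝ, ∫⁻ x, ENNReal.ofReal ((c * x ^ 2) ^ 2) ∂(gaussianReal 0 1) =
      ENNReal.ofReal (fourthMoment * c ^ 2) := by
    intro c
    have h3 := lintegral_sub_pow_four_of_map_eq_gaussianReal (μ := gaussianReal 0 1)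
      (g := fun x => x) (by fun_prop) zero_le_one hid
    simp only [sub_zero, one_pow, mul_one] at h3
    simp only [mul_pow, ENNReal.ofReal_mul (sq_nonneg c)]
    rw [lintegral_const_mul' _ _ ENNReal.ofReal_ne_top, h3, mul_comm, ENNReal.ofReal_mul hK]
  have h5 := lintegral_sq_sum_sub_integral_le (μ := gaussianReal 0 1)
    (g := fun i x => hB.eigenvalues i * x ^ 2) (fun i => by fun_prop)
  simp only [h2, h4] at h5
  refine h5.trans ?_
  rw [← ENNReal.ofReal_sum_of_nonneg fun i _ => by positivity]
  refine ENNReal.ofReal_le_ofReal ?_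
  calc ∑ i, fourthMoment * hB.eigenvalues i ^ 2 ≤ ∑ _i : Fin d, fourthMoment * (CA * CT) ^ 2 := by
        refine Finset.sum_le_sum fun i _ => ?_
        have := hlam0 i
        have := hlam1 i
        gcongr
    _ = _ := by simp

/-- Expanding about `δ` adds the linear term `2 ⟪A δ, a - δ⟫` and the constant `δᵀ A δ`. The
constants 3, 12, 3 come from `(x + 2 y + v)² ≤ 3 (x² + 4 y² + v²)`. -/
lemma lintegral_quadratic_sub_trace_sq_le (δ : Vec d) (hT : T.PosSemidef) (hA : Aᵀ = A)
    {CA CT : ℝ} (hCA : 0 < CA) (hCT : 0 ≤ CT) (hApos : ∀ x, 0 ≤ x ⬝ᵥ (A *ᵥ x))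
    (hAub : ∀ x, x ⬝ᵥ (A *ᵥ x) ≤ CA * (x ⬝ᵥ x)) (hTub : ∀ x, x ⬝ᵥ (T *ᵥ x) ≤ CT * (x ⬝ᵥ x)) :
    ∫⁻ a, ENNReal.ofReal ((a.ofLp ⬝ᵥ (A *ᵥ a.ofLp) - (A * T).trace) ^ 2)
        ∂(multivariateGaussian δ T) ≤
      ENNReal.ofReal (3 * (d * (fourthMoment * (CA * CT) ^ 2)) +
        12 * (CT * (CA ^ 2 * ‖δ‖ ^ 2)) + 3 * (CA * ‖δ‖ ^ 2) ^ 2) := by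
  have hK := fourthMoment_nonneg
  set w : Vec d := WithLp.toLp 2 (A *ᵥ δ.ofLp) with hw
  have hpt : ∀ a : Vec d, (a.ofLp ⬝ᵥ (A *ᵥ a.ofLp) - (A * T).trace) ^ 2 ≤
      3 * ((a - δ).ofLp ⬝ᵥ (A *ᵥ (a - δ).ofLp) - (A * T).trace) ^ 2 +
        12 * (⟪w, a⟫ - ⟪w, δ⟫) ^ 2 + 3 * (CA * ‖δ‖ ^ 2) ^ 2 := by
    intro a
    have h1 : a.ofLp ⬝ᵥ (A *ᵥ a.ofLp) = (a - δ).ofLp ⬝ᵥ (A *ᵥ (a - δ).ofLp) +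
        2 * (⟪w, a⟫ - ⟪w, δ⟫) + δ.ofLp ⬝ᵥ (A *ᵥ δ.ofLp) := by
      rw [inner_eq_dotProduct, inner_eq_dotProduct, hw, WithLp.ofLp_sub, Matrix.mulVec_sub,
        sub_dotProduct, dotProduct_sub, dotProduct_sub, dotProduct_mulVec_symm hA δ.ofLp a.ofLp,
        dotProduct_comm (A *ᵥ δ.ofLp), dotProduct_comm (A *ᵥ δ.ofLp)]
      ring
    have h2 : (δ.ofLp ⬝ᵥ (A *ᵥ δ.ofLp)) ^ 2 ≤ (CA * ‖δ‖ ^ 2) ^ 2 := by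
      have := hAub δ.ofLp
      rw [← norm_sq_eq_dotProduct] at this
      exact pow_le_pow_left₀ (hApos _) this 2
    rw [h1]
    set x := (a - δ).ofLp ⬝ᵥ (A *ᵥ (a - δ).ofLp) - (A * T).trace with hx
    set y := ⟪w, a⟫ - ⟪w, δ⟫
    set v := δ.ofLp ⬝ᵥ (A *ᵥ δ.ofLp)
    rw [show (a - δ).ofLp ⬝ᵥ (A *ᵥ (a - δ).ofLp) + 2 * y + v - (A * T).trace = x + 2 * y + v by
      rw [hx]; ring]
    nlinarith [sq_nonneg (x - 2 * y), sq_nonneg (x - v), sq_nonneg (2 * y - v)]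
  have hwT : w.ofLp ⬝ᵥ (T *ᵥ w.ofLp) ≤ CT * (CA ^ 2 * ‖δ‖ ^ 2) := by
    refine (hTub _).trans ?_
    gcongr
    rw [norm_sq_eq_dotProduct]
    exact mulVec_dotProduct_mulVec_le hA hCA hApos hAub _
  have hm : Measurable fun a : Vec d => ENNReal.ofReal
      (((a - δ).ofLp ⬝ᵥ (A *ᵥ (a - δ).ofLp) - (A * T).trace) ^ 2) := by
    unfold dotProduct Matrix.mulVec dotProduct
    fun_prop
  calc _ ≤ ∫⁻ a, (3 * ENNReal.ofReal
          (((a - δ).ofLp ⬝ᵥ (A *ᵥ (a - δ).ofLp) - (A * T).trace) ^ 2) +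
        12 * ENNReal.ofReal ((⟪w, a⟫ - ⟪w, δ⟫) ^ 2) + ENNReal.ofReal (3 * (CA * ‖δ‖ ^ 2) ^ 2))
          ∂(multivariateGaussian δ T) := by
        refine lintegral_mono fun a => (ENNReal.ofReal_le_ofReal (hpt a)).trans (le_of_eq ?_)
        rw [ENNReal.ofReal_add (by positivity) (by positivity),
          ENNReal.ofReal_add (by positivity) (by positivity),
          ENNReal.ofReal_mul (p := 3) (by norm_num), ENNReal.ofReal_mul (p := 12) (by norm_num)]
        norm_num
    _ ≤ 3 * ENNReal.ofReal (d * (fourthMoment * (CA * CT) ^ 2)) +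
        12 * ENNReal.ofReal (CT * (CA ^ 2 * ‖δ‖ ^ 2)) +
        ENNReal.ofReal (3 * (CA * ‖δ‖ ^ 2) ^ 2) := by
        rw [lintegral_add_right _ (by fun_prop), lintegral_add_left (by fun_prop),
          lintegral_const_mul' _ _ (by norm_num), lintegral_const_mul' _ _ (by norm_num),
          lintegral_const, measure_univ, mul_one,
          lintegral_inner_sub_sq_multivariateGaussian δ hT w]
        gcongr
        exact lintegral_centered_quadratic_sub_trace_sq_le δ hT hA hCA.le hApos hAub hTub
    _ = _ := by
        rw [ENNReal.ofReal_add (by positivity) (by positivity),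
          ENNReal.ofReal_add (by positivity) (by positivity),
          ENNReal.ofReal_mul (p := 3) (by norm_num), ENNReal.ofReal_mul (p := 12) (by norm_num)]
        norm_num

end QuadraticForm

/-! ### The law of the witness function -/

section Witness

variable {d n : ℕ}

/-- The vector which represents the witness function of the linear kernel. -/
noncomputable def witnessVec (g : (Fin n → Vec d) × (Fin n → Vec d)) : Vec d :=
  (n : ℝ)⁻¹ • (∑ i, g.1 i - ∑ i, g.2 i)

lemma witness_linearKernel (g : (Fin n → Vec d) × (Fin n → Vec d)) :
    witness linearKernel g.1 g.2 = fun x => ⟪witnessVec g, x⟫ := by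
  ext x
  simp only [witness, linearKernel, witnessVec, real_inner_smul_left, inner_sub_left, sum_inner]
  ring

@[fun_prop]
lemma measurable_witnessVec :
    Measurable (witnessVec : (Fin n → Vec d) × (Fin n → Vec d) → Vec d) := by
  unfold witnessVec
  fun_prop

variable {μX μV μY μW : Vec d} {S₁₁ S₁₂ S₂₁ S₂₂ : Matrix (Fin d) (Fin d) ℝ}

instance isProbabilityMeasure_gaussianPair :
    IsProbabilityMeasure (gaussianPair μX μV S₁₁ S₁₂ S₂₁ S₂₂) :=
  isGaussian_gaussianPair.toIsProbabilityMeasure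

lemma map_inner_fst_gaussianPair (hS : (Matrix.fromBlocks S₁₁ S₁₂ S₂₁ S₂₂).PosSemidef)
    (x : Vec d) :
    (gaussianPair μX μV S₁₁ S₁₂ S₂₁ S₂₂).fst.map (fun y => ⟪x, y⟫) =
      gaussianReal ⟪x, μX⟫ (x.ofLp ⬝ᵥ (S₁₁ *ᵥ x.ofLp)).toNNReal := by
  have h := map_inner_gaussianPair (μ₁ := μX) (μ₂ := μV) hS x 0
  simp only [inner_zero_left, add_zero, WithLp.ofLp_zero, Matrix.mulVec_zero, zero_dotProduct] at h
  rw [← h, Measure.fst, Measure.map_map (by fun_prop) measurable_fst]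
  rfl

/-- Both laws have the same one-dimensional projections, which determine the characteristic
function. Each group contributes `S₁₁ / n` to the covariance. -/
lemma map_witnessVec (hS : (Matrix.fromBlocks S₁₁ S₁₂ S₂₁ S₂₂).PosSemidef) (hS₁₁ : S₁₁.PosSemidef)
    (hn : 0 < n) :
    ((Measure.pi fun _ : Fin n => (gaussianPair μX μV S₁₁ S₁₂ S₂₁ S₂₂).fst).prod
        (Measure.pi fun _ : Fin n => (gaussianPair μY μW S₁₁ S₁₂ S₂₁ S₂₂).fst)).map witnessVec =
      multivariateGaussian (μX - μY) ((2 / n : ℝ) • S₁₁) := by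
  have hn' : (0 : ℝ) < n := by positivity
  have hT : ((2 / n : ℝ) • S₁₁).PosSemidef := hS₁₁.smul (by positivity)
  have hprob := Measure.isProbabilityMeasure_map (μ := (Measure.pi fun _ : Fin n =>
    (gaussianPair μX μV S₁₁ S₁₂ S₂₁ S₂₂).fst).prod
        (Measure.pi fun _ : Fin n => (gaussianPair μY μW S₁₁ S₁₂ S₂₁ S₂₂).fst))
        (f := witnessVec) measurable_witnessVec.aemeasurable
  refine Measure.ext_of_charFunDual ?_
  ext L
  obtain ⟨x, rfl⟩ := (InnerProductSpace.toDual ℝ (Vec d)).surjective L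
  rw [charFunDual_eq_charFun_map_one, charFunDual_eq_charFun_map_one]
  congr 1
  have e1 : (multivariateGaussian (μX - μY) ((2 / n : ℝ) • S₁₁)).map
      (InnerProductSpace.toDual ℝ (Vec d) x) = _ := map_inner_multivariateGaussian (μX - μY) hT x
  rw [e1, Measure.map_map (by fun_prop) measurable_witnessVec]
  have hv : 0 ≤ x.ofLp ⬝ᵥ (S₁₁ *ᵥ x.ofLp) := by simpa using hS₁₁.dotProduct_mulVec_nonneg x.ofLp
  have hX := map_sum_pi_of_map_eq_gaussianReal (ι := Fin n) (by fun_prop) hv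
    (map_inner_fst_gaussianPair (μX := μX) (μV := μV) hS x)
  have hY := map_sum_pi_of_map_eq_gaussianReal (ι := Fin n) (by fun_prop) hv
    (map_inner_fst_gaussianPair (μX := μY) (μV := μW) hS x)
  have hX' := map_const_mul_of_map_eq_gaussianReal (by fun_prop) hX (n : ℝ)⁻¹
  have hY' := map_const_mul_of_map_eq_gaussianReal (by fun_prop) hY (-(n : ℝ)⁻¹)
  have h := map_prod_add_of_map_eq_gaussianReal (by fun_prop) (by fun_prop) (by positivity)
    (by positivity) hX' hY'
  have e2 : (InnerProductSpace.toDual ℝ (Vec d) x) ∘ witnessVec =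
      fun p : (Fin n → Vec d) × (Fin n → Vec d) =>
        (n : ℝ)⁻¹ * ∑ i, ⟪x, p.1 i⟫ + -(n : ℝ)⁻¹ * ∑ i, ⟪x, p.2 i⟫ := by
    ext p
    simp only [Function.comp_apply, InnerProductSpace.toDual_apply_apply, witnessVec,
      real_inner_smul_right, inner_sub_right, inner_sum]
    ring
  rw [e2, h, Fintype.card_fin]
  congr 1
  · rw [inner_sub_right]
    field_simp
    ring
  · congr 1
    rw [Matrix.smul_mulVec, dotProduct_smul, smul_eq_mul]
    field_simp
    ring

end Witness

/-! ### Spectral bounds -/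

section Spectrum

variable {d : ℕ} {S₁₁ S₁₂ S₂₁ S₂₂ : Matrix (Fin d) (Fin d) ℝ} {c C : ℝ}

lemma le_dotProduct_mulVec_of_spectrum_subset {S : Matrix (Fin d) (Fin d) ℝ} (hS : S.IsHermitian)
    (h : spectrum ℝ S ⊆ Set.Icc c C) (x : Fin d → ℝ) :
    c * (x ⬝ᵥ x) ≤ x ⬝ᵥ (S *ᵥ x) := by
  have h1 : (S - algebraMap ℝ _ c).PosSemidef := by
    refine Matrix.posSemidef_iff_isHermitian_and_spectrum_nonneg.2 ⟨hS.sub ?_, ?_⟩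
    · rw [Algebra.algebraMap_eq_smul_one, Matrix.IsHermitian, Matrix.conjTranspose_smul]
      simp
    · rw [← spectrum.sub_singleton_eq]
      rintro _ ⟨y, hy, z, rfl, rfl⟩
      exact sub_nonneg.2 (h hy).1
  have h2 := h1.dotProduct_mulVec_nonneg x
  rw [Algebra.algebraMap_eq_smul_one, Matrix.sub_mulVec, Matrix.smul_mulVec, Matrix.one_mulVec,
    dotProduct_sub, dotProduct_smul, star_trivial, smul_eq_mul] at h2
  linarith

lemma dotProduct_mulVec_le_of_spectrum_subset {S : Matrix (Fin d) (Fin d) ℝ} (hS : S.IsHermitian)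
    (h : spectrum ℝ S ⊆ Set.Icc c C) (x : Fin d → ℝ) :
    x ⬝ᵥ (S *ᵥ x) ≤ C * (x ⬝ᵥ x) := by
  have h1 : spectrum ℝ (-S) ⊆ Set.Icc (-C) (-c) := by
    rw [← spectrum.neg_eq]
    intro y hy
    have := h (Set.mem_neg.1 hy)
    exact ⟨by linarith [this.2], by linarith [this.1]⟩
  have h2 := le_dotProduct_mulVec_of_spectrum_subset hS.neg h1 x
  rw [Matrix.neg_mulVec, dotProduct_neg] at h2
  linarith

lemma posSemidef_fst_block (hS : (Matrix.fromBlocks S₁₁ S₁₂ S₂₁ S₂₂).PosSemidef) :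
    S₁₁.PosSemidef :=
  hS.submatrix Sum.inl

lemma isHermitian_fst_block (hS : (Matrix.fromBlocks S₁₁ S₁₂ S₂₁ S₂₂).PosSemidef) :
    S₁₁.IsHermitian :=
  (posSemidef_fst_block hS).isHermitian

lemma isUnit_of_spectrum_subset (hc : 0 < c) (h : spectrum ℝ S₂₂ ⊆ Set.Icc c C) : IsUnit S₂₂ :=
  spectrum.isUnit_of_zero_notMem ℝ fun h0 => hc.not_ge (h h0).1

/-- The matrix of the quadratic form which gives the asymptotic variance of the statistic. -/
noncomputable def oracleCov (S₁₁ S₁₂ S₂₁ S₂₂ : Matrix (Fin d) (Fin d) ℝ) :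
    Matrix (Fin d) (Fin d) ℝ :=
  S₁₁ - (2⁻¹ : ℝ) • (S₁₂ * S₂₂⁻¹ * S₂₁)

lemma oracleCov_transpose (hS : (Matrix.fromBlocks S₁₁ S₁₂ S₂₁ S₂₂).PosSemidef) :
    (oracleCov S₁₁ S₁₂ S₂₁ S₂₂)ᵀ = oracleCov S₁₁ S₁₂ S₂₁ S₂₂ := by
  obtain ⟨h1, h2, h3, h4⟩ := blocks_transpose hS
  rw [oracleCov, Matrix.transpose_sub, Matrix.transpose_smul, Matrix.transpose_mul,
    Matrix.transpose_mul, Matrix.transpose_nonsing_inv, h1, h2, h3, h4, Matrix.mul_assoc]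

lemma noiseVar_add_half_fitVar (a : Vec d) :
    noiseVar S₁₁ S₁₂ S₂₁ S₂₂ a + fitVar S₁₂ S₂₁ S₂₂ a / 2 =
      a.ofLp ⬝ᵥ (oracleCov S₁₁ S₁₂ S₂₁ S₂₂ *ᵥ a.ofLp) := by
  rw [noiseVar, oracleCov, Matrix.sub_mulVec, dotProduct_sub, Matrix.smul_mulVec, dotProduct_smul,
    fitVar, smul_eq_mul]
  ring

lemma four_mul_trace_oracleCov_mul :
    4 * (S₁₁ ^ 2).trace - 2 * (S₁₂ * S₂₂⁻¹ * S₂₁ * S₁₁).trace =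
      4 * (oracleCov S₁₁ S₁₂ S₂₁ S₂₂ * S₁₁).trace := by
  rw [oracleCov, Matrix.sub_mul, Matrix.smul_mul, Matrix.trace_sub, Matrix.trace_smul, sq,
    smul_eq_mul]
  ring

/-- The noise variance is nonnegative, so `S₁₂ S₂₂⁻¹ S₂₁ ≤ S₁₁` as forms. Eigenvalue bounds on `S₁₁`
thus carry over to `oracleCov`. -/
lemma half_dotProduct_le_oracleCov (hS : (Matrix.fromBlocks S₁₁ S₁₂ S₂₁ S₂₂).PosSemidef)
    (h₂₂ : IsUnit S₂₂) (x : Fin d → ℝ) :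
    x ⬝ᵥ (S₁₁ *ᵥ x) / 2 ≤ x ⬝ᵥ (oracleCov S₁₁ S₁₂ S₂₁ S₂₂ *ᵥ x) := by
  have h := gaussianRegression_gaussianPair (μ₁ := 0) (μ₂ := 0) hS h₂₂ (WithLp.toLp 2 x)
  have h1 := h.vr_nonneg
  have h3 := noiseVar_add_half_fitVar (S₁₁ := S₁₁) (S₁₂ := S₁₂) (S₂₁ := S₂₁) (S₂₂ := S₂₂)
    (WithLp.toLp 2 x)
  rw [noiseVar] at h1 h3
  simp only at h1 h3
  linarith

lemma oracleCov_le_dotProduct (hS : (Matrix.fromBlocks S₁₁ S₁₂ S₂₁ S₂₂).PosSemidef)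
    (h₂₂ : IsUnit S₂₂) (x : Fin d → ℝ) :
    x ⬝ᵥ (oracleCov S₁₁ S₁₂ S₂₁ S₂₂ *ᵥ x) ≤ x ⬝ᵥ (S₁₁ *ᵥ x) := by
  have h := gaussianRegression_gaussianPair (μ₁ := 0) (μ₂ := 0) hS h₂₂ (WithLp.toLp 2 x)
  have h1 := h.ve_nonneg
  have h3 := noiseVar_add_half_fitVar (S₁₁ := S₁₁) (S₁₂ := S₁₂) (S₂₁ := S₂₁) (S₂₂ := S₂₂)
    (WithLp.toLp 2 x)
  rw [noiseVar] at h3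
  simp only at h3
  linarith

end Spectrum

/-! ### Conditioning on the witness function -/

section Conditioning

variable {α β α' β' : Type*} {mα : MeasurableSpace α} {mβ : MeasurableSpace β}
  {mα' : MeasurableSpace α'} {mβ' : MeasurableSpace β'}

/-- The first components and the second components of a pair of pairs. -/
def prodProdProdComm (α β α' β' : Type*) [MeasurableSpace α] [MeasurableSpace β]
    [MeasurableSpace α'] [MeasurableSpace β'] : (α × β) × (α' × β') ≃ᵐ (α × α') × (β × β') where
  toEquiv := Equiv.prodProdProdComm α β α' β'
  measurable_toFun := by
    change Measurable fun D : (α × β) × (α' × β') => ((D.1.1, D.2.1), (D.1.2, D.2.2))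
    fun_prop
  measurable_invFun := by
    change Measurable fun D : (α × α') × (β × β') => ((D.1.1, D.2.1), (D.1.2, D.2.2))
    fun_prop

lemma measurePreserving_prodProdProdComm (μ : Measure α) (ν : Measure β) (μ' : Measure α')
    (ν' : Measure β') [SFinite μ] [SFinite ν] [SFinite μ'] [SFinite ν'] :
    MeasurePreserving (prodProdProdComm α β α' β') ((μ.prod ν).prod (μ'.prod ν'))
      ((μ.prod μ').prod (ν.prod ν')) := by
  have h1 := measurePreserving_prodAssoc μ ν (μ'.prod ν')
  have h2 := (MeasurePreserving.id μ).prod ((measurePreserving_prodAssoc ν μ' ν').symm)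
  have h3 := (MeasurePreserving.id μ).prod
    ((Measure.measurePreserving_swap (μ := ν) (ν := μ')).prod (MeasurePreserving.id ν'))
  have h4 := (MeasurePreserving.id μ).prod (measurePreserving_prodAssoc μ' ν ν')
  have h5 := (measurePreserving_prodAssoc μ μ' (ν.prod ν')).symm
  exact h5.comp (h4.comp (h3.comp (h2.comp h1)))

/-- A probability on a product is close to a constant if the conditional probabilities are, outside
of a small set. -/
lemma abs_measureReal_prod_sub_le (μ : Measure α) (ν : Measure β) [IsProbabilityMeasure μ]
    [IsProbabilityMeasure ν] {S : Set (α × β)} (hS : MeasurableSet S) {p b : ℝ}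
    (hp : p ∈ Set.Icc (0 : ℝ) 1) (hb : 0 ≤ b) {B : Set α}
    (h : ∀ a ∉ B, |ν.real (Prod.mk a ⁻¹' S) - p| ≤ b) :
    |(μ.prod ν).real S - p| ≤ b + μ.real B := by
  have hm : Measurable fun a => ν.real (Prod.mk a ⁻¹' S) :=
    (measurable_measure_prodMk_left hS).ennreal_toReal
  have hI : Integrable (fun a => ν.real (Prod.mk a ⁻¹' S)) μ := by
    refine Integrable.of_bound hm.aestronglyMeasurable 1 (ae_of_all _ fun a => ?_)
    rw [Real.norm_of_nonneg measureReal_nonneg]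
    exact measureReal_le_one
  have h1 : (μ.prod ν).real S = ∫ a, ν.real (Prod.mk a ⁻¹' S) ∂μ := by
    rw [measureReal_def, Measure.prod_apply hS, integral_eq_lintegral_of_nonneg_ae
      (ae_of_all _ fun _ => measureReal_nonneg) hm.aestronglyMeasurable]
    congr 1
    refine lintegral_congr fun a => ?_
    rw [measureReal_def, ENNReal.ofReal_toReal (measure_ne_top _ _)]
  -- `B` need not be measurable; it is replaced by a measurable hull of the same measure. On the
  -- hull the difference of two numbers in `[0, 1]` is at most 1.
  have hB := measurableSet_toMeasurable μ B
  have h2 : ∫ a, (ν.real (Prod.mk a ⁻¹' S) - p) ∂μ = (μ.prod ν).real S - p := by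
    rw [integral_sub hI (integrable_const _), h1]
    simp
  rw [← h2]
  refine (abs_integral_le_integral_abs).trans ?_
  have h3 : ∫ a, (b + (toMeasurable μ B).indicator (fun _ => (1 : ℝ)) a) ∂μ = b + μ.real B := by
    rw [integral_add (integrable_const _) ((integrable_const _).indicator hB),
      integral_indicator_const _ hB]
    simp [measureReal_def, measure_toMeasurable]
  rw [← h3]
  refine integral_mono (hI.sub (integrable_const _)).abs
    ((integrable_const _).add ((integrable_const _).indicator hB)) fun a => ?_
  by_cases ha : a ∈ toMeasurable μ B
  · have h4 : ν.real (Prod.mk a ⁻¹' S) ≤ 1 := measureReal_le_one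
    have h5 : 0 ≤ ν.real (Prod.mk a ⁻¹' S) := measureReal_nonneg
    simp only [Set.indicator_of_mem ha]
    rw [abs_le]
    constructor <;> linarith [hp.1, hp.2]
  · simp only [Set.indicator_of_notMem ha, add_zero]
    exact h a fun h' => ha (subset_toMeasurable _ _ h')

end Conditioning

/-! ### The power of the test along a fixed experiment -/

/-- Meant for `s = ⟪δ, a⟫`, `b = ‖δ‖²`, `q = aᵀ A a` and `q' = tr (A T)`. The bound on `η` keeps `2
q ≥ q₀`, so both square roots are at least `√q₀`. -/
lemma abs_div_sqrt_sub_le {q q' q₀ s b θ η N : ℝ} (hN : 0 < N) (hq₀ : 0 < q₀) (hq' : q₀ ≤ q')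
    (hη : η ≤ q₀ / 2) (hb : 0 ≤ b) (hq : |q - q'| ≤ η) (hs : |√N * (s - b)| ≤ θ) :
    |s / √(2 * q / N) - √N * b / √(2 * q')| ≤ θ / √q₀ + √N * b * (η / (q₀ * √q₀)) := by
  have hq1 : q₀ ≤ 2 * q := by linarith [(abs_le.1 hq).1]
  set r := √q₀ with hr
  set x := √(2 * q) with hx
  set y := √(2 * q') with hy
  have hr0 : 0 < r := Real.sqrt_pos.2 hq₀
  have hrx : r ≤ x := Real.sqrt_le_sqrt hq1
  have hry : r ≤ y := Real.sqrt_le_sqrt (by linarith)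
  have hr2 : r * r = q₀ := Real.mul_self_sqrt hq₀.le
  have hx2 : x * x = 2 * q := Real.mul_self_sqrt (by linarith)
  have hy2 : y * y = 2 * q' := Real.mul_self_sqrt (by linarith)
  have hx0 : 0 < x := hr0.trans_le hrx
  have hy0 : 0 < y := hr0.trans_le hry
  have hN0 : 0 < √N := Real.sqrt_pos.2 hN
  have h1 : s / √(2 * q / N) - √N * b / y = √N * (s - b) / x + √N * b * ((y - x) / (x * y)) := by
    rw [Real.sqrt_div (by linarith), ← hx]
    field_simp
    ring
  have h2 : |y - x| * (x + y) ≤ 2 * η := by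
    rw [← abs_of_pos (add_pos hx0 hy0), ← abs_mul, show (y - x) * (x + y) = 2 * (q' - q) by
      linear_combination hy2 - hx2, abs_mul, abs_sub_comm q' q, abs_two]
    linarith
  have h3 : |y - x| * r ≤ η := by
    have := mul_le_mul_of_nonneg_left (add_le_add hrx hry) (abs_nonneg (y - x))
    linarith
  rw [h1]
  refine (abs_add_le _ _).trans (add_le_add ?_ ?_)
  · rw [abs_div, abs_of_pos hx0]
    have := (abs_nonneg _).trans hs
    gcongr
  · rw [abs_mul, abs_of_nonneg (by positivity : 0 ≤ √N * b), abs_div,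
      abs_of_pos (mul_pos hx0 hy0)]
    refine mul_le_mul_of_nonneg_left ?_ (by positivity)
    rw [div_le_div_iff₀ (by positivity) (by positivity)]
    have h5 : q₀ ≤ x * y := by
      rw [← hr2]
      gcongr
    calc |y - x| * (q₀ * r) = (|y - x| * r) * q₀ := by ring
      _ ≤ η * (x * y) := by
        have := (abs_nonneg _).trans hq
        gcongr

/-! ### Joint measurability in the witness samples and the regression samples -/

section Measurability

variable {d n₁ n₂ n m : ℕ} {k : Vec d → Vec d → ℝ} {est : Regression d (n / 2)}

lemma measurable_crossFit_witness (hest : MeasurableRegression k n₁ n₂ est) (i : Fin (n + m)) :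
    Measurable fun q : ((Fin n₁ → Vec d) × (Fin n₂ → Vec d)) ×
      ((Fin n → Vec d × Vec d) × (Fin m → Vec d)) =>
        crossFit est (witness k q.1.1 q.1.2) q.2.1 q.2.2 i := by
  have hcov : Measurable fun q : ((Fin n₁ → Vec d) × (Fin n₂ → Vec d)) ×
      ((Fin n → Vec d × Vec d) × (Fin m → Vec d)) => covariates q.2.1 q.2.2 i :=
    (measurable_covariates i).comp measurable_snd
  have hA : Measurable fun q : ((Fin n₁ → Vec d) × (Fin n₂ → Vec d)) ×
      ((Fin n → Vec d × Vec d) × (Fin m → Vec d)) => foldA q.2.1 :=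
    measurable_foldA.comp (measurable_fst.comp measurable_snd)
  have hB : Measurable fun q : ((Fin n₁ → Vec d) × (Fin n₂ → Vec d)) ×
      ((Fin n → Vec d × Vec d) × (Fin m → Vec d)) => foldB q.2.1 :=
    measurable_foldB.comp (measurable_fst.comp measurable_snd)
  unfold crossFit
  split_ifs
  · exact Measurable.comp hest (measurable_fst.prodMk (hB.prodMk hcov))
  · exact Measurable.comp hest (measurable_fst.prodMk (hA.prodMk hcov))

lemma measurable_residual_witness {est : Regression d (n / 2)}
    (hest : MeasurableRegression linearKernel n₁ n₂ est) (i : Fin n) :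
    Measurable fun q : ((Fin n₁ → Vec d) × (Fin n₂ → Vec d)) ×
      ((Fin n → Vec d × Vec d) × (Fin m → Vec d)) =>
        residual est (witness linearKernel q.1.1 q.1.2) q.2.1 q.2.2 i := by
  have h1 := measurable_crossFit_witness (m := m) hest (Fin.castAdd m i)
  unfold residual
  refine Measurable.sub ?_ h1
  unfold witness linearKernel
  fun_prop

lemma measurable_crossMean_witness {est : Regression d (n / 2)}
    (hest : MeasurableRegression linearKernel n₁ n₂ est) :
    Measurable fun q : ((Fin n₁ → Vec d) × (Fin n₂ → Vec d)) ×
      ((Fin n → Vec d × Vec d) × (Fin m → Vec d)) =>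
        crossMean est (witness linearKernel q.1.1 q.1.2) q.2.1 q.2.2 := by
  have h1 := fun i => measurable_crossFit_witness (m := m) hest i
  have h2 := fun i => measurable_residual_witness (m := m) hest i
  unfold crossMean empMean
  fun_prop

lemma measurable_crossVar_witness {est : Regression d (n / 2)}
    (hest : MeasurableRegression linearKernel n₁ n₂ est) :
    Measurable fun q : ((Fin n₁ → Vec d) × (Fin n₂ → Vec d)) ×
      ((Fin n → Vec d × Vec d) × (Fin m → Vec d)) =>
        crossVar est (witness linearKernel q.1.1 q.1.2) q.2.1 q.2.2 := by
  have h1 := fun i => measurable_crossFit_witness (m := m) hest i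
  have h2 := fun i => measurable_residual_witness (m := m) hest i
  unfold crossVar empVar empMean
  fun_prop

end Measurability

/-! ### Separation of the witness samples from the regression samples -/

section Experiment

variable {d n : ℕ} {P Q : Measure (Vec d × Vec d)}

/-- The law of the samples from which the witness function is computed. -/
noncomputable def witnessLaw (P Q : Measure (Vec d × Vec d)) (n : ℕ) :
    Measure ((Fin n → Vec d) × (Fin n → Vec d)) :=
  (Measure.pi fun _ : Fin n => P.fst).prod (Measure.pi fun _ : Fin n => Q.fst)

instance [IsProbabilityMeasure P] [IsProbabilityMeasure Q] :
    IsProbabilityMeasure (witnessLaw P Q n) := by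
  unfold witnessLaw
  infer_instance

/-- The rejection region, as a set of pairs of a witness sample and of regression samples. -/
def rejection (estX estY : Regression d (n / 2)) (t : ℝ) :
    Set (((Fin n → Vec d) × (Fin n → Vec d)) ×
      (((Fin n → Vec d × Vec d) × (Fin n → Vec d)) ×
        ((Fin n → Vec d × Vec d) × (Fin n → Vec d)))) :=
  {q | t < (crossMean estX (witness linearKernel q.1.1 q.1.2) q.2.1.1 q.2.1.2 -
      crossMean estY (witness linearKernel q.1.1 q.1.2) q.2.2.1 q.2.2.2) /
    √(crossVar estX (witness linearKernel q.1.1 q.1.2) q.2.1.1 q.2.1.2 +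
      crossVar estY (witness linearKernel q.1.1 q.1.2) q.2.2.1 q.2.2.2)}

lemma measurableSet_rejection {estX estY : Regression d (n / 2)}
    (hestX : MeasurableRegression linearKernel n n estX)
    (hestY : MeasurableRegression linearKernel n n estY) (t : ℝ) :
    MeasurableSet (rejection estX estY t) := by
  have hX : Measurable fun q : ((Fin n → Vec d) × (Fin n → Vec d)) ×
      (((Fin n → Vec d × Vec d) × (Fin n → Vec d)) ×
        ((Fin n → Vec d × Vec d) × (Fin n → Vec d))) => (q.1, q.2.1) := by fun_prop
  have hY : Measurable fun q : ((Fin n → Vec d) × (Fin n → Vec d)) ×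
      (((Fin n → Vec d × Vec d) × (Fin n → Vec d)) ×
        ((Fin n → Vec d × Vec d) × (Fin n → Vec d))) => (q.1, q.2.2) := by fun_prop
  have h1 := (measurable_crossMean_witness (m := n) hestX).comp hX
  have h2 := (measurable_crossMean_witness (m := n) hestY).comp hY
  have h3 := (measurable_crossVar_witness (m := n) hestX).comp hX
  have h4 := (measurable_crossVar_witness (m := n) hestY).comp hY
  exact measurableSet_lt measurable_const ((h1.sub h2).div (h3.add h4).sqrt)

variable [IsProbabilityMeasure P] [IsProbabilityMeasure Q]

lemma power_eq_rejection (estX estY : Regression d (n / 2)) (α : ℝ) :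
    power linearKernel P Q n n n n estX estY α =
      ((witnessLaw P Q n).prod ((sampleLaw P n n).prod (sampleLaw Q n n))).real
        (rejection estX estY (z (1 - α))) := by
  have h := measurePreserving_prodProdProdComm (Measure.pi fun _ : Fin n => P.fst)
    (sampleLaw P n n) (Measure.pi fun _ : Fin n => Q.fst) (sampleLaw Q n n)
  rw [measureReal_def, witnessLaw, ← h.measure_preimage_equiv]
  rfl

/-- The consistency hypotheses concern the witness samples only. `B` is arbitrary, because the sets
on which `relMSE` is large are not known to be measurable; the rearrangement is an equivalence, so
no measurability is needed. -/
lemma dataLaw_witness (B : Set ((Fin n → Vec d) × (Fin n → Vec d))) :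
    dataLaw P Q n n n n {D | (D.1.1, D.2.1) ∈ B} = witnessLaw P Q n B := by
  have h := measurePreserving_prodProdProdComm (Measure.pi fun _ : Fin n => P.fst)
    (sampleLaw P n n) (Measure.pi fun _ : Fin n => Q.fst) (sampleLaw Q n n)
  have h2 := h.measure_preimage_equiv (B ×ˢ Set.univ)
  rw [Measure.prod_prod, measure_univ, mul_one] at h2
  rw [witnessLaw, ← h2, Set.prod_univ]
  rfl

end Experiment

lemma MeasurableRegression.measurable_uncurry {d h n₁ n₂ : ℕ} {k : Vec d → Vec d → ℝ}
    {est : Regression d h} (hest : MeasurableRegression k n₁ n₂ est)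
    (g : (Fin n₁ → Vec d) × (Fin n₂ → Vec d)) :
    Measurable (Function.uncurry (est (witness k g.1 g.2))) := by
  have hg : Measurable fun p : (Fin h → Vec d × Vec d) × Vec d => (g, p) :=
    measurable_const.prodMk measurable_id
  exact Measurable.comp (g := fun p : ((Fin n₁ → Vec d) × (Fin n₂ → Vec d)) ×
    (Fin h → Vec d × Vec d) × Vec d => est (witness k p.1.1 p.1.2) p.2.1 p.2.2) hest hg

/-! ### Concentration of the witness vector and the bound on the power -/

section GaussianExperiment

variable {d n : ℕ} {μX μV μY μW : Vec d} {S₁₁ S₁₂ S₂₁ S₂₂ : Matrix (Fin d) (Fin d) ℝ} {c C : ℝ}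

lemma trainedSq_le_of_relMSE_lt (hS : (Matrix.fromBlocks S₁₁ S₁₂ S₂₁ S₂₂).PosSemidef)
    (h₂₂ : IsUnit S₂₂) {h : ℕ} {est : Regression d h} {a : Vec d} {ρ : ℝ} (hρ : 0 ≤ ρ)
    (hV : 0 < noiseVar S₁₁ S₁₂ S₂₁ S₂₂ a + fitVar S₁₂ S₂₁ S₂₂ a)
    (hlt : relMSE (gaussianPair μX μV S₁₁ S₁₂ S₂₁ S₂₂) est (fun x => ⟪a, x⟫) <
      ENNReal.ofReal ρ) :
    trainedSq (gaussianPair μX μV S₁₁ S₁₂ S₂₁ S₂₂)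
        (fun t v => est (fun x => ⟪a, x⟫) t v - regressionFun μX μV S₂₁ S₂₂ a v) ≤
      ENNReal.ofReal (ρ * (noiseVar S₁₁ S₁₂ S₂₁ S₂₂ a + fitVar S₁₂ S₂₁ S₂₂ a)) := by
  rw [relMSE_gaussianPair hS h₂₂] at hlt
  have := hlt.le
  rwa [ENNReal.div_le_iff (by simpa using hV) ENNReal.ofReal_ne_top,
    ← ENNReal.ofReal_mul hρ] at this

/-- The means and the quadratic forms of the witness vector which determine the conditional power
concentrate. -/
lemma witnessLaw_quadratic_le (hS : (Matrix.fromBlocks S₁₁ S₁₂ S₂₁ S₂₂).PosSemidef)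
    (hn : 0 < n) (hC : 0 < C) (h₁₁ : spectrum ℝ S₁₁ ⊆ Set.Icc c C)
    (h₂₂ : IsUnit S₂₂) {η : ℝ} (hη : 0 < η) :
    (witnessLaw (gaussianPair μX μV S₁₁ S₁₂ S₂₁ S₂₂) (gaussianPair μY μW S₁₁ S₁₂ S₂₁ S₂₂) n).real
        {g | η ^ 2 ≤ ((witnessVec g).ofLp ⬝ᵥ (oracleCov S₁₁ S₁₂ S₂₁ S₂₂ *ᵥ (witnessVec g).ofLp) -
          (oracleCov S₁₁ S₁₂ S₂₁ S₂₂ * ((2 / n : ℝ) • S₁₁)).trace) ^ 2} ≤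
      (3 * (d * (fourthMoment * (C * (2 / n * C)) ^ 2)) +
        12 * (2 / n * C * (C ^ 2 * ‖μX - μY‖ ^ 2)) + 3 * (C * ‖μX - μY‖ ^ 2) ^ 2) / η ^ 2 := by
  have hK := fourthMoment_nonneg
  have hH := isHermitian_fst_block hS
  have hub := dotProduct_mulVec_le_of_spectrum_subset hH h₁₁
  have hpos : ∀ x : Fin d → ℝ, 0 ≤ x ⬝ᵥ (S₁₁ *ᵥ x) := fun x => by
    simpa using (posSemidef_fst_block hS).dotProduct_mulVec_nonneg x
  have hS₁₁ := posSemidef_fst_block hS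
  have hT : ((2 / n : ℝ) • S₁₁).PosSemidef := hS₁₁.smul (by positivity)
  have hm : Measurable fun a : Vec d => (a.ofLp ⬝ᵥ (oracleCov S₁₁ S₁₂ S₂₁ S₂₂ *ᵥ a.ofLp) -
          (oracleCov S₁₁ S₁₂ S₂₁ S₂₂ * ((2 / n : ℝ) • S₁₁)).trace) ^ 2 := by
    unfold dotProduct Matrix.mulVec dotProduct
    fun_prop
  refine measureReal_ge_le_of_lintegral_le (hm.comp measurable_witnessVec) (by positivity)
    (by positivity) ?_
  have h := lintegral_quadratic_sub_trace_sq_le (μX - μY) hT (oracleCov_transpose hS) hC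
    (CT := 2 / n * C) (by positivity)
    (fun x => (div_nonneg (hpos x) zero_le_two).trans (half_dotProduct_le_oracleCov hS h₂₂ x))
    (fun x => (oracleCov_le_dotProduct hS h₂₂ x).trans (hub x))
    (fun x => by
      rw [Matrix.smul_mulVec, dotProduct_smul, smul_eq_mul, mul_assoc]
      exact mul_le_mul_of_nonneg_left (hub x) (by positivity))
  rw [← map_witnessVec (μV := μV) (μW := μW) hS hS₁₁ hn,
    lintegral_map hm.ennreal_ofReal measurable_witnessVec] at h
  exact h

/-- Chebyshev's inequality: the variance of `⟪δ, a⟫` is `(2 / n) δᵀ S₁₁ δ ≤ 2 C ‖δ‖² / n`. -/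
lemma witnessLaw_inner_le (hS : (Matrix.fromBlocks S₁₁ S₁₂ S₂₁ S₂₂).PosSemidef)
    (hn : 0 < n) (hC : 0 < C) (h₁₁ : spectrum ℝ S₁₁ ⊆ Set.Icc c C)
    {θ : ℝ} (hθ : 0 < θ) :
    (witnessLaw (gaussianPair μX μV S₁₁ S₁₂ S₂₁ S₂₂) (gaussianPair μY μW S₁₁ S₁₂ S₂₁ S₂₂) n).real
        {g | θ ^ 2 / n ≤ (⟪μX - μY, witnessVec g⟫ - ⟪μX - μY, μX - μY⟫) ^ 2} ≤
      2 * C * ‖μX - μY‖ ^ 2 / θ ^ 2 := by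
  have hH := isHermitian_fst_block hS
  have hub := dotProduct_mulVec_le_of_spectrum_subset hH h₁₁
  have hS₁₁ := posSemidef_fst_block hS
  have hT : ((2 / n : ℝ) • S₁₁).PosSemidef := hS₁₁.smul (by positivity)
  have hn' : (0 : ℝ) < n := by positivity
  have hm : Measurable fun a : Vec d => (⟪μX - μY, a⟫ - ⟪μX - μY, μX - μY⟫) ^ 2 := by fun_prop
  have h := lintegral_inner_sub_sq_multivariateGaussian (μX - μY) hT (μX - μY)
  rw [← map_witnessVec (μV := μV) (μW := μW) hS hS₁₁ hn,
    lintegral_map hm.ennreal_ofReal measurable_witnessVec] at h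
  have h2 := measureReal_ge_le_of_lintegral_le (c := θ ^ 2 / n) (hm.comp measurable_witnessVec)
    (b := 2 / n * (C * ‖μX - μY‖ ^ 2)) (by positivity) (by positivity) (h.le.trans
      (ENNReal.ofReal_le_ofReal (by
        rw [Matrix.smul_mulVec, dotProduct_smul, smul_eq_mul, norm_sq_eq_dotProduct]
        exact mul_le_mul_of_nonneg_left (hub _) (by positivity))))
  refine h2.trans (le_of_eq ?_)
  field_simp

/-- The first group of terms bounds the conditional error for a good witness vector, the last
bracket the probability of a bad one. Bad means poor regression in one of the groups (`B₁`, `B₂`),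
an atypical variance (`B₃`) or an atypical drift (`B₄`). -/
lemma abs_power_sub_le (hS : (Matrix.fromBlocks S₁₁ S₁₂ S₂₁ S₂₂).PosSemidef)
    (hn : Even n) (hn0 : 0 < n) (hC : 0 < C) (h₁₁ : spectrum ℝ S₁₁ ⊆ Set.Icc c C)
    (h₂₂ : IsUnit S₂₂) {estX estY : Regression d (n / 2)}
    (hestX : MeasurableRegression linearKernel n n estX)
    (hestY : MeasurableRegression linearKernel n n estY) {α ρ κ θ η q₀ : ℝ} (hα : α ∈ Set.Ioo 0 1)
    (hρ : 0 < ρ) (hρ1 : ρ ≤ 1) (hκ : 0 < κ) (hκ1 : κ ≤ 1) (hθ : 0 < θ) (hη : 0 < η)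
    (hq₀ : 0 < q₀) (hηq : η ≤ q₀ / 2)
    (hq : q₀ ≤ (oracleCov S₁₁ S₁₂ S₂₁ S₂₂ * ((2 / n : ℝ) • S₁₁)).trace)
    (hP : P = gaussianPair μX μV S₁₁ S₁₂ S₂₁ S₂₂) (hQ : Q = gaussianPair μY μW S₁₁ S₁₂ S₂₁ S₂₂) :
    |power linearKernel P Q n n n n estX estY α -
      Phi (z α + √n * ‖μX - μY‖ ^ 2 /
        √(2 * (oracleCov S₁₁ S₁₂ S₂₁ S₂₂ * ((2 / n : ℝ) • S₁₁)).trace))| ≤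
      κ * (|z (1 - α)| + 1) + 6 * ρ / κ ^ 2 + 4 * (3 * √ρ + 2 * (fourthMoment + 2) / √n) / κ +
        (θ / √q₀ + √n * ‖μX - μY‖ ^ 2 * (η / (q₀ * √q₀))) +
      ((dataLaw P Q n n n n
          {D | ENNReal.ofReal ρ ≤ relMSE P estX (dataWitness linearKernel D)}).toReal +
        (dataLaw P Q n n n n
          {D | ENNReal.ofReal ρ ≤ relMSE Q estY (dataWitness linearKernel D)}).toReal +
        (3 * (d * (fourthMoment * (C * (2 / n * C)) ^ 2)) +
          12 * (2 / n * C * (C ^ 2 * ‖μX - μY‖ ^ 2)) + 3 * (C * ‖μX - μY‖ ^ 2) ^ 2) / η ^ 2 +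
        2 * C * ‖μX - μY‖ ^ 2 / θ ^ 2) := by
  subst hP hQ
  have hK := fourthMoment_nonneg
  have hn' : (0 : ℝ) < n := by positivity
  set P := gaussianPair μX μV S₁₁ S₁₂ S₂₁ S₂₂ with hP
  set Q := gaussianPair μY μW S₁₁ S₁₂ S₂₁ S₂₂ with hQ
  set A := oracleCov S₁₁ S₁₂ S₂₁ S₂₂ with hA
  set T := (2 / n : ℝ) • S₁₁
  set δ := μX - μY with hδ
  set B₁ : Set ((Fin n → Vec d) × (Fin n → Vec d)) :=
    {g | ENNReal.ofReal ρ ≤ relMSE P estX (witness linearKernel g.1 g.2)} with hB₁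
  set B₂ : Set ((Fin n → Vec d) × (Fin n → Vec d)) :=
    {g | ENNReal.ofReal ρ ≤ relMSE Q estY (witness linearKernel g.1 g.2)} with hB₂
  set B₃ : Set ((Fin n → Vec d) × (Fin n → Vec d)) :=
    {g | η ^ 2 ≤ ((witnessVec g).ofLp ⬝ᵥ (A *ᵥ (witnessVec g).ofLp) - (A * T).trace) ^ 2} with hB₃
  set B₄ : Set ((Fin n → Vec d) × (Fin n → Vec d)) :=
    {g | θ ^ 2 / n ≤ (⟪δ, witnessVec g⟫ - ⟪δ, δ⟫) ^ 2} with hB₄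
  have hmain := abs_measureReal_prod_sub_le (witnessLaw P Q n)
    ((sampleLaw P n n).prod (sampleLaw Q n n))
    (measurableSet_rejection hestX hestY (z (1 - α)))
    (p := Phi (z α + √n * ‖δ‖ ^ 2 / √(2 * (A * T).trace)))
    (b := κ * (|z (1 - α)| + 1) + 6 * ρ / κ ^ 2 +
      4 * (3 * √ρ + 2 * (fourthMoment + 2) / √n) / κ +
        (θ / √q₀ + √n * ‖δ‖ ^ 2 * (η / (q₀ * √q₀)))) ⟨cdf_nonneg _ _, cdf_le_one _ _⟩
    (by positivity) (B := B₁ ∪ B₂ ∪ B₃ ∪ B₄) ?_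
  · rw [← power_eq_rejection] at hmain
    refine hmain.trans (add_le_add le_rfl ?_)
    refine (measureReal_union_le _ _).trans (add_le_add ((measureReal_union_le _ _).trans
      (add_le_add ((measureReal_union_le _ _).trans (add_le_add ?_ ?_)) ?_)) ?_)
    · rw [measureReal_def, ← dataLaw_witness]
      rfl
    · rw [measureReal_def, ← dataLaw_witness]
      rfl
    · exact witnessLaw_quadratic_le hS hn0 hC h₁₁ h₂₂ hη
    · exact witnessLaw_inner_le hS hn0 hC h₁₁ hθ
  · intro g hg
    simp only [Set.mem_union, not_or, hB₁, hB₂, hB₃, hB₄, Set.mem_ofPred_eq, not_le] at hg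
    obtain ⟨⟨⟨h1, h2⟩, h3⟩, h4⟩ := hg
    set a := witnessVec g with ha
    have hw : witness linearKernel g.1 g.2 = fun x => ⟪a, x⟫ := witness_linearKernel g
    rw [hw] at h1 h2
    have h3' : |a.ofLp ⬝ᵥ (A *ᵥ a.ofLp) - (A * T).trace| ≤ η := (sq_lt_sq₀ (abs_nonneg _) hη.le).1
      (by rwa [sq_abs]) |>.le
    have h4' : |√n * (⟪δ, a⟫ - ‖δ‖ ^ 2)| ≤ θ := by
      rw [← real_inner_self_eq_norm_sq]
      refine ((sq_lt_sq₀ (abs_nonneg _) hθ.le).1 ?_).le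
      rw [sq_abs, mul_pow, Real.sq_sqrt hn'.le, mul_comm]
      exact (lt_div_iff₀ hn').1 h4
    have hX := gaussianRegression_gaussianPair (μ₁ := μX) (μ₂ := μV) hS h₂₂ a
    have hY := gaussianRegression_gaussianPair (μ₁ := μY) (μ₂ := μW) hS h₂₂ a
    have hqa := noiseVar_add_half_fitVar (S₁₁ := S₁₁) (S₁₂ := S₁₂) (S₂₁ := S₂₁) (S₂₂ := S₂₂) a
    -- On the good event `aᵀ A a ≥ q₀ - η ≥ q₀ / 2`, and `vr + ve` is at least `aᵀ A a`.
    have hV : 0 < noiseVar S₁₁ S₁₂ S₂₁ S₂₂ a + fitVar S₁₂ S₂₁ S₂₂ a := by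
      have := hX.ve_nonneg
      have := (abs_le.1 h3').1
      linarith
    have hmeas : ∀ {est : Regression d (n / 2)}, MeasurableRegression linearKernel n n est →
        Measurable (Function.uncurry (est fun x => ⟪a, x⟫)) := by
      intro est hest
      rw [← hw]
      exact hest.measurable_uncurry g
    have hcond := abs_conditional_power_sub_le hX hY hn hn0 (hmeas hestX) (hmeas hestY) hV hρ hρ1
      hκ hκ1 (trainedSq_le_of_relMSE_lt hS h₂₂ hρ.le hV h1)
      (trainedSq_le_of_relMSE_lt hS h₂₂ hρ.le hV h2) (z (1 - α))
    rw [hqa, ← inner_sub_right, real_inner_comm (μX - μY) a, z_one_sub hα, neg_neg] at hcond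
    have hset : Prod.mk g ⁻¹' rejection estX estY (z (1 - α)) =
        {ω | -z α < (crossMean estX (fun x => ⟪a, x⟫) ω.1.1 ω.1.2 -
          crossMean estY (fun x => ⟪a, x⟫) ω.2.1 ω.2.2) /
          √(crossVar estX (fun x => ⟪a, x⟫) ω.1.1 ω.1.2 +
            crossVar estY (fun x => ⟪a, x⟫) ω.2.1 ω.2.2)} := by
      rw [← hw, z_one_sub hα]
      rfl
    rw [hset, z_one_sub hα]
    have hPhi := abs_Phi_sub_le (z α + ⟪δ, a⟫ / √(2 * (a.ofLp ⬝ᵥ (A *ᵥ a.ofLp)) / n))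
      (z α + √n * ‖δ‖ ^ 2 / √(2 * (A * T).trace))
    rw [add_sub_add_left_eq_sub] at hPhi
    exact (abs_sub_le _ _ _).trans (add_le_add hcond (hPhi.trans
      (abs_div_sqrt_sub_le hn' hq₀ hq hηq (sq_nonneg _) h3' h4')))

end GaussianExperiment

/-! ### Orders of magnitude and the choice of the tuning parameters -/

section Asymptotics

/-- The right-hand form has a bounded numerator and a denominator bounded below. -/
lemma mul_div_sqrt_eq_drift {d n : ℕ} {S₁₁ S₁₂ S₂₁ S₂₂ : Matrix (Fin d) (Fin d) ℝ} (hn : 0 < n)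
    (D : ℝ) :
    n * D / √(4 * (S₁₁ ^ 2).trace - 2 * (S₁₂ * S₂₂⁻¹ * S₂₁ * S₁₁).trace) =
      √n * D / √(2 * (oracleCov S₁₁ S₁₂ S₂₁ S₂₂ * ((2 / n : ℝ) • S₁₁)).trace) := by
  have hn' : (0 : ℝ) < n := by positivity
  have hs : 0 < √(n : ℝ) := Real.sqrt_pos.2 hn'
  have hss : √(n : ℝ) * √n = n := Real.mul_self_sqrt hn'.le
  rw [four_mul_trace_oracleCov_mul, Matrix.mul_smul, Matrix.trace_smul, smul_eq_mul]
  set q := (oracleCov S₁₁ S₁₂ S₂₁ S₂₂ * S₁₁).trace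
  rw [show 2 * (2 / n * q) = 4 * q / n by ring, Real.sqrt_div' _ hn'.le, div_div_eq_mul_div]
  congr 1
  linear_combination (-D) * hss

/-- As forms, `oracleCov ≥ c / 2` and `(2 / n) S₁₁ ≥ 2 c / n`; the trace collects `d` eigenvalues.
-/
lemma le_trace_oracleCov_mul {d n : ℕ} {S₁₁ S₁₂ S₂₁ S₂₂ : Matrix (Fin d) (Fin d) ℝ} {c C : ℝ}
    (hS : (Matrix.fromBlocks S₁₁ S₁₂ S₂₁ S₂₂).PosSemidef) (hc : 0 < c)
    (h₁₁ : spectrum ℝ S₁₁ ⊆ Set.Icc c C) (h₂₂ : IsUnit S₂₂) :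
    c ^ 2 * (d / n) ≤ (oracleCov S₁₁ S₁₂ S₂₁ S₂₂ * ((2 / n : ℝ) • S₁₁)).trace := by
  have hlb := le_dotProduct_mulVec_of_spectrum_subset (isHermitian_fst_block hS) h₁₁
  have h := le_trace_mul (cA := c / 2) (cT := 2 / n * c)
    ((posSemidef_fst_block hS).smul (by positivity : (0 : ℝ) ≤ 2 / n)) (oracleCov_transpose hS)
    (by positivity)
    (fun x => le_trans (by linarith [hlb x]) (half_dotProduct_le_oracleCov hS h₂₂ x))
    (fun x => by
      rw [Matrix.smul_mulVec, dotProduct_smul, smul_eq_mul, mul_assoc]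
      exact mul_le_mul_of_nonneg_left (hlb x) (by positivity))
  refine le_trans (le_of_eq ?_) h
  ring

lemma norm_sub_sq_isBigO {ι : Type*} {l : Filter ι} {E : ι → Type*}
    [∀ j, SeminormedAddCommGroup (E j)] {x y : ∀ j, E j} {g : ι → ℝ}
    (hx : (fun j => ‖x j‖ ^ 2) =O[l] g) (hy : (fun j => ‖y j‖ ^ 2) =O[l] g) :
    (fun j => ‖x j - y j‖ ^ 2) =O[l] g := by
  refine Asymptotics.IsBigO.trans (Asymptotics.IsBigO.of_bound 2 (Eventually.of_forall fun j => ?_))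
    (hx.add hy)
  rw [Real.norm_of_nonneg (by positivity), Real.norm_of_nonneg (by positivity)]
  have h := norm_sub_le (x j) (y j)
  nlinarith [sq_nonneg (‖x j‖ - ‖y j‖), norm_nonneg (x j - y j), norm_nonneg (x j),
    norm_nonneg (y j)]

/-- The local alternative is calibrated so that `√n · √d / n = √(d / n)`, which converges. -/
lemma exists_sqrt_mul_le_of_isBigO {n d : ℕ → ℕ} {τ : ℝ}
    (hd : Tendsto (fun j => (d j : ℝ) / (n j : ℝ)) atTop (𝓝 τ)) {D : ℕ → ℝ}
    (hD : D =O[atTop] fun j => √(d j : ℝ) / (n j : ℝ)) :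
    ∃ M : ℝ, 0 ≤ M ∧ ∀ᶠ j in atTop, √(n j) * D j ≤ M := by
  have h1 : (fun j => √(n j : ℝ) * D j) =O[atTop] fun j => √((d j : ℝ) / n j) := by
    refine ((Asymptotics.isBigO_refl (fun j => √(n j : ℝ)) atTop).mul hD).congr_right fun j => ?_
    rw [Real.sqrt_div (by positivity), ← mul_div_assoc, mul_div_right_comm, Real.sqrt_div_self']
    ring
  obtain ⟨M, hM, hb⟩ := (h1.trans (hd.sqrt.isBigO_one ℝ)).exists_nonneg
  refine ⟨M, hM, hb.bound.mono fun j hj => ?_⟩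
  have := le_trans (le_abs_self _) hj
  simpa using this

lemma tendsto_zero_of_sqrt_mul_le {n : ℕ → ℕ} (hn : Tendsto n atTop atTop) {D : ℕ → ℝ}
    (hD : ∀ j, 0 ≤ D j) {M : ℝ} (h : ∀ᶠ j in atTop, √(n j) * D j ≤ M) :
    Tendsto D atTop (𝓝 0) := by
  have hs : Tendsto (fun j => √(n j : ℝ)) atTop atTop :=
    Real.tendsto_sqrt_atTop.comp (tendsto_natCast_atTop_atTop.comp hn)
  refine tendsto_of_tendsto_of_tendsto_of_le_of_le' tendsto_const_nhds
    (hs.const_div_atTop M) (Eventually.of_forall hD) ?_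
  filter_upwards [h, hs.eventually_gt_atTop 0] with j h1 h2
  rw [le_div_iff₀ h2, mul_comm]
  exact h1

lemma tendsto_quadratic_variance {n d : ℕ → ℕ} {τ : ℝ} (hn : Tendsto n atTop atTop)
    (hd : Tendsto (fun j => (d j : ℝ) / (n j : ℝ)) atTop (𝓝 τ)) {D : ℕ → ℝ}
    (hD : Tendsto D atTop (𝓝 0)) (K C : ℝ) :
    Tendsto (fun j => 3 * (d j * (K * (C * (2 / n j * C)) ^ 2)) +
      12 * (2 / n j * C * (C ^ 2 * D j)) + 3 * (C * D j) ^ 2) atTop (𝓝 0) := by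
  have hi : Tendsto (fun j => 2 / (n j : ℝ)) atTop (𝓝 0) :=
    (tendsto_natCast_atTop_atTop.comp hn).const_div_atTop 2
  have h1 : Tendsto (fun j => 6 * K * C ^ 4 * ((d j : ℝ) / n j) * (2 / n j)) atTop
      (𝓝 (6 * K * C ^ 4 * τ * 0)) := (hd.const_mul _).mul hi
  have h2 : Tendsto (fun j => 12 * (2 / n j * C * (C ^ 2 * D j))) atTop
      (𝓝 (12 * (0 * C * (C ^ 2 * 0)))) := ((hi.mul_const C).mul (hD.const_mul _)).const_mul 12
  have h3 : Tendsto (fun j => 3 * (C * D j) ^ 2) atTop (𝓝 (3 * (C * 0) ^ 2)) :=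
    ((hD.const_mul C).pow 2).const_mul 3
  convert (h1.add h2).add h3 using 2
  · ring
  · ring

/-- A sequence tends to zero if it is bounded by quantities which are arbitrarily small for a
suitable choice of the tuning parameters. -/
lemma tendsto_zero_of_forall_le {x : ℕ → ℝ} {q₀ Z M : ℝ} (hq₀ : 0 < q₀) (hZ : 0 ≤ Z) (hM : 0 ≤ M)
    (r : ℝ → ℝ → ℝ → ℝ → ℕ → ℝ)
    (hr : ∀ κ ρ θ η, 0 < κ → 0 < ρ → 0 < θ → 0 < η → Tendsto (r κ ρ θ η) atTop (𝓝 0))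
    (h : ∀ κ ρ θ η, 0 < κ → κ ≤ 1 → 0 < ρ → ρ ≤ 1 → 0 < θ → 0 < η → η ≤ q₀ / 2 →
      ∀ᶠ j in atTop, |x j| ≤ κ * (Z + 1) + (6 * ρ / κ ^ 2 + 12 * √ρ / κ) +
        (θ / √q₀ + M * (η / (q₀ * √q₀))) + r κ ρ θ η j) :
    Tendsto x atTop (𝓝 0) := by
  have hs : 0 < √q₀ := Real.sqrt_pos.2 hq₀
  rw [Metric.tendsto_nhds]
  intro ε hε
  -- The order matters: `κ` is fixed first, then `ρ` small depending on `κ`. Five terms of size at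
  -- most `ε / 8` stay below `ε`.
  set κ := min 1 (ε / 8 / (Z + 1)) with hκ
  have hκ0 : 0 < κ := by positivity
  have hκZ : κ * (Z + 1) ≤ ε / 8 := by
    rw [← le_div_iff₀ (by positivity)]
    exact min_le_right _ _
  have hρt : Tendsto (fun ρ : ℝ => 6 * ρ / κ ^ 2 + 12 * √ρ / κ) (𝓝[>] 0) (𝓝 0) := by
    have : Continuous fun ρ : ℝ => 6 * ρ / κ ^ 2 + 12 * √ρ / κ := by fun_prop
    have h0 := this.tendsto 0
    simp only [mul_zero, zero_div, Real.sqrt_zero, add_zero] at h0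
    exact h0.mono_left nhdsWithin_le_nhds
  obtain ⟨ρ, hρ8, hρ0, hρ1⟩ := ((hρt.eventually_lt_const (by positivity : 0 < ε / 8)).and
    (Ioc_mem_nhdsGT zero_lt_one)).exists
  set θ := ε / 8 * √q₀ with hθ
  set η := min (q₀ / 2) (ε / 8 / (M + 1) * (q₀ * √q₀)) with hη
  have hη0 : 0 < η := by positivity
  have hη8 : M * (η / (q₀ * √q₀)) ≤ ε / 8 := by
    have h1 : η / (q₀ * √q₀) ≤ ε / 8 / (M + 1) := by
      rw [div_le_iff₀ (by positivity)]
      exact min_le_right _ _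
    calc M * (η / (q₀ * √q₀)) ≤ (M + 1) * (ε / 8 / (M + 1)) := by gcongr; linarith
      _ = ε / 8 := by field_simp
  have hθ8 : θ / √q₀ = ε / 8 := by
    rw [hθ]
    field_simp
  filter_upwards [h κ ρ θ η hκ0 (min_le_left _ _) hρ0 hρ1 (by positivity) hη0 (min_le_left _ _),
    (hr κ ρ θ η hκ0 hρ0 (by positivity) hη0).eventually_lt_const (by positivity : 0 < ε / 8)]
    with j h1 h2
  rw [Real.dist_eq, sub_zero]
  linarith

end Asymptotics

end XssMMD

theorem mainTheorem9
    (α : ℝ) (hα : α ∈ Set.Ioo (0 : ℝ) 1)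
    -- sample size and dimension along the sequence of experiments
    (n d : ℕ → ℕ) (hn : Tendsto n atTop atTop) (hn_even : ∀ j, Even (n j))
    (τ : ℝ) (hτ : 0 < τ)
    (hd : Tendsto (fun j => (d j : ℝ) / (n j : ℝ)) atTop (𝓝 τ))
    -- means and the common covariance matrix of `(X, V)` and `(Y, W)`
    (μX μV μY μW : ∀ j, XssMMD.Vec (d j))
    (S11 S12 S21 S22 : ∀ j, Matrix (Fin (d j)) (Fin (d j)) ℝ)
    (hS : ∀ j, (Matrix.fromBlocks (S11 j) (S12 j) (S21 j) (S22 j)).PosSemidef)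
    -- bounded eigenvalues
    (c C : ℝ) (hc : 0 < c)
    (h11 : ∀ j, spectrum ℝ (S11 j) ⊆ Set.Icc c C)
    (h22 : ∀ j, spectrum ℝ (S22 j) ⊆ Set.Icc c C)
    -- local alternative
    (hμX : (fun j => ‖μX j‖ ^ 2) =O[atTop] fun j => √(d j : ℝ) / (n j : ℝ))
    (hμY : (fun j => ‖μY j‖ ^ 2) =O[atTop] fun j => √(d j : ℝ) / (n j : ℝ))
    -- the laws of `(X, V)` and of `(Y, W)`
    (P Q : ∀ j, Measure (XssMMD.Vec (d j) × XssMMD.Vec (d j)))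
    (hP : ∀ j, P j = XssMMD.gaussianPair (μX j) (μV j) (S11 j) (S12 j) (S21 j) (S22 j))
    (hQ : ∀ j, Q j = XssMMD.gaussianPair (μY j) (μW j) (S11 j) (S12 j) (S21 j) (S22 j))
    -- the regression procedures and their consistency
    (estX estY : ∀ j, XssMMD.Regression (d j) (n j / 2))
    (hestX : ∀ j, XssMMD.MeasurableRegression XssMMD.linearKernel (n j) (n j) (estX j))
    (hestY : ∀ j, XssMMD.MeasurableRegression XssMMD.linearKernel (n j) (n j) (estY j))
    (hconsX : ∀ ε : ℝ≥0∞, 0 < ε → Tendsto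
      (fun j => XssMMD.dataLaw (P j) (Q j) (n j) (n j) (n j) (n j)
        {D | ε ≤ XssMMD.relMSE (P j) (estX j) (XssMMD.dataWitness XssMMD.linearKernel D)})
      atTop (𝓝 0))
    (hconsY : ∀ ε : ℝ≥0∞, 0 < ε → Tendsto
      (fun j => XssMMD.dataLaw (P j) (Q j) (n j) (n j) (n j) (n j)
        {D | ε ≤ XssMMD.relMSE (Q j) (estY j) (XssMMD.dataWitness XssMMD.linearKernel D)})
      atTop (𝓝 0)) :
    Tendsto
      (fun j =>
        XssMMD.power XssMMD.linearKernel (P j) (Q j) (n j) (n j) (n j) (n j)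
            (estX j) (estY j) α
          - XssMMD.Phi (XssMMD.z α + (n j : ℝ) * ‖μX j - μY j‖ ^ 2 /
              √(4 * (S11 j ^ 2).trace
                - 2 * (S12 j * (S22 j)⁻¹ * S21 j * S11 j).trace)))
      atTop (𝓝 0) := by
  -- Positivity of `C` is not assumed, and the spectra give no information in dimension zero;
  -- enlarging `C` is harmless.
  obtain ⟨C', hC', hC0⟩ : ∃ C' : ℝ, C ≤ C' ∧ 0 < C' := ⟨max C 1, le_max_left _ _, by positivity⟩
  have h11' : ∀ j, spectrum ℝ (S11 j) ⊆ Set.Icc c C' := fun j =>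
    (h11 j).trans (Set.Icc_subset_Icc_right hC')
  have hU : ∀ j, IsUnit (S22 j) := fun j => XssMMD.isUnit_of_spectrum_subset hc (h22 j)
  have hδ := XssMMD.norm_sub_sq_isBigO hμX hμY
  obtain ⟨M, hM, hMb⟩ := XssMMD.exists_sqrt_mul_le_of_isBigO hd hδ
  have hδ0 := XssMMD.tendsto_zero_of_sqrt_mul_le hn (fun j => sq_nonneg ‖μX j - μY j‖) hMb
  -- Eventually `d / n > τ / 2`, so this is a lower bound for `tr (A T)`.
  have hq₀ : 0 < c ^ 2 * (τ / 2) := by positivity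
  have hs : Tendsto (fun j => √(n j : ℝ)) atTop atTop :=
    Real.tendsto_sqrt_atTop.comp (tendsto_natCast_atTop_atTop.comp hn)
  refine XssMMD.tendsto_zero_of_forall_le hq₀ (abs_nonneg (XssMMD.z (1 - α))) hM
    (fun κ ρ θ η j => 4 * (2 * (XssMMD.fourthMoment + 2) / √(n j)) / κ +
      ((XssMMD.dataLaw (P j) (Q j) (n j) (n j) (n j) (n j) {D | ENNReal.ofReal ρ ≤
          XssMMD.relMSE (P j) (estX j) (XssMMD.dataWitness XssMMD.linearKernel D)}).toReal +
        (XssMMD.dataLaw (P j) (Q j) (n j) (n j) (n j) (n j) {D | ENNReal.ofReal ρ ≤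
          XssMMD.relMSE (Q j) (estY j) (XssMMD.dataWitness XssMMD.linearKernel D)}).toReal +
        (3 * (d j * (XssMMD.fourthMoment * (C' * (2 / n j * C')) ^ 2)) +
          12 * (2 / n j * C' * (C' ^ 2 * ‖μX j - μY j‖ ^ 2)) +
          3 * (C' * ‖μX j - μY j‖ ^ 2) ^ 2) / η ^ 2 +
        2 * C' * ‖μX j - μY j‖ ^ 2 / θ ^ 2)) ?_ ?_
  · intro κ ρ θ η hκ hρ hθ hη
    have h1 := ((hs.const_div_atTop (2 * (XssMMD.fourthMoment + 2))).const_mul 4).div_const κ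
    have h2 := (ENNReal.tendsto_toReal ENNReal.zero_ne_top).comp
      (hconsX (ENNReal.ofReal ρ) (ENNReal.ofReal_pos.2 hρ))
    have h3 := (ENNReal.tendsto_toReal ENNReal.zero_ne_top).comp
      (hconsY (ENNReal.ofReal ρ) (ENNReal.ofReal_pos.2 hρ))
    have h4 := (XssMMD.tendsto_quadratic_variance hn hd hδ0 XssMMD.fourthMoment C').div_const
      (η ^ 2)
    have h5 := (hδ0.const_mul (2 * C')).div_const (θ ^ 2)
    have h6 := h1.add (((h2.add h3).add h4).add h5)
    simpa using h6
  · intro κ ρ θ η hκ hκ1 hρ hρ1 hθ hη hηq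
    filter_upwards [hMb, hn.eventually_gt_atTop 0, hd.eventually_const_lt (half_lt_self hτ)]
      with j hMj hnj hdj
    have hq : c ^ 2 * (τ / 2) ≤ _ :=
      (mul_le_mul_of_nonneg_left hdj.le (sq_nonneg c)).trans
        (XssMMD.le_trace_oracleCov_mul (n := n j) (hS j) hc (h11' j) (hU j))
    rw [XssMMD.mul_div_sqrt_eq_drift hnj]
    refine (XssMMD.abs_power_sub_le (hS j) (hn_even j) hnj hC0 (h11' j) (hU j) (hestX j)
      (hestY j) hα hρ hρ1 hκ hκ1 hθ hη hq₀ hηq hq (hP j) (hQ j)).trans ?_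
    have hB : √(n j : ℝ) * ‖μX j - μY j‖ ^ 2 * (η / (c ^ 2 * (τ / 2) * √(c ^ 2 * (τ / 2)))) ≤
        M * (η / (c ^ 2 * (τ / 2) * √(c ^ 2 * (τ / 2)))) := by gcongr
    have hE : 4 * (3 * √ρ + 2 * (XssMMD.fourthMoment + 2) / √(n j)) / κ =
        12 * √ρ / κ + 4 * (2 * (XssMMD.fourthMoment + 2) / √(n j)) / κ := by ring
    rw [hE]
    linarith
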